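/- \textbf{Setting.} An elementary gate is an arbitrary unitary on one or two qubits. Finite-dimensional Hilbert spaces are held in qubit registers by injectively assigning bit strings to the vectors of an orthonormal basis; a circuit implements a unitary on such a space (or on a tensor product of such spaces, held in the union of the registers) if it acts as this unitary on the encoded subspace. Let $\mathcal H=\mathbb C^D$, and write $|\cdot|$ for the largest singular value. Let $\alpha>0$. An \emph{$\alpha$-scaled $Q$-block-encoding} of a matrix $A$ on $\mathcal H$ with $|A|\le\alpha$ is a unitary $U_A$ on $\mathbb C^k\otimes\mathcal H$, for some $k\ge 1$, implemented by a circuit of at most $Q$ elementary gates, with $(\langle 0|_k\otimes I)\,U_A\,(|0\rangle_k\otimes I)=A/\alpha$. Let $|\mathbf 0\rangle\in\mathcal H$ be an easy-to-prepare state, that is, a known state which is a product state of the qubits that hold $\mathcal H$ (for example a computational basis state). An \emph{$R$-preparation-unitary} of a density operator $\rho$ on $\mathcal H$ is a unitary $U_\rho$ on $\mathcal H\otimes\mathbb C^l$, for some $l\ge1$, implemented by a circuit of at most $R$ elementary gates, such that $\rho=\mathrm{Tr}_{\mathbb C^l}(|\rho\rangle\langle\rho|)$ for $|\rho\rangle=U_\rho(|\mathbf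 0\rangle|0\rangle_l)$. An \emph{algorithm} here is an adaptive classical protocol, with free uniform classical random choices, which repeatedly runs a quantum circuit on qubits initialised to $|0\cdots0\rangle$, measures all qubits in the computational basis, and finally outputs a real number. A circuit consists of elementary gates and of black-box calls to (the circuits for) $U_A$ and $U_\rho$, to their inverses, and to singly controlled versions of all these. The algorithm may depend on the register sizes, the encodings, $|\mathbf 0\rangle$, $\alpha,\varepsilon,\delta,Q,R$ and on the sets of qubits touched by the two given circuits, but not on $A$, $\rho$ or the unitaries themselves. Its \emph{circuit complexity} is the worst-case total number of elementary gates in all circuits run, each call being charged the least number of elementary gates that performs it exactly. \textbf{Lemma.} There is an absolute constant $C>0$ such that the following holds. For all $\varepsilon>0$ and $0<\delta\le 1$, and for all values of the other parameters above, there is one algorithm such that, whenever $A$ is Hermitian and is given by an $\alpha$-scaled $Q$-block-encoding and the density operator $\rho$ is given by an $R$-preparation-unitary (with these parameters), its output $\xi$ satisfies $$|\xi-\mathrm{Tr}(\rho A)|\le\varepsilon$$ with probability at least $1-\delta$, and its circuit complexity is at most $$C\,(R+Q)\cdot\frac{\alpha}{\varepsilon}\,\log\frac1\delta .$$ -/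

import Mathlib

noncomputable section

namespace QEst

/-! Qubit registers.  The qubits of a register are the elements of a finite type `ι`, its
computational basis is `ι → Bool`, and operators on it are matrices indexed by `ι → Bool`
(row = output, column = input). -/

/-- Operators on the register with set of qubits `ι`. -/
abbrev Op (ι : Type) : Type := Matrix (ι → Bool) (ι → Bool) ℂ

open Classical in
/-- The operator on the register `ι` that acts as `U` on the qubits selected by `wires` and as the
identity on all other qubits. -/
def place {r ι : Type} (wires : r ↪ ι) (U : Op r) : Op ι :=
  Matrix.of fun x y =>
    if ∀ i, i ∉ Set.range wires → x i = y i then U (x ∘ wires) (y ∘ wires) else 0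

/-- `M` controlled by the qubit `q` (used only for operators `M` that do not act on `q`). -/
def controlled {ι : Type} [DecidableEq ι] [Fintype ι] (q : ι) (M : Op ι) : Op ι :=
  Matrix.of fun x y => if y q = true then M x y else (1 : Op ι) x y

/-- An elementary gate on the register `ι`: any unitary on one or two of its qubits. -/
structure Gate (ι : Type) where
  arity : ℕ
  one_le_arity : 1 ≤ arity
  arity_le_two : arity ≤ 2
  wires : Fin arity ↪ ι
  U : Op (Fin arity)
  unitary_U : U ∈ Matrix.unitaryGroup (Fin arity → Bool) ℂ

/-- The unitary on the whole register performed by a gate. -/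
def Gate.matrix {ι : Type} (g : Gate ι) : Op ι := place g.wires g.U

/-- A circuit is a list of elementary gates, the head being applied first. -/
abbrev Circuit (ι : Type) : Type := List (Gate ι)

/-- The unitary performed by a circuit. -/
def Circuit.matrix {ι : Type} [DecidableEq ι] [Fintype ι] : Circuit ι → Op ι
  | [] => 1
  | g :: c => Circuit.matrix c * g.matrix

/-- The qubits on which at least one gate of the circuit acts. -/
def Circuit.support {ι : Type} (c : Circuit ι) : Set ι :=
  {q | ∃ g ∈ c, q ∈ Set.range g.wires}

/-- The least number of elementary gates of a circuit performing exactly `W` (`⊤` if none). -/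
def circuitComplexity {ι : Type} [DecidableEq ι] [Fintype ι] (W : Op ι) : ℕ∞ :=
  ⨅ (c : Circuit ι) (_ : c.matrix = W), (c.length : ℕ∞)

/-! Block-encodings and preparation unitaries.  The Hilbert spaces `ℂ^D`, `ℂ^k`, `ℂ^l` are held in
qubit registers by injective maps from their basis vectors to bit strings. -/

/-- The encoding of `ℂ^k ⊗ ℂ^D` obtained from encodings of the factors. -/
def encPair {k D a n : ℕ} (e : Fin k ↪ (Fin a → Bool)) (f : Fin D ↪ (Fin n → Bool)) :
    Fin k × Fin D → (Fin a ⊕ Fin n → Bool) :=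
  fun p => Sum.elim (e p.1) (f p.2)

/-- The circuit `c` acts as `U` on the encoded subspace.  (For unitary `U` and injective `enc` the
equality of the matrix entries forces this subspace to be invariant.) -/
def Circuit.Implements {ι Y : Type} [DecidableEq ι] [Fintype ι] (c : Circuit ι)
    (enc : Y → (ι → Bool)) (U : Matrix Y Y ℂ) : Prop :=
  c.matrix.submatrix enc enc = U

/-- The largest singular value. -/
def opNorm {D : ℕ} (A : Matrix (Fin D) (Fin D) ℂ) : ℝ :=
  ‖Matrix.toEuclideanCLM (n := Fin D) (𝕜 := ℂ) A‖

/-- The block `(⟨0|_k ⊗ I) U (|0⟩_k ⊗ I)`. -/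
def zeroBlock {k D : ℕ} [NeZero k] (U : Matrix (Fin k × Fin D) (Fin k × Fin D) ℂ) :
    Matrix (Fin D) (Fin D) ℂ :=
  Matrix.of fun x y => U (0, x) (0, y)

/-- An `acc`-accurate `α`-scaled `Q`-block-encoding of `A`: a unitary `U` on `ℂ^k ⊗ ℂ^D`
and a circuit of at most `Q` elementary gates for it. -/
structure BlockEncoding {k D a n : ℕ} [NeZero k]
    (encK : Fin k ↪ (Fin a → Bool)) (encH : Fin D ↪ (Fin n → Bool))
    (acc α : ℝ) (Q : ℕ) (A : Matrix (Fin D) (Fin D) ℂ) where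
  U : Matrix (Fin k × Fin D) (Fin k × Fin D) ℂ
  unitary_U : U ∈ Matrix.unitaryGroup (Fin k × Fin D) ℂ
  circuit : Circuit (Fin a ⊕ Fin n)
  length_le : circuit.length ≤ Q
  implements : circuit.Implements (encPair encK encH) U
  norm_le : opNorm A ≤ α
  accurate : opNorm ((α : ℂ)⁻¹ • A - zeroBlock U) ≤ acc

open scoped ComplexOrder in
/-- Density operators on `ℂ^D`. -/
def IsDensityOperator {D : ℕ} (ρ : Matrix (Fin D) (Fin D) ℂ) : Prop :=
  ρ.PosSemidef ∧ ρ.trace = 1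

/-- `z ∈ ℂ^D` is an easy-to-prepare state: as a state of the register of `n` qubits it is a product
of states of single qubits (for example a computational basis state), that is, it arises from
`|0⋯0⟩` by one layer of one-qubit gates. -/
def EasyToPrepare {D n : ℕ} (encH : Fin D ↪ (Fin n → Bool)) (z : Fin D → ℂ) : Prop :=
  ∃ φ : Fin n → Bool → ℂ,
    (∀ i, ‖φ i false‖ ^ 2 + ‖φ i true‖ ^ 2 = 1) ∧
    ∀ s : Fin n → Bool, (∑ x, if encH x = s then z x else 0) = ∏ i, φ i (s i)

/-- The state `U (|z⟩ |0⟩_l)`. -/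
def preparedState {D l : ℕ} [NeZero l] (U : Matrix (Fin D × Fin l) (Fin D × Fin l) ℂ)
    (z : Fin D → ℂ) : Fin D × Fin l → ℂ :=
  U.mulVec fun p => if p.2 = 0 then z p.1 else 0

/-- The partial trace over `ℂ^l` of `|ψ⟩⟨ψ|`. -/
def reducedState {D l : ℕ} (ψ : Fin D × Fin l → ℂ) : Matrix (Fin D) (Fin D) ℂ :=
  Matrix.of fun x y => ∑ j, ψ (x, j) * star (ψ (y, j))

/-- An `R`-preparation-unitary of `ρ` (starting from the state `z` of `ℂ^D`): a unitary `U` on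
`ℂ^D ⊗ ℂ^l` and a circuit of at most `R` elementary gates for it. -/
structure PreparationUnitary {D l n b : ℕ} [NeZero l]
    (encH : Fin D ↪ (Fin n → Bool)) (encL : Fin l ↪ (Fin b → Bool))
    (z : Fin D → ℂ) (R : ℕ) (ρ : Matrix (Fin D) (Fin D) ℂ) where
  U : Matrix (Fin D × Fin l) (Fin D × Fin l) ℂ
  unitary_U : U ∈ Matrix.unitaryGroup (Fin D × Fin l) ℂ
  circuit : Circuit (Fin n ⊕ Fin b)
  length_le : circuit.length ≤ R
  implements : circuit.Implements (encPair encH encL) U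
  prepares : reducedState (preparedState U z) = ρ

/-! Quantum algorithms with black-box access to two unitaries `V₁`, `V₂` on registers `r₁`, `r₂`.
The description of an algorithm does not mention the two unitaries; they enter only when it is
run.  All gates executed are charged, those needed for the black boxes included. -/

/-- One step of a circuit on `m` qubits: an elementary gate, or a call of one of the black boxes, or
of its inverse (`inv = true`), on chosen wires, possibly controlled by one further qubit. -/
inductive Instr (r₁ r₂ : Type) (m : ℕ) : Type
  | gate (g : Gate (Fin m))
  | call₁ (wires : r₁ ↪ Fin m) (inv : Bool) (ctrl : Option (Fin m))
      (h : ∀ q ∈ ctrl, q ∉ Set.range wires)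
  | call₂ (wires : r₂ ↪ Fin m) (inv : Bool) (ctrl : Option (Fin m))
      (h : ∀ q ∈ ctrl, q ∉ Set.range wires)

/-- The operator on `m` qubits performed by a call of the black box `V`. -/
def callMatrix {r : Type} {m : ℕ} (V : Op r) (wires : r ↪ Fin m) (inv : Bool)
    (ctrl : Option (Fin m)) : Op (Fin m) :=
  let W := place wires (if inv then V.conjTranspose else V)
  match ctrl with
  | none => W
  | some q => controlled q W

/-- The operator performed by an instruction. -/
def Instr.matrix {r₁ r₂ : Type} {m : ℕ} (V₁ : Op r₁) (V₂ : Op r₂) : Instr r₁ r₂ m → Op (Fin m)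
  | .gate g => g.matrix
  | .call₁ wires inv ctrl _ => callMatrix V₁ wires inv ctrl
  | .call₂ wires inv ctrl _ => callMatrix V₂ wires inv ctrl

/-- The number of elementary gates spent on an instruction.  A call of a black box is charged the
number of elementary gates needed to perform it. -/
def Instr.cost {r₁ r₂ : Type} {m : ℕ} (V₁ : Op r₁) (V₂ : Op r₂) : Instr r₁ r₂ m → ℕ∞
  | .gate _ => 1
  | .call₁ wires inv ctrl _ => circuitComplexity (callMatrix V₁ wires inv ctrl)
  | .call₂ wires inv ctrl _ => circuitComplexity (callMatrix V₂ wires inv ctrl)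

/-- The operator performed by a list of instructions, the head being applied first. -/
def programMatrix {r₁ r₂ : Type} {m : ℕ} (V₁ : Op r₁) (V₂ : Op r₂) :
    List (Instr r₁ r₂ m) → Op (Fin m)
  | [] => 1
  | s :: p => programMatrix V₁ V₂ p * s.matrix V₁ V₂

/-- The number of elementary gates spent on a list of instructions. -/
def programCost {r₁ r₂ : Type} {m : ℕ} (V₁ : Op r₁) (V₂ : Op r₂)
    (p : List (Instr r₁ r₂ m)) : ℕ∞ :=
  (p.map (Instr.cost V₁ V₂)).sum

/-- Algorithms that return a real number.  `output ξ` returns `ξ`.  `toss N next` draws a uniformly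
random element of `Fin (N + 1)` classically and goes on accordingly.  `run m p next` runs the
circuit `p` on `m` qubits in the initial state `|0⋯0⟩`, measures all qubits in the computational
basis and goes on according to the outcome. -/
inductive Algorithm (r₁ r₂ : Type) : Type
  | output (ξ : ℝ)
  | toss (N : ℕ) (next : Fin (N + 1) → Algorithm r₁ r₂)
  | run (m : ℕ) (p : List (Instr r₁ r₂ m)) (next : (Fin m → Bool) → Algorithm r₁ r₂)

open Classical in
/-- The probability that the returned number lies in `S`. -/
def Algorithm.prob {r₁ r₂ : Type} (V₁ : Op r₁) (V₂ : Op r₂) (S : Set ℝ) :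
    Algorithm r₁ r₂ → ℝ
  | .output ξ => if ξ ∈ S then 1 else 0
  | .toss N next => (∑ i, Algorithm.prob V₁ V₂ S (next i)) / ((N : ℝ) + 1)
  | .run _ p next =>
      ∑ x, ‖programMatrix V₁ V₂ p x (fun _ => false)‖ ^ 2 * Algorithm.prob V₁ V₂ S (next x)

/-- The total number of elementary gates of all circuits that are run, in the worst case. -/
def Algorithm.cost {r₁ r₂ : Type} (V₁ : Op r₁) (V₂ : Op r₂) : Algorithm r₁ r₂ → ℕ∞
  | .output _ => 0
  | .toss _ next => ⨆ i, Algorithm.cost V₁ V₂ (next i)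
  | .run _ p next => programCost V₁ V₂ p + ⨆ x, Algorithm.cost V₁ V₂ (next x)

end QEst

end

open QEst

noncomputable section

namespace QEst

open Function
open scoped Matrix

/-! Let `M` prepare the purification of `ρ` from `|0⋯0⟩` and put `t = Tr(ρA)/α`. Then `⟨0|M† U_A
M|0⟩ = t`, a real number in `[-1, 1]` (`expectation_touched`, `exists_expectation`). One ancilla,
rotated by angles `u`, `v` around a controlled call of `U_A`, gives a unitary `B` with `⟨0|B|0⟩ =
cos u cos v + t sin u sin v`, so an affine function of `t` becomes an amplitude `sin x`. With `S`
the reflection about `|0⋯0⟩`, the operator `(B S B† S)^j B` returns to `|0⋯0⟩` with probability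
`sin²((2j+1)x)` (`amplification_apply`).

Suppose `t` is known to lie in `[c - w, c + w]`. The angles are chosen so that `x` sits near
`π/(4(2j+1))`, where the amplified probability is `1/2` and steepest. With `j` of order `1/w`, the
probability is at least `21/40` or at most `19/40` when `t` lies in the upper or lower third
(`amplified_bias`). A majority vote then discards an outer third. In the middle third both answers
are right. Each round shrinks the interval by `2/3` and costs `O((R+Q)/w)` per vote.

Costs grow geometrically, so the early rounds are cheap and can afford more votes. With a number of
votes growing linearly in the number of remaining rounds, the failure probabilities sum to at most
`exp(-Λ)`, while the last rounds dominate the total cost `O((R+Q)(α/ε)(Λ+3))`. No extra logarithm of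
`α/ε` appears (`search_prob_ge`, `search_cost_le`).

For `δ` near `1` the budget `log(1/δ)` tends to zero. The search is then stopped at half-width
`(G+1)ε/α` and one of `G+1` grid points is guessed at random, which divides both the cost and the
success probability by `G+1` (`exists_algorithm`).

The gate count must not depend on the register sizes. Only touched qubits, at most `2(R+Q)` of them,
are prepared and reflected, since the preparation of the others cancels in `M† U_A M`. Control is
exact and costs at most seven gates per gate, by diagonalizing (`Gate.exists_circuit_controlled`).
-/

/-! ### Operators placed on selected qubits. -/

theorem place_of_agree {r ι : Type} (w : r ↪ ι) (U : Op r) {x y : ι → Bool}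
    (h : ∀ i, i ∉ Set.range w → x i = y i) : place w U x y = U (x ∘ w) (y ∘ w) := by
  simp only [place, Matrix.of_apply, if_pos h]

theorem place_of_not_agree {r ι : Type} (w : r ↪ ι) (U : Op r) {x y : ι → Bool}
    (h : ¬ ∀ i, i ∉ Set.range w → x i = y i) : place w U x y = 0 := by
  simp only [place, Matrix.of_apply, if_neg h]

theorem extend_comp_eq {r ι : Type} (w : r ↪ ι) (u : r → Bool) (x : ι → Bool) :
    extend w u x ∘ w = u := by
  funext j; exact w.injective.extend_apply u x j

theorem extend_off {r ι : Type} (w : r ↪ ι) (u : r → Bool) (x : ι → Bool) {i : ι}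
    (h : i ∉ Set.range w) : extend w u x i = x i :=
  extend_apply' u x i (fun ⟨a, ha⟩ => h ⟨a, ha⟩)

theorem extend_self_of_agree {r ι : Type} (w : r ↪ ι) {x y : ι → Bool}
    (h : ∀ i, i ∉ Set.range w → x i = y i) : extend w (y ∘ w) x = y := by
  funext i
  by_cases hi : i ∈ Set.range w
  · obtain ⟨j, rfl⟩ := hi
    exact w.injective.extend_apply _ _ j
  · rw [extend_off w _ _ hi, h i hi]

/-- Row `x` of `place w U` is supported on the strings that differ from `x` only on `w`, and `extend
w · x` parametrizes these. -/
theorem sum_place_mul {r ι : Type} [Fintype r] [DecidableEq r] [Fintype ι] [DecidableEq ι]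
    (w : r ↪ ι) (U : Op r) (x : ι → Bool) (F : (ι → Bool) → ℂ) :
    ∑ z, place w U x z * F z = ∑ u, U (x ∘ w) u * F (extend w u x) := by
  symm
  apply Fintype.sum_of_injective (fun u => extend w u x)
  · intro u v huv
    have := congrArg (fun f => f ∘ w) huv
    simpa only [extend_comp_eq] using this
  · intro z hz
    rw [place_of_not_agree, zero_mul]
    intro h
    exact hz ⟨z ∘ w, extend_self_of_agree w h⟩
  · intro u
    rw [place_of_agree w U (fun i hi => (extend_off w u x hi).symm), extend_comp_eq]

theorem place_mul {r ι : Type} [Fintype r] [DecidableEq r] [Fintype ι] [DecidableEq ι]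
    (w : r ↪ ι) (U V : Op r) : place w (U * V) = place w U * place w V := by
  ext x y
  rw [Matrix.mul_apply, sum_place_mul]
  by_cases h : ∀ i, i ∉ Set.range w → x i = y i
  · rw [place_of_agree w _ h, Matrix.mul_apply]
    refine Finset.sum_congr rfl fun u _ => ?_
    rw [place_of_agree w V (fun i hi => (extend_off w u x hi).trans (h i hi)), extend_comp_eq]
  · rw [place_of_not_agree w _ h]
    symm
    refine Finset.sum_eq_zero fun u _ => ?_
    rw [place_of_not_agree w V (fun h' => h fun i hi => by rw [← h' i hi, extend_off w u x hi]),
      mul_zero]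

theorem eq_iff_agree {r ι : Type} (w : r ↪ ι) {x y : ι → Bool} :
    x = y ↔ (∀ i, i ∉ Set.range w → x i = y i) ∧ x ∘ w = y ∘ w := by
  constructor
  · rintro rfl; exact ⟨fun _ _ => rfl, rfl⟩
  · rintro ⟨h, h'⟩
    rw [← extend_self_of_agree w h, ← h', extend_self_of_agree w (fun _ _ => rfl)]

theorem place_one {r ι : Type} [Fintype r] [DecidableEq r] [Fintype ι] [DecidableEq ι]
    (w : r ↪ ι) : place w (1 : Op r) = 1 := by
  ext x y
  by_cases h : ∀ i, i ∉ Set.range w → x i = y i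
  · rw [place_of_agree w _ h, Matrix.one_apply, Matrix.one_apply]
    by_cases h' : x ∘ w = y ∘ w
    · rw [if_pos h', if_pos ((eq_iff_agree w).2 ⟨h, h'⟩)]
    · rw [if_neg h', if_neg fun e => h' ((eq_iff_agree w).1 e).2]
  · rw [place_of_not_agree w _ h, Matrix.one_apply_ne]
    rintro rfl; exact h fun _ _ => rfl

theorem place_conjTranspose {r ι : Type} (w : r ↪ ι) (U : Op r) :
    (place w U).conjTranspose = place w U.conjTranspose := by
  ext x y
  rw [Matrix.conjTranspose_apply]
  by_cases h : ∀ i, i ∉ Set.range w → x i = y i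
  · rw [place_of_agree w _ h, place_of_agree w _ (fun i hi => (h i hi).symm),
      Matrix.conjTranspose_apply]
  · rw [place_of_not_agree w _ h, place_of_not_agree w _
      (fun h' => h fun i hi => (h' i hi).symm), star_zero]

theorem place_place {s r ι : Type} (w : r ↪ ι) (v : s ↪ r) (U : Op s) :
    place w (place v U) = place (v.trans w) U := by
  ext x y
  have key : (∀ i, i ∉ Set.range (v.trans w) → x i = y i) ↔
      (∀ i, i ∉ Set.range w → x i = y i) ∧ ∀ j, j ∉ Set.range v → (x ∘ w) j = (y ∘ w) j := by
    constructor
    · refine fun h => ⟨fun i hi => h i ?_, fun j hj => h (w j) ?_⟩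
      · rintro ⟨j, rfl⟩; exact hi ⟨v j, rfl⟩
      · rintro ⟨t, ht⟩; exact hj ⟨t, w.injective ht⟩
    · rintro ⟨h1, h2⟩ i hi
      by_cases hw : i ∈ Set.range w
      · obtain ⟨j, rfl⟩ := hw
        refine h2 j ?_
        rintro ⟨t, rfl⟩; exact hi ⟨t, rfl⟩
      · exact h1 i hw
  by_cases h : ∀ i, i ∉ Set.range (v.trans w) → x i = y i
  · obtain ⟨h1, h2⟩ := key.1 h
    rw [place_of_agree _ _ h, place_of_agree _ _ h1, place_of_agree _ _ h2]
    rfl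
  · rw [place_of_not_agree _ _ h]
    by_cases h1 : ∀ i, i ∉ Set.range w → x i = y i
    · rw [place_of_agree _ _ h1, place_of_not_agree]
      exact fun h2 => h (key.2 ⟨h1, h2⟩)
    · rw [place_of_not_agree _ _ h1]

theorem place_mem_unitaryGroup {r ι : Type} [Fintype r] [DecidableEq r] [Fintype ι]
    [DecidableEq ι] (w : r ↪ ι) {U : Op r} (hU : U ∈ Matrix.unitaryGroup (r → Bool) ℂ) :
    place w U ∈ Matrix.unitaryGroup (ι → Bool) ℂ := by
  rw [Matrix.mem_unitaryGroup_iff, Matrix.star_eq_conjTranspose] at hU ⊢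
  rw [place_conjTranspose, ← place_mul, hU, place_one]

theorem place_mul_place_apply {r s ι : Type} [Fintype ι] [DecidableEq ι] (w : r ↪ ι) (v : s ↪ ι)
    (hd : Disjoint (Set.range w) (Set.range v)) (U : Op r) (V : Op s) (x y : ι → Bool)
    (h : ∀ i, i ∉ Set.range w → i ∉ Set.range v → x i = y i) :
    (place w U * place v V) x y = U (x ∘ w) (y ∘ w) * V (x ∘ v) (y ∘ v) := by
  classical
  -- The only intermediate string reachable from both sides has the bits of `y` on `w` and those of
  -- `x` elsewhere.
  rw [Matrix.mul_apply, Finset.sum_eq_single (extend w (y ∘ w) x)]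
  · rw [place_of_agree w U (fun i hi => (extend_off w _ x hi).symm), extend_comp_eq,
      place_of_agree v V]
    · congr 2
      funext j
      exact extend_off w _ x (Set.disjoint_right.1 hd ⟨j, rfl⟩)
    · intro i hi
      by_cases hw : i ∈ Set.range w
      · obtain ⟨j, rfl⟩ := hw
        exact w.injective.extend_apply _ _ j
      · rw [extend_off w _ x hw]; exact h i hw hi
  · intro z _ hz
    by_cases h1 : ∀ i, i ∉ Set.range w → x i = z i
    · by_cases h2 : ∀ i, i ∉ Set.range v → z i = y i
      · refine absurd ?_ hz
        rw [← extend_self_of_agree w h1]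
        congr 1
        funext j
        exact h2 _ (Set.disjoint_left.1 hd ⟨j, rfl⟩)
      · rw [place_of_not_agree v V h2, mul_zero]
    · rw [place_of_not_agree w U h1, zero_mul]
  · simp

theorem place_mul_place_eq_zero {r s ι : Type} [Fintype ι] [DecidableEq ι] (w : r ↪ ι) (v : s ↪ ι)
    (U : Op r) (V : Op s) (x y : ι → Bool)
    (h : ¬ ∀ i, i ∉ Set.range w → i ∉ Set.range v → x i = y i) :
    (place w U * place v V) x y = 0 := by
  rw [Matrix.mul_apply]
  refine Finset.sum_eq_zero fun z _ => ?_
  by_cases h1 : ∀ i, i ∉ Set.range w → x i = z i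
  · rw [place_of_not_agree v V (fun h2 => h fun i hw hv => (h1 i hw).trans (h2 i hv)), mul_zero]
  · rw [place_of_not_agree w U h1, zero_mul]

theorem place_commute {r s ι : Type} [Fintype ι] [DecidableEq ι] (w : r ↪ ι) (v : s ↪ ι)
    (hd : Disjoint (Set.range w) (Set.range v)) (U : Op r) (V : Op s) :
    Commute (place w U) (place v V) := by
  ext x y
  by_cases h : ∀ i, i ∉ Set.range w → i ∉ Set.range v → x i = y i
  · rw [place_mul_place_apply w v hd U V x y h,
      place_mul_place_apply v w hd.symm V U x y (fun i h1 h2 => h i h2 h1), mul_comm]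
  · rw [place_mul_place_eq_zero w v U V x y h,
      place_mul_place_eq_zero v w V U x y (fun h' => h fun i h1 h2 => h' i h2 h1)]

/-! ### Operators confined to a set of qubits. -/

/-- `M` acts trivially on the qubits outside `T`, in the sense that it does not change them. -/
def Fixes {ι : Type} (T : Set ι) (M : Op ι) : Prop :=
  ∀ x y, M x y ≠ 0 → ∀ i, i ∉ T → x i = y i

theorem Fixes.mono {ι : Type} {T T' : Set ι} {M : Op ι} (h : Fixes T M) (hT : T ⊆ T') :
    Fixes T' M := fun x y hxy i hi => h x y hxy i fun h' => hi (hT h')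

theorem Fixes.one {ι : Type} [Fintype ι] [DecidableEq ι] (T : Set ι) : Fixes T (1 : Op ι) := by
  intro x y hxy i _
  by_contra h
  exact hxy (Matrix.one_apply_ne fun h' => h (congrFun h' i))

theorem Fixes.mul {ι : Type} [Fintype ι] [DecidableEq ι] {T : Set ι} {M N : Op ι}
    (hM : Fixes T M) (hN : Fixes T N) : Fixes T (M * N) := by
  intro x y hxy i hi
  rw [Matrix.mul_apply] at hxy
  obtain ⟨z, _, hz⟩ := Finset.exists_ne_zero_of_sum_ne_zero hxy
  exact (hM x z (left_ne_zero_of_mul hz) i hi).trans (hN z y (right_ne_zero_of_mul hz) i hi)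

theorem Fixes.conjTranspose {ι : Type} {T : Set ι} {M : Op ι} (hM : Fixes T M) :
    Fixes T M.conjTranspose := by
  intro x y hxy i hi
  rw [Matrix.conjTranspose_apply] at hxy
  exact (hM y x (fun h => hxy (by rw [h, star_zero])) i hi).symm

theorem fixes_place {r ι : Type} (w : r ↪ ι) (U : Op r) : Fixes (Set.range w) (place w U) := by
  intro x y hxy
  by_contra h
  exact hxy (place_of_not_agree w U h)

/-! Controlled operators. -/

theorem controlled_of_true {ι : Type} [DecidableEq ι] [Fintype ι] {q : ι} (M : Op ι)
    {x y : ι → Bool} (h : y q = true) : controlled q M x y = M x y := by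
  simp only [controlled, Matrix.of_apply, if_pos h]

theorem controlled_of_false {ι : Type} [DecidableEq ι] [Fintype ι] {q : ι} (M : Op ι)
    {x y : ι → Bool} (h : y q = false) : controlled q M x y = (1 : Op ι) x y := by
  simp [controlled, h]

theorem Fixes.controlled {ι : Type} [DecidableEq ι] [Fintype ι] {T : Set ι} {M : Op ι}
    (h : Fixes T M) (q : ι) : Fixes T (controlled q M) := by
  intro x y hxy
  cases hy : y q
  · rw [controlled_of_false M hy] at hxy; exact Fixes.one T x y hxy
  · rw [controlled_of_true M hy] at hxy; exact h x y hxy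

theorem controlled_one {ι : Type} [DecidableEq ι] [Fintype ι] (q : ι) :
    controlled q (1 : Op ι) = 1 := by
  ext x y
  simp [controlled]

/-- `N` does not change the control qubit, so both factors see the same control value. -/
theorem controlled_mul {ι : Type} [DecidableEq ι] [Fintype ι] {q : ι} (M : Op ι) {N : Op ι}
    {T : Set ι} (hN : Fixes T N) (hq : q ∉ T) :
    controlled q (M * N) = controlled q M * controlled q N := by
  ext x y
  rw [Matrix.mul_apply]
  cases hy : y q
  · rw [controlled_of_false _ hy]
    rw [Finset.sum_eq_single y]
    · rw [controlled_of_false _ hy, controlled_of_false _ hy, Matrix.one_apply_eq, mul_one]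
    · intro z _ hz
      rw [controlled_of_false N hy, Matrix.one_apply_ne hz, mul_zero]
    · simp
  · rw [controlled_of_true _ hy, Matrix.mul_apply]
    refine Finset.sum_congr rfl fun z _ => ?_
    rw [controlled_of_true N hy]
    by_cases h : N z y = 0
    · rw [h, mul_zero, mul_zero]
    · rw [controlled_of_true M ((hN z y h q hq).trans hy)]

theorem controlled_conjTranspose {ι : Type} [DecidableEq ι] [Fintype ι] {q : ι} {M : Op ι}
    {T : Set ι} (hM : Fixes T M) (hq : q ∉ T) :
    (controlled q M).conjTranspose = controlled q M.conjTranspose := by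
  ext x y
  rw [Matrix.conjTranspose_apply]
  by_cases hxy : x q = y q
  · cases hy : y q
    · rw [controlled_of_false _ hy, controlled_of_false _ (hxy.trans hy), Matrix.one_apply,
        Matrix.one_apply]
      by_cases h : x = y
      · simp [h]
      · simp [h, Ne.symm h]
    · rw [controlled_of_true _ hy, controlled_of_true _ (hxy.trans hy),
        Matrix.conjTranspose_apply]
  · have h1 : controlled q M y x = 0 := by
      by_contra h
      exact hxy (hM.controlled q y x h q hq).symm
    have h2 : controlled q M.conjTranspose x y = 0 := by
      by_contra h
      exact hxy (hM.conjTranspose.controlled q x y h q hq)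
    rw [h1, h2, star_zero]

theorem controlled_mem_unitaryGroup {ι : Type} [DecidableEq ι] [Fintype ι] {q : ι} {M : Op ι}
    {T : Set ι} (hM : Fixes T M) (hq : q ∉ T) (hU : M ∈ Matrix.unitaryGroup (ι → Bool) ℂ) :
    controlled q M ∈ Matrix.unitaryGroup (ι → Bool) ℂ := by
  rw [Matrix.mem_unitaryGroup_iff, Matrix.star_eq_conjTranspose] at hU ⊢
  rw [controlled_conjTranspose hM hq, ← controlled_mul M hM.conjTranspose hq, hU, controlled_one]

theorem place_controlled {r ι : Type} [Fintype r] [DecidableEq r] [Fintype ι] [DecidableEq ι]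
    (w : r ↪ ι) (q : r) (M : Op r) : place w (controlled q M) = controlled (w q) (place w M) := by
  ext x y
  cases hy : y (w q)
  · rw [controlled_of_false _ hy]
    conv_rhs => rw [← place_one w]
    by_cases h : ∀ i, i ∉ Set.range w → x i = y i
    · rw [place_of_agree _ _ h, place_of_agree _ _ h, controlled_of_false M (y := y ∘ w) hy]
    · rw [place_of_not_agree _ _ h, place_of_not_agree _ _ h]
  · rw [controlled_of_true _ hy]
    by_cases h : ∀ i, i ∉ Set.range w → x i = y i
    · rw [place_of_agree _ _ h, place_of_agree _ _ h, controlled_of_true M (y := y ∘ w) hy]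
    · rw [place_of_not_agree _ _ h, place_of_not_agree _ _ h]

/-! Circuits. -/

theorem Gate.matrix_mem_unitaryGroup {ι : Type} [Fintype ι] [DecidableEq ι] (g : Gate ι) :
    g.matrix ∈ Matrix.unitaryGroup (ι → Bool) ℂ :=
  place_mem_unitaryGroup g.wires g.unitary_U

theorem Circuit.matrix_append {ι : Type} [Fintype ι] [DecidableEq ι] (c d : Circuit ι) :
    Circuit.matrix (c ++ d : List (Gate ι)) = Circuit.matrix d * Circuit.matrix c := by
  induction c with
  | nil => simp [Circuit.matrix]
  | cons g c ih => rw [List.cons_append, Circuit.matrix, Circuit.matrix, ih, mul_assoc]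

theorem Circuit.matrix_mem_unitaryGroup {ι : Type} [Fintype ι] [DecidableEq ι] (c : Circuit ι) :
    c.matrix ∈ Matrix.unitaryGroup (ι → Bool) ℂ := by
  induction c with
  | nil => exact one_mem _
  | cons g c ih => exact mul_mem ih g.matrix_mem_unitaryGroup

/-- The gate `g` moved along the embedding `w`. -/
def Gate.map {r ι : Type} (w : r ↪ ι) (g : Gate r) : Gate ι :=
  { g with wires := g.wires.trans w }

/-- The inverse gate. -/
def Gate.inverse {ι : Type} (g : Gate ι) : Gate ι :=
  { g with
    U := g.U.conjTranspose
    unitary_U := by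
      exact Unitary.star_mem g.unitary_U }

theorem Gate.matrix_map {r ι : Type} (w : r ↪ ι) (g : Gate r) :
    (g.map w).matrix = place w g.matrix := (place_place w g.wires g.U).symm

theorem Gate.matrix_inverse {ι : Type} (g : Gate ι) :
    g.inverse.matrix = g.matrix.conjTranspose := (place_conjTranspose g.wires g.U).symm

theorem Circuit.matrix_map {r ι : Type} [Fintype r] [DecidableEq r] [Fintype ι] [DecidableEq ι]
    (w : r ↪ ι) (c : Circuit r) :
    Circuit.matrix (List.map (Gate.map w) c) = place w c.matrix := by
  induction c with
  | nil => exact (place_one w).symm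
  | cons g c ih =>
    rw [List.map_cons, Circuit.matrix, Circuit.matrix, ih, place_mul, Gate.matrix_map]

theorem Circuit.matrix_inverse {ι : Type} [Fintype ι] [DecidableEq ι] (c : Circuit ι) :
    Circuit.matrix (List.map Gate.inverse c).reverse = c.matrix.conjTranspose := by
  induction c with
  | nil => simp [Circuit.matrix]
  | cons g c ih =>
    rw [List.map_cons, List.reverse_cons, Circuit.matrix_append, ih, Circuit.matrix.eq_2 g c,
      Matrix.conjTranspose_mul]
    simp [Circuit.matrix, Gate.matrix_inverse]

theorem Circuit.fixes_support {ι : Type} [Fintype ι] [DecidableEq ι] (c : Circuit ι) :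
    Fixes c.support c.matrix := by
  induction c with
  | nil => exact Fixes.one _
  | cons g c ih =>
    refine Fixes.mul (ih.mono ?_) ((fixes_place g.wires g.U).mono ?_)
    · rintro q ⟨g', hg', hq⟩; exact ⟨g', List.mem_cons_of_mem _ hg', hq⟩
    · intro q hq; exact ⟨g, List.mem_cons_self, hq⟩

theorem Circuit.support_map {r ι : Type} (w : r ↪ ι) (c : Circuit r) :
    Circuit.support (List.map (Gate.map w) c) = w '' Circuit.support c := by
  ext q
  constructor
  · rintro ⟨g, hg, hq⟩
    obtain ⟨g', hg', rfl⟩ := List.mem_map.1 hg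
    obtain ⟨j, rfl⟩ := hq
    exact ⟨g'.wires j, ⟨g', hg', j, rfl⟩, rfl⟩
  · rintro ⟨p, ⟨g, hg, j, rfl⟩, rfl⟩
    exact ⟨g.map w, List.mem_map_of_mem hg, j, rfl⟩

theorem Circuit.commute_of_disjoint {s ι : Type} [Fintype ι] [DecidableEq ι] (c : Circuit ι)
    (v : s ↪ ι) (hd : Disjoint c.support (Set.range v)) (V : Op s) :
    Commute c.matrix (place v V) := by
  induction c with
  | nil => exact Commute.one_left _
  | cons g c ih =>
    refine Commute.mul_left (ih (hd.mono_left ?_)) (place_commute _ _ (hd.mono_left ?_) _ _)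
    · rintro q ⟨g', hg', hq⟩; exact ⟨g', List.mem_cons_of_mem _ hg', hq⟩
    · intro q hq; exact ⟨g, List.mem_cons_self, hq⟩

/-- This bounds the number of qubits to be prepared and reflected by the gate count, whatever the
register size. -/
theorem Circuit.finite_support_ncard_le {ι : Type} (c : Circuit ι) :
    c.support.Finite ∧ c.support.ncard ≤ 2 * c.length := by
  induction c with
  | nil =>
    have : Circuit.support ([] : Circuit ι) = ∅ := by
      ext q; simp [Circuit.support]
    rw [this]; simp
  | cons g c ih =>
    have : Circuit.support (g :: c) = Set.range g.wires ∪ Circuit.support c := by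
      ext q; simp [Circuit.support]
    rw [this]
    refine ⟨(Set.finite_range _).union ih.1, (Set.ncard_union_le _ _).trans ?_⟩
    have h1 : (Set.range g.wires).ncard ≤ 2 := by
      rw [← Set.image_univ, Set.ncard_image_of_injective _ g.wires.injective, Set.ncard_univ]
      simpa using g.arity_le_two
    rw [List.length_cons]
    omega

/-! ### Diagonalization of unitary matrices by the Cayley transform. -/

/-- The unit circle is infinite and the characteristic polynomial has finitely many roots. Such a
`μ` makes a Cayley transform of `U` available. -/
theorem exists_norm_eq_one_isUnit_det {n : Type} [Fintype n] [DecidableEq n] (U : Matrix n n ℂ) :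
    ∃ μ : ℂ, ‖μ‖ = 1 ∧ IsUnit (Matrix.scalar n μ - U) := by
  have hinf : (Metric.sphere (0 : ℂ) 1).Infinite := by
    refine (isPreconnected_sphere (by rw [Complex.rank_real_complex]; norm_num) 0
      1).infinite_of_nontrivial ⟨1, by simp, -1, by simp, fun h => ?_⟩
    have := congrArg Complex.re h
    norm_num at this
  obtain ⟨μ, hμ, hμ'⟩ := (hinf.sdiff (Polynomial.rootSet_finite U.charpoly ℂ)).nonempty
  refine ⟨μ, by simpa using hμ, ?_⟩
  rw [Matrix.isUnit_iff_isUnit_det, isUnit_iff_ne_zero, ← Matrix.eval_charpoly]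
  intro h
  exact hμ' ((Polynomial.mem_rootSet_of_ne U.charpoly_monic.ne_zero).2 (by simpa using h))

/-- Unitary matrices are unitarily diagonalizable. -/
theorem exists_unitary_diagonalization {n : Type} [Fintype n] [DecidableEq n] {U : Matrix n n ℂ}
    (hU : U ∈ Matrix.unitaryGroup n ℂ) :
    ∃ W ∈ Matrix.unitaryGroup n ℂ, ∃ d : n → ℂ, (∀ i, ‖d i‖ = 1) ∧
      U = W * Matrix.diagonal d * W.conjTranspose := by
  obtain ⟨μ, hμ, hZ⟩ := exists_norm_eq_one_isUnit_det U
  have hμμ : starRingEnd ℂ μ * μ = 1 := by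
    rw [← Complex.normSq_eq_conj_mul_self, Complex.normSq_eq_norm_sq, hμ]; simp
  have hUU : star U * U = 1 := Matrix.mem_unitaryGroup_iff'.1 hU
  have hUU' : U * star U = 1 := Matrix.mem_unitaryGroup_iff.1 hU
  obtain ⟨Y, hYZ, hZY⟩ : ∃ Y, Y * (Matrix.scalar n μ - U) = 1 ∧
      (Matrix.scalar n μ - U) * Y = 1 := by
    obtain ⟨u, hu⟩ := hZ
    exact ⟨u⁻¹.1, by rw [← hu]; simp, by rw [← hu]; simp⟩
  have hsc : (Matrix.scalar n μ) = μ • (1 : Matrix n n ℂ) := by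
    rw [Matrix.smul_one_eq_diagonal]; rfl
  rw [hsc] at hYZ hZY
  -- Cayley transform: `H = i (μ + U)(μ - U)⁻¹` is Hermitian, so the spectral theorem for Hermitian
  -- matrices applies to it.
  set Z := μ • (1 : Matrix n n ℂ) - U with hZdef
  set X := μ • (1 : Matrix n n ℂ) + U with hXdef
  set H := Complex.I • (X * Y) with hHdef
  have hHZ : H * Z = Complex.I • X := by
    rw [hHdef, smul_mul_assoc, mul_assoc, hYZ, mul_one]
  have hsZ : star Z = starRingEnd ℂ μ • (1 : Matrix n n ℂ) - star U := by
    rw [hZdef]; simp [star_sub, star_smul]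
  have hsX : star X = starRingEnd ℂ μ • (1 : Matrix n n ℂ) + star U := by
    rw [hXdef]; simp [star_add, star_smul]
  have e1 : star Z * X = -(star X * Z) := by
    rw [hsZ, hsX, hZdef, hXdef]
    simp only [sub_mul, mul_add, add_mul, mul_sub, hUU, one_mul, mul_one, smul_mul_assoc,
      mul_smul_comm, smul_smul, smul_add, smul_sub, mul_comm μ, hμμ, one_smul]
    abel
  have hsY : star Z * star Y = 1 := by rw [← star_mul, hYZ, star_one]
  have hsY' : star Y * star Z = 1 := by rw [← star_mul, hZY, star_one]
  have hH : H.IsHermitian := by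
    -- As `Z` is invertible, it suffices to test `Z* H Z = i Z* X`, and `Z* X` is skew-Hermitian by
    -- `e1`.
    have e2 : star Z * H * Z = star Z * star H * Z := by
      have : star Z * star H = star (H * Z) := (star_mul _ _).symm
      rw [this, hHZ, mul_assoc, hHZ, star_smul, mul_smul_comm, e1, smul_mul_assoc]
      simp
    have e3 : star Y * (star Z * H * Z) * Y = star Y * (star Z * star H * Z) * Y := by rw [e2]
    have e4 : ∀ M, star Y * (star Z * M * Z) * Y = M := fun M => by
      calc star Y * (star Z * M * Z) * Y = (star Y * star Z) * M * (Z * Y) := by noncomm_ring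
        _ = M := by rw [hsY', hZY, one_mul, mul_one]
    rw [e4, e4] at e3
    exact e3.symm
  have hspec := hH.spectral_theorem
  rw [Unitary.conjStarAlgAut_apply] at hspec
  set W : Matrix n n ℂ := (hH.eigenvectorUnitary : Matrix n n ℂ) with hWdef
  have hW : W ∈ Matrix.unitaryGroup n ℂ := hH.eigenvectorUnitary.2
  have hWW : star W * W = 1 := Matrix.mem_unitaryGroup_iff'.1 hW
  have hWW' : W * star W = 1 := Matrix.mem_unitaryGroup_iff.1 hW
  set e : n → ℂ := fun i => (hH.eigenvalues i : ℂ) with he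
  have hspec' : H = W * Matrix.diagonal e * star W := hspec
  have hne : ∀ i, e i + Complex.I ≠ 0 := fun i h => by
    have := congrArg Complex.im h
    simp [he] at this
  -- Inverting the transform gives `U = μ (H + i)⁻¹ (H - i)`. A real eigenvalue `e` of `H` thus
  -- becomes `μ (e - i)/(e + i)`, of modulus one.
  refine ⟨W, hW, fun i => μ * (e i - Complex.I) / (e i + Complex.I), fun i => ?_, ?_⟩
  · rw [norm_div, norm_mul, hμ, one_mul]
    have : e i - Complex.I = starRingEnd ℂ (e i + Complex.I) := by
      simp [he, sub_eq_add_neg]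
    rw [this, RCLike.norm_conj, div_self]
    exact norm_ne_zero_iff.2 (hne i)
  · have k1 : (H + Complex.I • 1) * U = μ • (H - Complex.I • 1) := by
      have h1 : H * Z = μ • H - H * U := by rw [hZdef, mul_sub, mul_smul_comm, mul_one]
      rw [hHZ, hXdef] at h1
      have h2 : H * U = μ • H - Complex.I • (μ • (1 : Matrix n n ℂ) + U) := by rw [h1]; abel
      rw [add_mul, h2, smul_mul_assoc, one_mul, smul_add, smul_sub,
        smul_comm μ Complex.I (1 : Matrix n n ℂ)]
      abel
    have hd1 : H + Complex.I • 1 = W * Matrix.diagonal (fun i => e i + Complex.I) * star W := by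
      have : Matrix.diagonal (fun i => e i + Complex.I) = Matrix.diagonal e + Complex.I • 1 := by
        rw [Matrix.smul_one_eq_diagonal, Matrix.diagonal_add]
      rw [this, mul_add, add_mul, ← hspec', mul_smul_comm, mul_one, smul_mul_assoc, hWW']
    have hd2 : μ • (H - Complex.I • 1) =
        W * Matrix.diagonal (fun i => μ * (e i - Complex.I)) * star W := by
      have : Matrix.diagonal (fun i => μ * (e i - Complex.I)) =
          μ • (Matrix.diagonal e - Complex.I • 1) := by
        rw [Matrix.smul_one_eq_diagonal, Matrix.diagonal_sub, ← Matrix.diagonal_smul]; rfl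
      rw [this, mul_smul_comm, smul_mul_assoc, mul_sub, sub_mul, ← hspec', mul_smul_comm, mul_one,
        smul_mul_assoc, hWW']
    have k2 : (W * Matrix.diagonal (fun i => (e i + Complex.I)⁻¹) * star W) *
        (H + Complex.I • 1) = 1 := by
      rw [hd1]
      calc _ = W * Matrix.diagonal (fun i => (e i + Complex.I)⁻¹) * (star W * W) *
            Matrix.diagonal (fun i => e i + Complex.I) * star W := by noncomm_ring
        _ = 1 := by
          rw [hWW, mul_one, mul_assoc W, Matrix.diagonal_mul_diagonal]
          simp [hne, hWW']
    calc U = ((W * Matrix.diagonal (fun i => (e i + Complex.I)⁻¹) * star W) *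
        (H + Complex.I • 1)) * U := by rw [k2, one_mul]
      _ = (W * Matrix.diagonal (fun i => (e i + Complex.I)⁻¹) * star W) *
          (W * Matrix.diagonal (fun i => μ * (e i - Complex.I)) * star W) := by
        rw [mul_assoc, k1, hd2]
      _ = W * Matrix.diagonal (fun i => (e i + Complex.I)⁻¹) * (star W * W) *
            Matrix.diagonal (fun i => μ * (e i - Complex.I)) * star W := by noncomm_ring
      _ = _ := by
        rw [hWW, mul_one, mul_assoc W, Matrix.diagonal_mul_diagonal, Matrix.star_eq_conjTranspose]
        congr 3
        funext i
        field_simp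

/-! Diagonal and permutation operators. -/

theorem diagonal_mem_unitaryGroup {n : Type} [Fintype n] [DecidableEq n] {d : n → ℂ}
    (hd : ∀ i, ‖d i‖ = 1) : Matrix.diagonal d ∈ Matrix.unitaryGroup n ℂ := by
  rw [Matrix.mem_unitaryGroup_iff, Matrix.star_eq_conjTranspose, Matrix.diagonal_conjTranspose,
    Matrix.diagonal_mul_diagonal, ← Matrix.diagonal_one]
  congr 1
  funext i
  rw [Pi.star_apply, RCLike.star_def, Complex.mul_conj, Complex.normSq_eq_norm_sq, hd]
  simp

theorem place_diagonal {r ι : Type} [Fintype r] [DecidableEq r] [Fintype ι] [DecidableEq ι]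
    (w : r ↪ ι) (d : (r → Bool) → ℂ) :
    place w (Matrix.diagonal d) = Matrix.diagonal fun x => d (x ∘ w) := by
  ext x y
  by_cases h : ∀ i, i ∉ Set.range w → x i = y i
  · rw [place_of_agree w _ h]
    by_cases hxy : x = y
    · subst hxy; simp
    · rw [Matrix.diagonal_apply_ne _ hxy, Matrix.diagonal_apply_ne]
      exact fun h' => hxy ((eq_iff_agree w).2 ⟨h, h'⟩)
  · rw [place_of_not_agree w _ h, Matrix.diagonal_apply_ne]
    rintro rfl; exact h fun _ _ => rfl

theorem controlled_diagonal {ι : Type} [Fintype ι] [DecidableEq ι] (q : ι)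
    (d : (ι → Bool) → ℂ) :
    controlled q (Matrix.diagonal d) = Matrix.diagonal fun x => if x q = true then d x else 1 := by
  ext x y
  by_cases hxy : x = y
  · subst hxy; by_cases h : x q = true <;> simp [controlled, h]
  · by_cases h : y q = true <;> simp [controlled, h, hxy]

/-- The operator that permutes the basis states by `f`. -/
def permOp {ι : Type} (f : (ι → Bool) → (ι → Bool)) : Op ι := by
  classical exact Matrix.of fun x y => if x = f y then 1 else 0

theorem permOp_apply {ι : Type} [Fintype ι] [DecidableEq ι] (f : (ι → Bool) → (ι → Bool))
    (x y : ι → Bool) : permOp f x y = if x = f y then 1 else 0 := by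
  simp only [permOp, Matrix.of_apply]
  congr

theorem permOp_mul {ι : Type} [Fintype ι] [DecidableEq ι] (f g : (ι → Bool) → (ι → Bool)) :
    permOp f * permOp g = permOp (f ∘ g) := by
  ext x y
  simp [Matrix.mul_apply, permOp_apply]

theorem permOp_conjTranspose {ι : Type} [Fintype ι] [DecidableEq ι] {f : (ι → Bool) → (ι → Bool)}
    (hf : Involutive f) : (permOp f).conjTranspose = permOp f := by
  ext x y
  rw [Matrix.conjTranspose_apply, permOp_apply, permOp_apply]
  by_cases h : x = f y
  · rw [if_pos h, if_pos (by rw [h, hf y]), star_one]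
  · rw [if_neg h, if_neg (fun h' => h (by rw [h', hf x])), star_zero]

theorem permOp_mem_unitaryGroup {ι : Type} [Fintype ι] [DecidableEq ι]
    {f : (ι → Bool) → (ι → Bool)} (hf : Involutive f) :
    permOp f ∈ Matrix.unitaryGroup (ι → Bool) ℂ := by
  rw [Matrix.mem_unitaryGroup_iff, Matrix.star_eq_conjTranspose, permOp_conjTranspose hf,
    permOp_mul]
  ext x y
  simp [permOp_apply, Matrix.one_apply, hf y]

theorem permOp_mul_diagonal_mul_permOp {ι : Type} [Fintype ι] [DecidableEq ι]
    {f : (ι → Bool) → (ι → Bool)} (hf : Involutive f) (d : (ι → Bool) → ℂ) :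
    permOp f * (Matrix.diagonal d * permOp f) = Matrix.diagonal (d ∘ f) := by
  ext x y
  rw [Matrix.mul_apply]
  simp only [Matrix.diagonal_mul, permOp_apply]
  rw [Finset.sum_eq_single (f y)]
  · by_cases h : x = y
    · subst h; simp [hf x]
    · rw [Matrix.diagonal_apply_ne _ h, hf y]; simp [h]
  · intro z _ hz; simp [hz]
  · simp

theorem place_permOp {r ι : Type} [Fintype r] [DecidableEq r] [Fintype ι] [DecidableEq ι]
    (w : r ↪ ι) (f : (r → Bool) → (r → Bool)) :
    place w (permOp f) = permOp fun y => extend w (f (y ∘ w)) y := by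
  ext x y
  rw [permOp_apply]
  by_cases h : ∀ i, i ∉ Set.range w → x i = y i
  · rw [place_of_agree w _ h, permOp_apply]
    by_cases h' : x ∘ w = f (y ∘ w)
    · rw [if_pos h', if_pos]
      exact (eq_iff_agree w).2 ⟨fun i hi => (h i hi).trans (extend_off w _ y hi).symm,
        by rw [h', extend_comp_eq]⟩
    · rw [if_neg h', if_neg]
      rintro rfl; exact h' (extend_comp_eq _ _ _)
  · rw [place_of_not_agree w _ h, if_neg]
    rintro rfl; exact h fun i hi => extend_off w _ y hi

/-! Controlled gates. -/

/-- Two different qubits as an embedding. -/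
def pairWires {ι : Type} (p q : ι) (h : p ≠ q) : Fin 2 ↪ ι where
  toFun := ![p, q]
  inj' := by
    intro i j hij
    fin_cases i <;> fin_cases j <;> simp_all [eq_comm]

/-- The flip of the second bit if the first one is set. -/
def flipSnd (v : Fin 2 → Bool) : Fin 2 → Bool := ![v 0, xor (v 0) (v 1)]

theorem flipSnd_involutive : Involutive flipSnd := by
  intro v
  funext i
  fin_cases i <;> simp [flipSnd]

/-- A two-qubit gate on two given wires. -/
def gateTwo {ι : Type} (w : Fin 2 ↪ ι) (U : Op (Fin 2))
    (hU : U ∈ Matrix.unitaryGroup (Fin 2 → Bool) ℂ) : Gate ι :=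
  ⟨2, by norm_num, le_rfl, w, U, hU⟩

/-- Let `h² = d`. The circuit applies `h`, flips `w 0` if `q` is set, applies `h⁻¹`, and flips back.
If `q` is off the phases cancel. If `q` is on, the result is `h(v₀,v₁) / h(¬v₀,v₁)`, and a phase
`h(0,v₁) h(1,v₁)` on `q` and `w 1` alone turns this into `h(v₀,v₁)² = d`. -/
theorem exists_circuit_controlled_diagonal {ι : Type} [Fintype ι] [DecidableEq ι]
    (w : Fin 2 ↪ ι) {q : ι} (hq : q ∉ Set.range w) {d : (Fin 2 → Bool) → ℂ}
    (hd : ∀ v, ‖d v‖ = 1) :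
    ∃ c : Circuit ι, c.matrix = controlled q (place w (Matrix.diagonal d)) ∧ c.length ≤ 5 := by
  choose h hh using fun v => IsAlgClosed.exists_pow_nat_eq (d v) (n := 2) (by norm_num)
  have hn : ∀ v, ‖h v‖ = 1 := fun v => by
    have : ‖h v‖ ^ 2 = 1 := by rw [← norm_pow, hh, hd]
    nlinarith [norm_nonneg (h v)]
  have hne : ∀ v, h v ≠ 0 := fun v => norm_ne_zero_iff.1 (by rw [hn]; exact one_ne_zero)
  have h0 : q ≠ w 0 := fun e => hq ⟨0, e.symm⟩
  have h1 : q ≠ w 1 := fun e => hq ⟨1, e.symm⟩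
  have h01 : w 0 ≠ w 1 := fun e => absurd (w.injective e) (by decide)
  let e : (Fin 2 → Bool) → ℂ := fun v => if v 0 = true then h ![false, v 1] * h ![true, v 1] else 1
  have he : ∀ v, ‖e v‖ = 1 := fun v => by
    by_cases hv : v 0 = true <;> simp [e, hv, hn]
  let gD := gateTwo w (Matrix.diagonal h) (diagonal_mem_unitaryGroup hn)
  let gX := gateTwo (pairWires q (w 0) h0) (permOp flipSnd)
    (permOp_mem_unitaryGroup flipSnd_involutive)
  let gI := gateTwo w (Matrix.diagonal fun v => (h v)⁻¹)
    (diagonal_mem_unitaryGroup fun v => by rw [norm_inv, hn, inv_one])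
  let gE := gateTwo (pairWires q (w 1) h1) (Matrix.diagonal e) (diagonal_mem_unitaryGroup he)
  refine ⟨[gD, gX, gI, gX, gE], ?_, le_rfl⟩
  have hD : gD.matrix = Matrix.diagonal fun x => h (x ∘ w) := place_diagonal _ _
  have hI : gI.matrix = Matrix.diagonal fun x => (h (x ∘ w))⁻¹ := place_diagonal _ _
  have hE : gE.matrix = Matrix.diagonal fun x => e (x ∘ pairWires q (w 1) h1) :=
    place_diagonal _ _
  let f : (ι → Bool) → (ι → Bool) := fun y =>
    extend (pairWires q (w 0) h0) (flipSnd (y ∘ pairWires q (w 0) h0)) y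
  have hX : gX.matrix = permOp f := place_permOp _ _
  have hf0 : ∀ y, f y (w 0) = xor (y q) (y (w 0)) := fun y =>
    (pairWires q (w 0) h0).injective.extend_apply _ _ 1
  have hfq : ∀ y, f y q = y q := fun y =>
    (pairWires q (w 0) h0).injective.extend_apply _ _ 0
  have hfo : ∀ y i, i ≠ q → i ≠ w 0 → f y i = y i := fun y i hi hi' =>
    extend_off _ _ y (by
      rintro ⟨j, rfl⟩
      fin_cases j
      · exact hi rfl
      · exact hi' rfl)
  have hf : Involutive f := by
    intro y
    funext i
    by_cases hi : i = q
    · rw [hi, hfq, hfq]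
    · by_cases hi' : i = w 0
      · rw [hi', hf0, hfq, hf0]; simp
      · rw [hfo _ _ hi hi', hfo _ _ hi hi']
  simp only [Circuit.matrix, one_mul]
  rw [hD, hI, hE, hX, place_diagonal, controlled_diagonal, mul_assoc, mul_assoc, mul_assoc,
    ← mul_assoc (Matrix.diagonal fun x => (h (x ∘ w))⁻¹), ← mul_assoc (permOp f),
    permOp_mul_diagonal_mul_permOp hf, Matrix.diagonal_mul_diagonal, Matrix.diagonal_mul_diagonal]
  congr 1
  funext x
  have hv : ∀ y : ι → Bool, y ∘ w = ![y (w 0), y (w 1)] := fun y => by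
    funext i; fin_cases i <;> rfl
  have hx1 : f x (w 1) = x (w 1) := hfo x _ h1.symm h01.symm
  simp only [Function.comp_apply, hv, hf0, hx1, e, ← hh]
  have p0 : pairWires q (w 1) h1 0 = q := rfl
  have p1 : pairWires q (w 1) h1 1 = w 1 := rfl
  rw [p0, p1]
  cases hxq : x q
  · simp [hne]
  · cases hx0 : x (w 0)
    · have := hne ![true, x (w 1)]
      simp only [if_true, Bool.xor_false]
      field_simp
    · have := hne ![false, x (w 1)]
      simp only [if_true, Bool.xor_true, Bool.not_true]
      field_simp

/-- A controlled one-qubit gate is itself a two-qubit gate. For a two-qubit gate `W D W†` only `D`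
needs the control, since `W W† = 1` when it is off. This costs five gates for `D` and two for `W`
and `W†`. -/
theorem Gate.exists_circuit_controlled {ι : Type} [Fintype ι] [DecidableEq ι] (g : Gate ι) {q : ι}
    (hq : q ∉ Set.range g.wires) :
    ∃ c : Circuit ι, c.matrix = controlled q g.matrix ∧ c.length ≤ 7 := by
  obtain ⟨k, hk1, hk2, w, U, hU⟩ := g
  obtain rfl | rfl : k = 1 ∨ k = 2 := by omega
  · have h0 : q ≠ w 0 := fun e => hq ⟨0, e.symm⟩
    let v : Fin 1 ↪ Fin 2 := ⟨fun _ => 1, fun i j _ => Subsingleton.elim i j⟩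
    have hv : (0 : Fin 2) ∉ Set.range v := by
      rintro ⟨i, hi⟩; exact absurd (show (1 : Fin 2) = 0 from hi) (by decide)
    refine ⟨[gateTwo (pairWires q (w 0) h0) (controlled 0 (place v U))
      (controlled_mem_unitaryGroup (fixes_place v U) hv (place_mem_unitaryGroup v hU))], ?_,
      by simp⟩
    have hw : v.trans (pairWires q (w 0) h0) = w := by
      ext i
      obtain rfl : i = 0 := Subsingleton.elim _ _
      rfl
    simp only [Circuit.matrix, one_mul]
    change place _ _ = controlled q (place w U)
    rw [gateTwo, place_controlled, place_place, hw]
    rfl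
  · obtain ⟨W, hW, d, hd, rfl⟩ := exists_unitary_diagonalization hU
    obtain ⟨c, hc, hl⟩ := exists_circuit_controlled_diagonal w hq hd
    have hW' : W.conjTranspose ∈ Matrix.unitaryGroup (Fin 2 → Bool) ℂ := Unitary.star_mem hW
    refine ⟨gateTwo w _ hW' :: (c ++ [gateTwo w W hW]), ?_,
      by rw [List.length_cons, List.length_append]; simp only [List.length_singleton]; omega⟩
    have h1 : (gateTwo w _ hW').matrix = (place w W).conjTranspose :=
      (place_conjTranspose w W).symm
    have h2 : (gateTwo w W hW).matrix = place w W := rfl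
    have h3 : place w W * (place w W).conjTranspose = 1 :=
      Matrix.mem_unitaryGroup_iff.1 (place_mem_unitaryGroup w hW)
    rw [Circuit.matrix, Circuit.matrix_append, hc, h1]
    simp only [Circuit.matrix, one_mul, h2]
    change _ = controlled q (place w (W * Matrix.diagonal d * W.conjTranspose))
    rw [place_mul, place_mul, ← place_conjTranspose]
    generalize place w (Matrix.diagonal d) = N
    have hF : Fixes (Set.range w) (place w W) := fixes_place w W
    generalize place w W = M at *
    ext x y
    cases hy : y q
    · rw [controlled_of_false _ hy, ← h3, Matrix.mul_apply, Matrix.mul_apply]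
      refine Finset.sum_congr rfl fun z _ => ?_
      by_cases hz : M.conjTranspose z y = 0
      · rw [hz, mul_zero, mul_zero]
      · have hzq : z q = false := (hF.conjTranspose z y hz q hq).trans hy
        congr 1
        rw [Matrix.mul_apply, Finset.sum_eq_single z]
        · rw [controlled_of_false _ hzq, Matrix.one_apply_eq, mul_one]
        · intro u _ hu
          rw [controlled_of_false _ hzq, Matrix.one_apply_ne hu, mul_zero]
        · simp
    · rw [controlled_of_true _ hy, Matrix.mul_apply, Matrix.mul_apply]
      refine Finset.sum_congr rfl fun z _ => ?_
      by_cases hz : M.conjTranspose z y = 0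
      · rw [hz, mul_zero, mul_zero]
      · have hzq : z q = true := (hF.conjTranspose z y hz q hq).trans hy
        congr 1
        rw [Matrix.mul_apply, Matrix.mul_apply]
        refine Finset.sum_congr rfl fun u _ => ?_
        rw [controlled_of_true _ hzq]

theorem Circuit.exists_controlled {ι : Type} [Fintype ι] [DecidableEq ι] (c : Circuit ι) {q : ι}
    (hq : q ∉ c.support) :
    ∃ c' : Circuit ι, c'.matrix = controlled q c.matrix ∧ c'.length ≤ 7 * c.length := by
  induction c with
  | nil => exact ⟨[], (controlled_one q).symm, le_rfl⟩
  | cons g c ih =>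
    obtain ⟨d, hd, hl⟩ := ih fun ⟨g', hg', hq'⟩ => hq ⟨g', List.mem_cons_of_mem _ hg', hq'⟩
    have hg : q ∉ Set.range g.wires := fun h => hq ⟨g, List.mem_cons_self, h⟩
    obtain ⟨e, he, hl'⟩ := g.exists_circuit_controlled hg
    refine ⟨e ++ d, ?_, ?_⟩
    · rw [Circuit.matrix_append, hd, he, Circuit.matrix,
        controlled_mul (Circuit.matrix c) (N := g.matrix) (fixes_place g.wires g.U) hg]
    · rw [List.length_append, List.length_cons]; omega

theorem circuitComplexity_le {ι : Type} [DecidableEq ι] [Fintype ι] (c : Circuit ι) :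
    circuitComplexity c.matrix ≤ c.length :=
  iInf₂_le (f := fun (c' : Circuit ι) (_ : c'.matrix = c.matrix) => (c'.length : ℕ∞)) c rfl

/-- Inverting a circuit keeps its length and moving it to other wires does too. Only the control
costs the factor seven. -/
theorem circuitComplexity_callMatrix_le {r : Type} [Fintype r] [DecidableEq r] {m : ℕ}
    (c : Circuit r) (w : r ↪ Fin m) (inv : Bool) (ctrl : Option (Fin m))
    (h : ∀ q ∈ ctrl, q ∉ Set.range w) :
    circuitComplexity (callMatrix c.matrix w inv ctrl) ≤ ((7 * c.length : ℕ) : ℕ∞) := by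
  obtain ⟨d, hd, hl⟩ : ∃ d : Circuit r,
      d.matrix = (if inv then c.matrix.conjTranspose else c.matrix) ∧ d.length = c.length := by
    cases inv
    · exact ⟨c, rfl, rfl⟩
    · exact ⟨_, Circuit.matrix_inverse c, by simp⟩
  have hm := Circuit.matrix_map w d
  cases ctrl with
  | none =>
    have : callMatrix c.matrix w inv none = Circuit.matrix (List.map (Gate.map w) d) := by
      rw [hm, hd]; rfl
    rw [this]
    refine (circuitComplexity_le _).trans ?_
    rw [List.length_map, hl]
    exact_mod_cast Nat.le_mul_of_pos_left _ (by norm_num)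
  | some q =>
    have hq : q ∉ Circuit.support (List.map (Gate.map w) d) := by
      rw [Circuit.support_map]
      rintro ⟨p, _, rfl⟩
      exact h _ rfl ⟨p, rfl⟩
    obtain ⟨e, he, hl'⟩ := Circuit.exists_controlled _ hq
    have : callMatrix c.matrix w inv (some q) = e.matrix := by
      rw [he, hm, hd]; rfl
    rw [this]
    refine (circuitComplexity_le _).trans ?_
    rw [List.length_map, hl] at hl'
    exact_mod_cast hl'

/-! Reflection about the basis state `|0⋯0⟩`. -/

theorem controlled_permOp {ι : Type} [Fintype ι] [DecidableEq ι] (q : ι)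
    (f : (ι → Bool) → (ι → Bool)) :
    controlled q (permOp f) = permOp fun y => if y q = true then f y else y := by
  ext x y
  by_cases h : y q = true <;> simp [controlled, permOp_apply, h, Matrix.one_apply]

theorem permOp_mulVec_single {ι : Type} [Fintype ι] [DecidableEq ι]
    (f : (ι → Bool) → (ι → Bool)) (s : ι → Bool) :
    permOp f *ᵥ Pi.single s 1 = Pi.single (f s) (1 : ℂ) := by
  rw [Matrix.mulVec_single_one]
  ext x
  rw [Matrix.col_apply, permOp_apply, Pi.single_apply]

/-- A one-qubit gate. -/
def gateOne {ι : Type} (q : ι) (U : Op (Fin 1))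
    (hU : U ∈ Matrix.unitaryGroup (Fin 1 → Bool) ℂ) : Gate ι :=
  ⟨1, le_rfl, by norm_num, ⟨fun _ => q, fun i j _ => Subsingleton.elim i j⟩, U, hU⟩

theorem exists_gate_not {ι : Type} [Fintype ι] [DecidableEq ι] (q : ι) :
    ∃ g : Gate ι, g.matrix = permOp fun s => update s q (!s q) := by
  have hf : Involutive fun (v : Fin 1 → Bool) i => !v i := fun v => by funext i; simp
  refine ⟨gateOne q (permOp fun v i => !v i) (permOp_mem_unitaryGroup hf), ?_⟩
  refine (place_permOp _ _).trans ?_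
  congr 1
  funext s
  funext i
  by_cases h : i = q
  · subst h
    rw [update_self]
    exact (Embedding.injective _).extend_apply _ _ (0 : Fin 1)
  · rw [update_of_ne h]
    exact extend_off _ _ _ (by rintro ⟨j, hj⟩; exact h hj.symm)

theorem exists_circuit_toffoli {ι : Type} [Fintype ι] [DecidableEq ι] {p x y : ι} (hpx : p ≠ x)
    (hpy : p ≠ y) (hxy : x ≠ y) :
    ∃ c : Circuit ι, (c.matrix = permOp fun s => update s y (xor (s y) (s p && !s x))) ∧
      c.length ≤ 7 := by
  have hf : Involutive fun v : Fin 2 → Bool => ![v 0, xor (v 1) (!v 0)] := fun v => by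
    funext i; fin_cases i <;> simp
  obtain ⟨c, hc, hl⟩ := (gateTwo (pairWires x y hxy) _ (permOp_mem_unitaryGroup hf)
    ).exists_circuit_controlled (q := p) (by
      rintro ⟨j, hj⟩
      fin_cases j
      · exact hpx hj.symm
      · exact hpy hj.symm)
  refine ⟨c, ?_, hl⟩
  rw [hc]
  change controlled p (place (pairWires x y hxy) (permOp fun v => ![v 0, xor (v 1) (!v 0)])) = _
  rw [place_permOp, controlled_permOp]
  congr 1
  funext s
  by_cases h : s p = true
  · rw [if_pos h, h]
    funext i
    by_cases hi : i = y
    · subst hi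
      rw [update_self]
      exact (pairWires x i hxy).injective.extend_apply _ _ 1
    · rw [update_of_ne hi]
      by_cases hi' : i = x
      · subst hi'
        exact (pairWires i y hxy).injective.extend_apply _ _ 0
      · refine extend_off _ _ _ ?_
        rintro ⟨j, hj⟩
        fin_cases j
        · exact hi' hj.symm
        · exact hi hj.symm
  · rw [if_neg h]
    simp [h]

theorem exists_gate_sign {ι : Type} [Fintype ι] [DecidableEq ι] (p : ι) :
    ∃ g : Gate ι, g.matrix = Matrix.diagonal fun s => if s p = true then 1 else -1 := by
  refine ⟨gateOne p (Matrix.diagonal fun v => if v 0 = true then 1 else -1)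
    (diagonal_mem_unitaryGroup fun v => ?_), ?_⟩
  · by_cases h : v 0 = true <;> simp [h]
  · exact place_diagonal _ _

/-- A ladder of Toffoli gates attaches the sign `-1` to the basis states in which `p` is not set or
one of the first components of `l` is set, if the second components of `l` are not set. -/
theorem exists_circuit_ladder {ι : Type} [Fintype ι] [DecidableEq ι] (l : List (ι × ι)) :
    ∀ p : ι, (p :: (l.map Prod.fst ++ l.map Prod.snd)).Nodup →
    ∃ c : Circuit ι, c.length ≤ 14 * l.length + 1 ∧
      ∀ s : ι → Bool, (∀ e ∈ l, s e.2 = false) →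
        c.matrix *ᵥ Pi.single s 1 =
          (if s p = true ∧ ∀ e ∈ l, s e.1 = false then (1 : ℂ) else -1) • Pi.single s 1 := by
  induction l with
  | nil =>
    intro p _
    obtain ⟨g, hg⟩ := exists_gate_sign p
    refine ⟨[g], by simp, fun s _ => ?_⟩
    simp only [Circuit.matrix, one_mul, hg]
    ext x
    by_cases h : x = s
    · subst h; simp [Matrix.mulVec_diagonal]
    · simp [Matrix.mulVec_diagonal, h]
  | cons e l ih =>
    obtain ⟨x, y⟩ := e
    intro p hnd
    simp only [List.map_cons, List.cons_append, List.nodup_cons, List.mem_cons, List.mem_append,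
      List.nodup_append, not_or] at hnd
    obtain ⟨⟨hpx, hp1, hpy, hp2⟩, ⟨hx1, hxy, hx2⟩, hn1, ⟨hy2, hn2⟩, hdis⟩ := hnd
    have hy1 : y ∉ l.map Prod.fst := fun h => (hdis y h y (Or.inl rfl)) rfl
    obtain ⟨c, hl, hc⟩ := ih y (by
      simp only [List.nodup_cons, List.mem_append, List.nodup_append, not_or]
      exact ⟨⟨hy1, hy2⟩, hn1, hn2, fun a ha b hb => hdis a ha b (Or.inr hb)⟩)
    obtain ⟨t, ht, htl⟩ := exists_circuit_toffoli hpx hpy hxy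
    -- The first `t` writes "`p` is set and `x` is not" into the clean qubit `y`. The ladder
    -- continues with `y` in place of `p`, and the second `t` cleans `y` again. Each entry costs two
    -- Toffoli gates of at most seven gates.
    refine ⟨t ++ (c ++ t), ?_, fun s hs => ?_⟩
    · simp only [List.length_append, List.length_cons]
      have h2 : List.length t ≤ 7 := htl
      have h3 : List.length c ≤ 14 * l.length + 1 := hl
      omega
    · have hsy : s y = false := hs (x, y) List.mem_cons_self
      have hne1 : ∀ e ∈ l, e.1 ≠ y := fun e he h => hy1 (h ▸ List.mem_map_of_mem he)
      have hne2 : ∀ e ∈ l, e.2 ≠ y := fun e he h => hy2 (h ▸ List.mem_map_of_mem he)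
      set s' := update s y (xor (s y) (s p && !s x)) with hs'
      have hback : update s' y (xor (s' y) (s' p && !s' x)) = s := by
        funext i
        by_cases hi : i = y
        · subst hi
          simp [hs', hpy, hxy]
        · simp [hs', hi]
      rw [Circuit.matrix_append, Circuit.matrix_append, ← Matrix.mulVec_mulVec,
        ← Matrix.mulVec_mulVec, ht, permOp_mulVec_single, ← hs', hc s', Matrix.mulVec_smul,
        permOp_mulVec_single, hback]
      · congr 1
        have : (s' y = true ∧ ∀ e ∈ l, s' e.1 = false) ↔
            (s p = true ∧ ∀ e ∈ (x, y) :: l, s e.1 = false) := by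
          have e1 : (∀ e ∈ l, s' e.1 = false) ↔ ∀ e ∈ l, s e.1 = false :=
            forall₂_congr fun e he => by rw [hs', update_of_ne (hne1 e he)]
          rw [e1, hs', update_self, hsy]
          simp [and_assoc]
        simp only [this]
      · intro e he
        rw [hs', update_of_ne (hne2 e he)]
        exact hs e (List.mem_cons_of_mem _ he)

/-- The state `ψ` has the qubits outside `T` in the state `|0⟩`. -/
def ZeroOff {ι : Type} (T : Set ι) (ψ : (ι → Bool) → ℂ) : Prop :=
  ∀ s, ψ s ≠ 0 → ∀ i, i ∉ T → s i = false

theorem ZeroOff.single {ι : Type} [Fintype ι] [DecidableEq ι] (T : Set ι) :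
    ZeroOff T (Pi.single (fun _ => false) 1) := by
  intro s hs i _
  by_cases h : s = fun _ => false
  · rw [h]
  · exact absurd (Pi.single_eq_of_ne h _) hs

theorem ZeroOff.mulVec {ι : Type} [Fintype ι] [DecidableEq ι] {T : Set ι} {M : Op ι}
    {ψ : (ι → Bool) → ℂ} (hM : Fixes T M) (hψ : ZeroOff T ψ) : ZeroOff T (M *ᵥ ψ) := by
  intro s hs i hi
  obtain ⟨u, _, hu⟩ := Finset.exists_ne_zero_of_sum_ne_zero hs
  rw [hM s u (left_ne_zero_of_mul hu) i hi]
  exact hψ u (right_ne_zero_of_mul hu) i hi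

/-- Reflection about `|0⋯0⟩`, for states whose qubits outside `p` and the first components of `l`
are in the state `|0⟩`. -/
theorem exists_circuit_reflection {ι : Type} [Fintype ι] [DecidableEq ι] (l : List (ι × ι))
    (p : ι) (hnd : (p :: (l.map Prod.fst ++ l.map Prod.snd)).Nodup) {T : Set ι}
    (hT : ∀ i, i ∈ T ↔ i = p ∨ i ∈ l.map Prod.fst) :
    ∃ c : Circuit ι, c.length ≤ 14 * l.length + 3 ∧
      ∀ ψ : (ι → Bool) → ℂ, ZeroOff T ψ →
        c.matrix *ᵥ ψ =
          (2 * ψ fun _ => false) • Pi.single (fun _ => false) (1 : ℂ) - ψ := by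
  obtain ⟨c, hl, hc⟩ := exists_circuit_ladder l p hnd
  obtain ⟨g, hg⟩ := exists_gate_not p
  simp only [List.nodup_cons, List.mem_append, List.nodup_append, not_or] at hnd
  obtain ⟨⟨hp1, hp2⟩, hn1, hn2, hdis⟩ := hnd
  -- The ladder tests for `p` set, whereas `|0⋯0⟩` has `p` unset, hence a NOT on `p` before and
  -- after.
  refine ⟨g :: (c ++ [g]), ?_, fun ψ hψ => ?_⟩
  · simp only [List.length_append, List.length_cons, List.length_nil]
    have h3 : List.length c ≤ 14 * l.length + 1 := hl
    omega
  have key : ∀ s : ι → Bool, (∀ i, i ∉ T → s i = false) →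
      Circuit.matrix (g :: (c ++ [g] : List (Gate ι))) *ᵥ Pi.single s (1 : ℂ) =
        (if s = fun _ => false then (1 : ℂ) else -1) • Pi.single s 1 := by
    intro s hs
    have hback : update (update s p (!s p)) p (!update s p (!s p) p) = s := by simp
    rw [Circuit.matrix, Circuit.matrix_append, ← Matrix.mulVec_mulVec, hg, permOp_mulVec_single,
      ← Matrix.mulVec_mulVec, hc]
    · simp only [Circuit.matrix, one_mul]
      rw [hg, Matrix.mulVec_smul, permOp_mulVec_single, hback]
      congr 1
      have : (update s p (!s p) p = true ∧ ∀ e ∈ l, update s p (!s p) e.1 = false) ↔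
          s = fun _ => false := by
        rw [update_self]
        constructor
        · rintro ⟨h1, h2⟩
          funext i
          by_cases hi : i ∈ T
          · by_cases hip : i = p
            · rw [hip]; simpa using h1
            · obtain h | h := (hT i).1 hi
              · exact absurd h hip
              · obtain ⟨e, he, rfl⟩ := List.mem_map.1 h
                have := h2 e he
                rwa [update_of_ne hip] at this
          · exact hs i hi
        · rintro rfl
          refine ⟨rfl, fun e he => ?_⟩
          rw [update_of_ne]
          rintro rfl
          exact hp1 (List.mem_map_of_mem he)
      simp only [this]
    · intro e he
      have h1 : e.2 ∈ l.map Prod.snd := List.mem_map_of_mem he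
      have h2 : e.2 ≠ p := fun h => hp2 (h ▸ h1)
      rw [update_of_ne h2]
      refine hs _ fun h => ?_
      obtain h | h := (hT _).1 h
      · exact h2 h
      · exact hdis _ h _ h1 rfl
  generalize Circuit.matrix (g :: (c ++ [g] : List (Gate ι))) = M at key
  have hsum : ψ = ∑ s, ψ s • Pi.single s (1 : ℂ) := by
    ext x; simp [Finset.sum_apply, Pi.single_apply]
  have h1 : M *ᵥ ψ = ∑ s, (ψ s * (if s = fun _ => false then (1 : ℂ) else -1)) •
      Pi.single s (1 : ℂ) := by
    conv_lhs => rw [hsum]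
    rw [Matrix.mulVec_sum]
    refine Finset.sum_congr rfl fun s _ => ?_
    by_cases h : ψ s = 0
    · simp [h]
    · rw [Matrix.mulVec_smul, key s (hψ s h), smul_smul]
  rw [h1]
  ext x
  simp only [Finset.sum_apply, Pi.smul_apply, Pi.sub_apply, Pi.single_apply, smul_eq_mul,
    mul_ite, mul_one, mul_zero, Finset.sum_ite_eq, Finset.mem_univ, if_true]
  by_cases h : x = fun _ => false
  · rw [if_pos h, if_pos h, h]; ring
  · rw [if_neg h, if_neg h]; ring

/-! Amplitude amplification in closed form. -/

/-- The span of `e` and `B e` is invariant under `B S B† S`, because `⟨o|B|o⟩` is real and so `B`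
and `B†` have the same overlap with `e`. `S` need act as the reflection only on `e`, `B e` and `B†
e`. -/
theorem amplification_apply {n : Type} [Fintype n] [DecidableEq n] {B S : Matrix n n ℂ} {o : n}
    (hB : B ∈ Matrix.unitaryGroup n ℂ) {x : ℝ} (hx : Real.cos x ≠ 0)
    (hS : S *ᵥ Pi.single o 1 = Pi.single o 1)
    (hSB : S *ᵥ (B *ᵥ Pi.single o 1) =
      (2 * (Real.sin x : ℂ)) • Pi.single o 1 - B *ᵥ Pi.single o 1)
    (hSB' : S *ᵥ (B.conjTranspose *ᵥ Pi.single o 1) =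
      (2 * (Real.sin x : ℂ)) • Pi.single o 1 - B.conjTranspose *ᵥ Pi.single o 1)
    (hoo : B o o = (Real.sin x : ℂ)) (j : ℕ) :
    ‖((B * (S * (B.conjTranspose * S))) ^ j * B) o o‖ ^ 2 = Real.sin ((2 * j + 1) * x) ^ 2 := by
  set e : n → ℂ := Pi.single o 1 with he
  have hBB : B.conjTranspose * B = 1 := Matrix.mem_unitaryGroup_iff'.1 hB
  have hBB' : B * B.conjTranspose = 1 := Matrix.mem_unitaryGroup_iff.1 hB
  -- The two coefficients satisfy a recursion of Chebyshev type. Multiplied by `cos x` they become a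
  -- cosine and a sine, which is why `cos x ≠ 0` is needed.
  have hcomb : ∀ j : ℕ, ∃ a b : ℝ,
      ((B * (S * (B.conjTranspose * S))) ^ j * B) *ᵥ e = (a : ℂ) • (B *ᵥ e) + (b : ℂ) • e ∧
      a * Real.cos x = (-1) ^ j * Real.cos ((2 * j + 1) * x) ∧
      b * Real.cos x = (-1) ^ j * Real.sin (2 * j * x) := by
    intro j
    induction j with
    | zero => exact ⟨1, 0, by simp, by simp, by simp⟩
    | succ j ih =>
      obtain ⟨a, b, h, ha, hb⟩ := ih
      refine ⟨(2 * Real.sin x * a + b) * (2 * Real.sin x) - a, -(2 * Real.sin x * a + b),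
        ?_, ?_, ?_⟩
      · rw [pow_succ', mul_assoc, ← Matrix.mulVec_mulVec, h, ← Matrix.mulVec_mulVec,
          ← Matrix.mulVec_mulVec, ← Matrix.mulVec_mulVec, Matrix.mulVec_add, Matrix.mulVec_smul,
          Matrix.mulVec_smul, hS, hSB]
        have h1 : B.conjTranspose *ᵥ ((a : ℂ) • ((2 * (Real.sin x : ℂ)) • e - B *ᵥ e) + (b : ℂ) • e)
            = ((2 * Real.sin x * a + b : ℝ) : ℂ) • (B.conjTranspose *ᵥ e) - (a : ℂ) • e := by
          simp only [Matrix.mulVec_add, Matrix.mulVec_sub, Matrix.mulVec_smul,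
            Matrix.mulVec_mulVec, hBB, Matrix.one_mulVec]
          push_cast
          module
        rw [h1, Matrix.mulVec_sub, Matrix.mulVec_smul, Matrix.mulVec_smul, hS, hSB']
        simp only [Matrix.mulVec_sub, Matrix.mulVec_smul,
            Matrix.mulVec_mulVec, hBB', Matrix.one_mulVec]
        push_cast
        module
      · have e1 : ((2 * Real.sin x * a + b) * (2 * Real.sin x) - a) * Real.cos x =
            (4 * Real.sin x ^ 2 - 1) * (a * Real.cos x) +
              2 * Real.sin x * (b * Real.cos x) := by ring
        rw [e1, ha, hb]
        have e2 : Real.sin (2 * j * x) = Real.sin ((2 * j + 1) * x - x) := by congr 1; ring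
        have e3 : Real.cos ((2 * ((j + 1 : ℕ) : ℝ) + 1) * x) =
            Real.cos ((2 * j + 1) * x + 2 * x) := by congr 1; push_cast; ring
        rw [e2, e3, Real.sin_sub, Real.cos_add, Real.cos_two_mul, Real.sin_two_mul, pow_succ,
          Real.cos_sq']
        ring
      · have e1 : -(2 * Real.sin x * a + b) * Real.cos x =
            -(2 * Real.sin x * (a * Real.cos x) + b * Real.cos x) := by ring
        rw [e1, ha, hb]
        have e2 : Real.sin (2 * j * x) = Real.sin ((2 * j + 1) * x - x) := by congr 1; ring
        have e3 : Real.sin (2 * ((j + 1 : ℕ) : ℝ) * x) =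
            Real.sin ((2 * j + 1) * x + x) := by congr 1; push_cast; ring
        rw [e2, e3, Real.sin_sub, Real.sin_add, pow_succ]
        ring
  obtain ⟨a, b, h, ha, hb⟩ := hcomb j
  have h0 : ((B * (S * (B.conjTranspose * S))) ^ j * B) o o =
      ((a * Real.sin x + b : ℝ) : ℂ) := by
    have := congrFun h o
    rw [he, Matrix.mulVec_single_one, Matrix.mulVec_single_one, Matrix.col_apply] at this
    rw [this]
    simp [hoo]
  have h1 : a * Real.sin x + b = (-1) ^ j * Real.sin ((2 * j + 1) * x) := by
    refine mul_right_cancel₀ hx ?_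
    have e1 : (a * Real.sin x + b) * Real.cos x =
      (a * Real.cos x) * Real.sin x + b * Real.cos x := by ring
    have e2 : Real.sin (2 * j * x) = Real.sin ((2 * j + 1) * x - x) := by congr 1; ring
    rw [e1, ha, hb, e2, Real.sin_sub]
    ring
  rw [h0, Complex.norm_real, Real.norm_eq_abs, sq_abs, h1, mul_pow, ← pow_mul, mul_comm j,
    pow_mul]
  norm_num

theorem Circuit.commute_of_disjoint_support {ι : Type} [Fintype ι] [DecidableEq ι]
    (c d : Circuit ι) (h : Disjoint c.support d.support) : Commute c.matrix d.matrix := by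
  induction d with
  | nil => exact Commute.one_right _
  | cons g d ih =>
    refine Commute.mul_right (ih (h.mono_right ?_))
      (c.commute_of_disjoint g.wires (h.mono_right ?_) g.U)
    · rintro q ⟨g', hg', hq⟩; exact ⟨g', List.mem_cons_of_mem _ hg', hq⟩
    · intro q hq; exact ⟨g, List.mem_cons_self, hq⟩

/-! ### Combining the identity and a unitary by means of one ancilla. -/

/-- The operator on one qubit that maps `|0⟩` to `p|0⟩ + q|1⟩`, unitary if `|p|² + |q|² = 1`. -/
def qubitOp (p q : ℂ) : Op (Fin 1) :=
  Matrix.of fun x y => if y 0 = true then (if x 0 = true then star p else -star q)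
    else (if x 0 = true then q else p)

theorem univ_fin_one_bool :
    (Finset.univ : Finset (Fin 1 → Bool)) = {fun _ => false, fun _ => true} := by
  decide

theorem sum_fin_one_bool (F : (Fin 1 → Bool) → ℂ) :
    ∑ x, F x = F (fun _ => false) + F (fun _ => true) := by
  rw [univ_fin_one_bool, Finset.sum_pair]
  intro h
  exact absurd (congrFun h 0) (by decide)

theorem qubitOp_mem_unitaryGroup {p q : ℂ} (h : ‖p‖ ^ 2 + ‖q‖ ^ 2 = 1) :
    qubitOp p q ∈ Matrix.unitaryGroup (Fin 1 → Bool) ℂ := by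
  have h' : p * starRingEnd ℂ p + q * starRingEnd ℂ q = 1 := by
    rw [Complex.mul_conj, Complex.mul_conj, Complex.normSq_eq_norm_sq, Complex.normSq_eq_norm_sq]
    exact_mod_cast h
  rw [Matrix.mem_unitaryGroup_iff', Matrix.star_eq_conjTranspose]
  ext x y
  rw [Matrix.mul_apply, sum_fin_one_bool]
  have hx : ∀ z : Fin 1 → Bool, z = fun _ => z 0 := fun z => by
    funext i; rw [Subsingleton.elim i 0]
  rw [hx x, hx y]
  have hne : (fun _ => true : Fin 1 → Bool) ≠ fun _ => false := fun h =>
    absurd (congrFun h 0) (by decide)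
  cases x 0 <;> cases y 0 <;> simp [qubitOp, Matrix.conjTranspose_apply, hne, hne.symm] <;>
    first | linear_combination h' | ring

/-- The embedding of a single qubit. -/
def oneWire {ι : Type} (q : ι) : Fin 1 ↪ ι := ⟨fun _ => q, fun i j _ => Subsingleton.elim i j⟩

theorem range_oneWire {ι : Type} (q : ι) : Set.range (oneWire q) = {q} := Set.range_const

theorem gateOne_matrix {ι : Type} (q : ι) (U : Op (Fin 1))
    (hU : U ∈ Matrix.unitaryGroup (Fin 1 → Bool) ℂ) :
    (gateOne q U hU).matrix = place (oneWire q) U := rfl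

theorem controlled_eq_add {ι : Type} [Fintype ι] [DecidableEq ι] (c : ι) (M : Op ι) :
    controlled c M =
      place (oneWire c) (Matrix.diagonal fun v => if v 0 = true then 0 else 1) +
        M * place (oneWire c) (Matrix.diagonal fun v => if v 0 = true then 1 else 0) := by
  ext x y
  rw [place_diagonal, place_diagonal, Matrix.add_apply, Matrix.mul_diagonal]
  have : ∀ z : ι → Bool, (z ∘ oneWire c) 0 = z c := fun _ => rfl
  simp only [this]
  cases hy : y c
  · rw [controlled_of_false _ hy]
    by_cases h : x = y
    · subst h; simp [hy]
    · simp [h]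
  · rw [controlled_of_true _ hy]
    by_cases h : x = y
    · subst h; simp [hy]
    · simp [h]

/-- The amplitude of `|0⋯0⟩` after a linear combination of the identity and `X`. -/
theorem linear_combination_apply {s ι : Type} [Fintype s] [DecidableEq s] [Fintype ι]
    [DecidableEq ι] (w : s ↪ ι) (c : ι) (hc : c ∉ Set.range w) (X : Op s) {M : Op s}
    (hM : M ∈ Matrix.unitaryGroup (s → Bool) ℂ) (p q p' q' : ℂ) :
    (place w M.conjTranspose * (place (oneWire c) (qubitOp p' q').conjTranspose *
      (controlled c (place w X) * (place (oneWire c) (qubitOp p q) * place w M))))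
        (fun _ => false) (fun _ => false) =
      star p' * p + star q' * q *
        (M.conjTranspose * (X * M)) (fun _ => false) (fun _ => false) := by
  have hd : Disjoint (Set.range (oneWire c)) (Set.range w) := by
    rw [range_oneWire]; exact Set.disjoint_singleton_left.2 hc
  have comm : ∀ (N : Op (Fin 1)) (Y : Op s), place (oneWire c) N * place w Y =
    place w Y * place (oneWire c) N := fun N Y => place_commute _ _ hd N Y
  have hMM : M.conjTranspose * M = 1 := Matrix.mem_unitaryGroup_iff'.1 hM
  set D0 : Op (Fin 1) := Matrix.diagonal fun v => if v 0 = true then 0 else 1 with hD0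
  set D1 : Op (Fin 1) := Matrix.diagonal fun v => if v 0 = true then 1 else 0 with hD1
  set A := qubitOp p q with hA
  set A' := qubitOp p' q' with hA'
  -- The projectors `D0` and `D1` on the control split the operator into two products over disjoint
  -- wires. In the first one `M† M` cancels.
  have key : place w M.conjTranspose * (place (oneWire c) A'.conjTranspose *
      (controlled c (place w X) * (place (oneWire c) A * place w M))) =
      place (oneWire c) (A'.conjTranspose * D0 * A) * place w 1 +
      place (oneWire c) (A'.conjTranspose * D1 * A) * place w (M.conjTranspose * (X * M)) := by
    rw [controlled_eq_add, ← hD0, ← hD1, add_mul, mul_add, mul_add]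
    have k : ∀ (N : Op (Fin 1)) (Y Z : Op s), place w Y * (place (oneWire c) N * place w Z) =
        place (oneWire c) N * place w (Y * Z) := fun N Y Z => by
      rw [← mul_assoc, ← comm, mul_assoc, place_mul w Y]
    congr 1
    · rw [← hMM, ← k, place_mul (oneWire c), place_mul (oneWire c)]
      simp only [mul_assoc]
    · rw [← k, place_mul (oneWire c), place_mul (oneWire c), mul_assoc (place w X),
        ← mul_assoc (place (oneWire c) D1), ← place_mul (oneWire c), k, place_mul (oneWire c)]
      simp only [mul_assoc]
  rw [key, Matrix.add_apply, place_mul_place_apply _ _ hd _ _ _ _ (fun _ _ _ => rfl),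
    place_mul_place_apply _ _ hd _ _ _ _ (fun _ _ _ => rfl)]
  have e0 : (A'.conjTranspose * D0 * A) (fun _ => false) (fun _ => false) = star p' * p := by
    simp [Matrix.mul_apply, sum_fin_one_bool, hD0, hA, hA', qubitOp, Matrix.diagonal_apply]
  have e1 : (A'.conjTranspose * D1 * A) (fun _ => false) (fun _ => false) = star q' * q := by
    simp [Matrix.mul_apply, sum_fin_one_bool, hD1, hA, hA', qubitOp, Matrix.diagonal_apply]
  have e2 : ((fun _ => false : ι → Bool) ∘ oneWire c) = fun _ => false := rfl
  have e3 : ((fun _ => false : ι → Bool) ∘ w) = fun _ => false := rfl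
  rw [e2, e3, e0, e1, Matrix.one_apply_eq, mul_one]

/-! Layers of one-qubit gates. -/

/-- One layer of one-qubit gates that prepares the state `φ i` of every qubit `i` of a list. -/
def layer {ι : Type} (φ : ι → Bool → ℂ) (hφ : ∀ i, ‖φ i false‖ ^ 2 + ‖φ i true‖ ^ 2 = 1)
    (L : List ι) : Circuit ι :=
  L.map fun i => gateOne i (qubitOp (φ i false) (φ i true)) (qubitOp_mem_unitaryGroup (hφ i))

theorem layer_apply {ι : Type} [Fintype ι] [DecidableEq ι] {φ : ι → Bool → ℂ}
    (hφ : ∀ i, ‖φ i false‖ ^ 2 + ‖φ i true‖ ^ 2 = 1) (L : List ι) (hL : L.Nodup)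
    (x y : ι → Bool) :
    (layer φ hφ L).matrix x y = if ∀ i, i ∉ L → x i = y i then
      (L.map fun i => qubitOp (φ i false) (φ i true) (fun _ => x i) (fun _ => y i)).prod
      else 0 := by
  induction L generalizing y with
  | nil =>
    simp only [layer, List.map_nil, Circuit.matrix, List.not_mem_nil, not_false_eq_true,
      true_imp_iff, List.prod_nil, Matrix.one_apply, funext_iff]
  | cons i L ih =>
    obtain ⟨hi, hL⟩ := List.nodup_cons.1 hL
    have h1 : (layer φ hφ (i :: L)).matrix = (layer φ hφ L).matrix *
      place (oneWire i) (qubitOp (φ i false) (φ i true)) := rfl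
    rw [h1, Matrix.mul_apply, Finset.sum_eq_single (update y i (x i))]
    · rw [ih hL, place_of_agree]
      · have e1 : (update y i (x i) ∘ oneWire i) = fun _ => x i := by
          funext j; exact update_self _ _ _
        have e2 : (y ∘ oneWire i) = fun _ => y i := rfl
        have e3 : (∀ j, j ∉ L → x j = update y i (x i) j) ↔ ∀ j, j ∉ i :: L → x j = y j := by
          refine forall_congr' fun j => ?_
          by_cases hj : j = i
          · subst hj; simp
          · simp [hj]
        rw [e1, e2]
        simp only [e3, List.map_cons, List.prod_cons, ite_mul, zero_mul]
        refine if_congr Iff.rfl ?_ rfl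
        rw [mul_comm]
        congr 2
        refine List.map_congr_left fun j hj => ?_
        rw [update_of_ne (fun h : j = i => hi (h ▸ hj))]
      · intro j hj
        rw [range_oneWire] at hj
        exact update_of_ne hj _ _
    · intro z _ hz
      by_cases h2 : ∀ j, j ∉ Set.range (oneWire i) → z j = y j
      · rw [ih hL, if_neg, zero_mul]
        intro h3
        apply hz
        funext j
        by_cases hj : j = i
        · rw [hj, update_self, h3 i hi]
        · rw [update_of_ne hj]; exact h2 j (by rw [range_oneWire]; exact hj)
      · rw [place_of_not_agree _ _ h2, mul_zero]
    · simp

theorem support_layer {ι : Type} {φ : ι → Bool → ℂ}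
    (hφ : ∀ i, ‖φ i false‖ ^ 2 + ‖φ i true‖ ^ 2 = 1) (L : List ι) :
    (layer φ hφ L).support = {i | i ∈ L} := by
  ext i
  constructor
  · rintro ⟨g, hg, hi⟩
    obtain ⟨j, hj, rfl⟩ := List.mem_map.1 hg
    obtain ⟨_, rfl⟩ := hi
    exact hj
  · intro hi
    exact ⟨_, List.mem_map_of_mem hi, (0 : Fin 1), rfl⟩

theorem layer_append {ι : Type} [Fintype ι] [DecidableEq ι] {φ : ι → Bool → ℂ}
    (hφ : ∀ i, ‖φ i false‖ ^ 2 + ‖φ i true‖ ^ 2 = 1) (L L' : List ι) :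
    (layer φ hφ (L ++ L')).matrix = (layer φ hφ L').matrix * (layer φ hφ L).matrix := by
  rw [layer, List.map_append, Circuit.matrix_append]; rfl

/-- Preparing also the qubits on which neither `X` nor `V` acts does not change the expectation. -/
theorem expectation_layer_append {ι : Type} [Fintype ι] [DecidableEq ι] {φ : ι → Bool → ℂ}
    (hφ : ∀ i, ‖φ i false‖ ^ 2 + ‖φ i true‖ ^ 2 = 1) (L L' : List ι) (X V : Circuit ι)
    (hX : ∀ i ∈ L', i ∉ X.support) (hV : ∀ i ∈ L', i ∉ V.support) :
    (V.matrix * (layer φ hφ (L ++ L')).matrix).conjTranspose *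
        (X.matrix * (V.matrix * (layer φ hφ (L ++ L')).matrix)) =
      (V.matrix * (layer φ hφ L).matrix).conjTranspose *
        (X.matrix * (V.matrix * (layer φ hφ L).matrix)) := by
  set N := (layer φ hφ L').matrix with hN
  have hNN : N.conjTranspose * N = 1 :=
    Matrix.mem_unitaryGroup_iff'.1 (layer φ hφ L').matrix_mem_unitaryGroup
  have h1 : Commute X.matrix N := X.commute_of_disjoint_support _ (by
    rw [support_layer]; exact Set.disjoint_right.2 hX)
  have h2 : Commute V.matrix N := V.commute_of_disjoint_support _ (by
    rw [support_layer]; exact Set.disjoint_right.2 hV)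
  have h3 : V.matrix * (layer φ hφ (L ++ L')).matrix =
      N * (V.matrix * (layer φ hφ L).matrix) := by
    rw [layer_append, ← mul_assoc, ← hN, h2.eq, mul_assoc]
  rw [h3]
  generalize V.matrix * (layer φ hφ L).matrix = Y
  rw [Matrix.conjTranspose_mul, ← mul_assoc X.matrix, h1.eq, mul_assoc, mul_assoc,
    ← mul_assoc Nᴴ, hNN, one_mul]

/-! Encoded operators. -/

theorem sum_norm_sq_col {n : Type} [Fintype n] [DecidableEq n] {U : Matrix n n ℂ}
    (hU : U ∈ Matrix.unitaryGroup n ℂ) (y : n) : ∑ x, ‖U x y‖ ^ 2 = 1 := by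
  have h : (star U * U) y y = 1 := by
    rw [Matrix.mem_unitaryGroup_iff'.1 hU, Matrix.one_apply_eq]
  rw [Matrix.mul_apply] at h
  have h2 : ((∑ x, ‖U x y‖ ^ 2 : ℝ) : ℂ) = 1 := by
    rw [← h, Complex.ofReal_sum]
    refine Finset.sum_congr rfl fun x _ => ?_
    rw [Matrix.star_apply, RCLike.star_def, ← Complex.normSq_eq_conj_mul_self,
      Complex.normSq_eq_norm_sq]
  exact_mod_cast h2

/-- The encoded part of the column already has norm one, and so has the whole column, so nothing
leaks out of the encoded subspace. -/
theorem apply_eq_zero_of_not_mem_range {n Y : Type} [Fintype n] [DecidableEq n] [Fintype Y]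
    [DecidableEq Y] {V : Matrix n n ℂ} (hV : V ∈ Matrix.unitaryGroup n ℂ) {enc : Y → n}
    (he : Injective enc) (hU : V.submatrix enc enc ∈ Matrix.unitaryGroup Y ℂ) (q : Y) {y : n}
    (hy : y ∉ Set.range enc) : V y (enc q) = 0 := by
  have h1 := sum_norm_sq_col hV (enc q)
  have h2 := sum_norm_sq_col hU q
  have h3 : ∑ x ∈ Finset.univ.image enc, ‖V x (enc q)‖ ^ 2 = 1 := by
    rw [Finset.sum_image (fun a _ b _ h => he h)]; exact h2
  have h4 : y ∉ Finset.univ.image enc := by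
    simpa using hy
  have h5 : ∑ x ∈ insert y (Finset.univ.image enc), ‖V x (enc q)‖ ^ 2 ≤ 1 := by
    rw [← h1]
    exact Finset.sum_le_univ_sum_of_nonneg fun _ => by positivity
  rw [Finset.sum_insert h4, h3] at h5
  have h6 : ‖V y (enc q)‖ ^ 2 ≤ 0 := by linarith
  simpa using (pow_eq_zero_iff (two_ne_zero)).1 (le_antisymm h6 (by positivity))

theorem apply_enc {n Y : Type} [Fintype n] [DecidableEq n] [Fintype Y] [DecidableEq Y]
    {V : Matrix n n ℂ} (hV : V ∈ Matrix.unitaryGroup n ℂ) {enc : Y → n}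
    (he : Injective enc) {U : Matrix Y Y ℂ} (hVU : V.submatrix enc enc = U)
    (hU : U ∈ Matrix.unitaryGroup Y ℂ) (q : Y) (y : n) :
    V y (enc q) = ∑ p, if y = enc p then U p q else 0 := by
  subst hVU
  by_cases hy : y ∈ Set.range enc
  · obtain ⟨p, rfl⟩ := hy
    simp [he.eq_iff]
  · rw [apply_eq_zero_of_not_mem_range hV he hU q hy, Finset.sum_eq_zero]
    intro p _
    exact if_neg fun h => hy ⟨p, h.symm⟩

/-! The expectation of a block-encoded operator in a prepared state. -/

/-- The qubits of a block-encoding inside all system qubits. -/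
def blockWires (a n b : ℕ) : Fin a ⊕ Fin n ↪ Fin a ⊕ (Fin n ⊕ Fin b) :=
  Embedding.sumMap (Embedding.refl _) Embedding.inl

/-- The qubits of a preparation unitary inside all system qubits. -/
def prepWires (a n b : ℕ) : Fin n ⊕ Fin b ↪ Fin a ⊕ (Fin n ⊕ Fin b) := Embedding.inr

/-- The one-qubit states whose product is the initial state. -/
def initialQubits {k l a n b : ℕ} [NeZero k] [NeZero l]
    (encK : Fin k ↪ (Fin a → Bool)) (encL : Fin l ↪ (Fin b → Bool)) (φ : Fin n → Bool → ℂ) :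
    Fin a ⊕ (Fin n ⊕ Fin b) → Bool → ℂ :=
  Sum.elim (fun i c => if c = encK 0 i then 1 else 0)
    (Sum.elim φ (fun i c => if c = encL 0 i then 1 else 0))

theorem initialQubits_normalized {k l a n b : ℕ} [NeZero k] [NeZero l]
    (encK : Fin k ↪ (Fin a → Bool)) (encL : Fin l ↪ (Fin b → Bool)) {φ : Fin n → Bool → ℂ}
    (hφ : ∀ i, ‖φ i false‖ ^ 2 + ‖φ i true‖ ^ 2 = 1) (i : Fin a ⊕ (Fin n ⊕ Fin b)) :
    ‖initialQubits encK encL φ i false‖ ^ 2 + ‖initialQubits encK encL φ i true‖ ^ 2 = 1 := by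
  rcases i with i | i | i
  · cases h : encK 0 i <;> simp [initialQubits, h]
  · exact hφ i
  · cases h : encL 0 i <;> simp [initialQubits, h]

theorem prod_basis_state {m : ℕ} (s t : Fin m → Bool) :
    ∏ i, (if s i = t i then (1 : ℂ) else 0) = if s = t then 1 else 0 := by
  rw [Finset.prod_boole]
  simp [funext_iff]

theorem layer_initialQubits_apply {k l a n b D : ℕ} [NeZero k] [NeZero l]
    (encK : Fin k ↪ (Fin a → Bool)) (encL : Fin l ↪ (Fin b → Bool))
    (encH : Fin D ↪ (Fin n → Bool)) {z : Fin D → ℂ} {φ : Fin n → Bool → ℂ}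
    (hφ : ∀ i, ‖φ i false‖ ^ 2 + ‖φ i true‖ ^ 2 = 1)
    (hz : ∀ s : Fin n → Bool, (∑ x, if encH x = s then z x else 0) = ∏ i, φ i (s i))
    {L : List (Fin a ⊕ (Fin n ⊕ Fin b))} (hL : L.Nodup) (hL' : ∀ i, i ∈ L)
    (s : Fin a ⊕ (Fin n ⊕ Fin b) → Bool) :
    (layer _ (initialQubits_normalized encK encL hφ) L).matrix s (fun _ => false) =
      (if s ∘ Sum.inl = encK 0 then 1 else 0) *
        ∑ x, if s ∘ Sum.inr = encPair encH encL (x, 0) then z x else 0 := by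
  rw [layer_apply _ L hL, if_pos (fun i hi => absurd (hL' i) hi), ← List.prod_toFinset _ hL]
  have hu : L.toFinset = Finset.univ := by ext i; simp [hL']
  rw [hu, Fintype.prod_sum_type, Fintype.prod_sum_type]
  have hq : ∀ i, qubitOp (initialQubits encK encL φ i false) (initialQubits encK encL φ i true)
      (fun _ => s i) (fun _ => false) = initialQubits encK encL φ i (s i) := fun i => by
    cases h : s i <;> simp [qubitOp]
  simp only [hq]
  have h1 : ∏ i, initialQubits encK encL φ (Sum.inl i) (s (Sum.inl i)) =
      if s ∘ Sum.inl = encK 0 then 1 else 0 := prod_basis_state (s ∘ Sum.inl) (encK 0)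
  have h2 : ∏ i, initialQubits encK encL φ (Sum.inr (Sum.inl i)) (s (Sum.inr (Sum.inl i))) =
      ∑ x, if encH x = s ∘ Sum.inr ∘ Sum.inl then z x else 0 := (hz _).symm
  have h3 : ∏ i, initialQubits encK encL φ (Sum.inr (Sum.inr i)) (s (Sum.inr (Sum.inr i))) =
      if s ∘ Sum.inr ∘ Sum.inr = encL 0 then 1 else 0 :=
    prod_basis_state (s ∘ Sum.inr ∘ Sum.inr) (encL 0)
  rw [h1, h2, h3, Finset.sum_mul]
  congr 1
  refine Finset.sum_congr rfl fun x _ => ?_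
  have : s ∘ Sum.inr = encPair encH encL (x, 0) ↔
      encH x = s ∘ Sum.inr ∘ Sum.inl ∧ s ∘ Sum.inr ∘ Sum.inr = encL 0 := by
    constructor
    · intro h
      exact ⟨funext fun i => (congrFun h (Sum.inl i)).symm, funext fun i => congrFun h (Sum.inr i)⟩
    · rintro ⟨e1, e2⟩
      funext i
      rcases i with i | i
      · exact (congrFun e1 i).symm
      · exact congrFun e2 i
  by_cases e1 : encH x = s ∘ Sum.inr ∘ Sum.inl <;>
    by_cases e2 : s ∘ Sum.inr ∘ Sum.inr = encL 0 <;> simp [this, e1, e2]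

theorem encPair_injective {k D a n : ℕ} (e : Fin k ↪ (Fin a → Bool)) (f : Fin D ↪ (Fin n → Bool)) :
    Injective (encPair e f) := by
  rintro ⟨x, y⟩ ⟨x', y'⟩ h
  exact Prod.ext (e.injective (funext fun i => congrFun h (Sum.inl i)))
    (f.injective (funext fun i => congrFun h (Sum.inr i)))

theorem extend_prepWires {a n b : ℕ} (u : Fin n ⊕ Fin b → Bool)
    (s : Fin a ⊕ (Fin n ⊕ Fin b) → Bool) :
    extend (prepWires a n b) u s = Sum.elim (s ∘ Sum.inl) u := by
  funext i
  rcases i with i | i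
  · exact extend_off (prepWires a n b) u s (by rintro ⟨j, hj⟩; exact Sum.inr_ne_inl hj)
  · exact (prepWires a n b).injective.extend_apply u s i

theorem prepared_apply {k l a n b D R : ℕ} [NeZero k] [NeZero l]
    (encK : Fin k ↪ (Fin a → Bool)) (encL : Fin l ↪ (Fin b → Bool))
    (encH : Fin D ↪ (Fin n → Bool)) {z : Fin D → ℂ} {φ : Fin n → Bool → ℂ}
    (hφ : ∀ i, ‖φ i false‖ ^ 2 + ‖φ i true‖ ^ 2 = 1)
    (hz : ∀ s : Fin n → Bool, (∑ x, if encH x = s then z x else 0) = ∏ i, φ i (s i))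
    {ρ : Matrix (Fin D) (Fin D) ℂ} (Uρ : PreparationUnitary encH encL z R ρ)
    {L : List (Fin a ⊕ (Fin n ⊕ Fin b))} (hL : L.Nodup) (hL' : ∀ i, i ∈ L)
    (s : Fin a ⊕ (Fin n ⊕ Fin b) → Bool) :
    (place (prepWires a n b) Uρ.circuit.matrix *
        (layer _ (initialQubits_normalized encK encL hφ) L).matrix) s (fun _ => false) =
      ∑ p, if s = Sum.elim (encK 0) (encPair encH encL p) then preparedState Uρ.U z p else 0 := by
  rw [Matrix.mul_apply, sum_place_mul]
  simp only [layer_initialQubits_apply encK encL encH hφ hz hL hL', extend_prepWires]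
  have c1 : ∀ u : Fin n ⊕ Fin b → Bool, (Sum.elim (s ∘ Sum.inl) u) ∘ Sum.inl = s ∘ Sum.inl :=
    fun _ => rfl
  have c2 : ∀ u : Fin n ⊕ Fin b → Bool, (Sum.elim (s ∘ Sum.inl) u) ∘ Sum.inr = u := fun _ => rfl
  simp only [c1, c2]
  have hsel : ∀ p : Fin D × Fin l, s = Sum.elim (encK 0) (encPair encH encL p) ↔
      s ∘ Sum.inl = encK 0 ∧ s ∘ prepWires a n b = encPair encH encL p := by
    intro p
    constructor
    · rintro rfl; exact ⟨rfl, rfl⟩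
    · rintro ⟨e1, e2⟩
      funext i
      rcases i with i | i
      · exact congrFun e1 i
      · exact congrFun e2 i
  simp only [hsel]
  by_cases hK : s ∘ Sum.inl = encK 0
  · simp only [hK, if_true, one_mul, true_and]
    calc _ = ∑ u, ∑ x, (if u = encPair encH encL (x, 0) then
          Uρ.circuit.matrix (s ∘ prepWires a n b) u * z x else 0) := by
          refine Finset.sum_congr rfl fun u _ => ?_
          rw [Finset.mul_sum]
          simp only [mul_ite, mul_zero]
      _ = ∑ x, Uρ.circuit.matrix (s ∘ prepWires a n b) (encPair encH encL (x, 0)) * z x := by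
          rw [Finset.sum_comm]
          refine Finset.sum_congr rfl fun x _ => ?_
          rw [Finset.sum_ite_eq' Finset.univ, if_pos (Finset.mem_univ _)]
      _ = ∑ x, ∑ p, (if s ∘ prepWires a n b = encPair encH encL p then
            Uρ.U p (x, 0) * z x else 0) := by
          refine Finset.sum_congr rfl fun x _ => ?_
          rw [apply_enc Uρ.circuit.matrix_mem_unitaryGroup (encPair_injective encH encL)
            Uρ.implements Uρ.unitary_U, Finset.sum_mul]
          simp only [ite_mul, zero_mul]
      _ = _ := by
          rw [Finset.sum_comm]
          refine Finset.sum_congr rfl fun p _ => ?_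
          by_cases hp : s ∘ prepWires a n b = encPair encH encL p
          · simp only [hp, if_true, preparedState, Matrix.mulVec, dotProduct]
            rw [Fintype.sum_prod_type]
            simp
          · simp [hp]
  · simp [hK]

theorem eq_of_opNorm_sub_le_zero {D : ℕ} {A B : Matrix (Fin D) (Fin D) ℂ}
    (h : opNorm (A - B) ≤ 0) : A = B := by
  have h1 : Matrix.toEuclideanCLM (n := Fin D) (𝕜 := ℂ) (A - B) = 0 := norm_le_zero_iff.1 h
  exact sub_eq_zero.1 ((map_eq_zero_iff _
    (Matrix.toEuclideanCLM (n := Fin D) (𝕜 := ℂ)).injective).1 h1)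

/-- `M` maps `|0⋯0⟩` to the encoded purification of `ρ` tensored with the code word of `|0⟩_k`.
Hence only the zero block of the block-encoding, `A/α`, is seen, and tracing out `ℂ^l` leaves `ρ`.
-/
theorem expectation_eq_trace {k l a n b D Q R : ℕ} [NeZero k] [NeZero l] {α : ℝ}
    (encK : Fin k ↪ (Fin a → Bool)) (encL : Fin l ↪ (Fin b → Bool))
    (encH : Fin D ↪ (Fin n → Bool)) {z : Fin D → ℂ} {φ : Fin n → Bool → ℂ}
    (hφ : ∀ i, ‖φ i false‖ ^ 2 + ‖φ i true‖ ^ 2 = 1)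
    (hz : ∀ s : Fin n → Bool, (∑ x, if encH x = s then z x else 0) = ∏ i, φ i (s i))
    {A ρ : Matrix (Fin D) (Fin D) ℂ} (UA : BlockEncoding encK encH 0 α Q A)
    (Uρ : PreparationUnitary encH encL z R ρ)
    {L : List (Fin a ⊕ (Fin n ⊕ Fin b))} (hL : L.Nodup) (hL' : ∀ i, i ∈ L)
    {M : Op (Fin a ⊕ (Fin n ⊕ Fin b))}
    (hM : M = place (prepWires a n b) Uρ.circuit.matrix *
        (layer _ (initialQubits_normalized encK encL hφ) L).matrix) :
    (M.conjTranspose * (place (blockWires a n b) UA.circuit.matrix * M))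
      (fun _ => false) (fun _ => false) = (α : ℂ)⁻¹ * (ρ * A).trace := by
  set ψ := preparedState Uρ.U z with hψ
  let full : Fin D × Fin l → (Fin a ⊕ (Fin n ⊕ Fin b) → Bool) :=
    fun p => Sum.elim (encK 0) (encPair encH encL p)
  have hcol : ∀ s, M s (fun _ => false) = ∑ p, if s = full p then ψ p else 0 := fun s => by
    rw [hM]; exact prepared_apply encK encL encH hφ hz Uρ hL hL' s
  -- The block-encoding does not touch the qubits of `ℂ^l`, so it is diagonal in the second
  -- component.
  have hentry : ∀ p p' : Fin D × Fin l, place (blockWires a n b) UA.circuit.matrix (full p') (full p) =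
      if p'.2 = p.2 then ((α : ℂ)⁻¹ • A) p'.1 p.1 else 0 := by
    intro p p'
    by_cases h : p'.2 = p.2
    · rw [if_pos h, place_of_agree, eq_of_opNorm_sub_le_zero UA.accurate]
      · rw [zeroBlock, Matrix.of_apply, ← UA.implements, Matrix.submatrix_apply]
        congr 1 <;> (funext i; rcases i with i | i <;> rfl)
      · intro i hi
        rcases i with i | i | i
        · exact absurd ⟨Sum.inl i, rfl⟩ hi
        · exact absurd ⟨Sum.inr i, rfl⟩ hi
        · change encL p'.2 i = encL p.2 i
          rw [h]
    · rw [if_neg h, place_of_not_agree]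
      intro h'
      refine h (encL.injective (funext fun i => ?_))
      refine h' (Sum.inr (Sum.inr i)) ?_
      rintro ⟨j | j, hj⟩
      · exact Sum.inl_ne_inr hj
      · exact Sum.inl_ne_inr (Sum.inr_injective hj)
  generalize place (blockWires a n b) UA.circuit.matrix = X at hentry
  have h1 : (M.conjTranspose * (X * M)) (fun _ => false) (fun _ => false) =
      ∑ p', ∑ p, star (ψ p') * (X (full p') (full p) * ψ p) := by
    have e1 : ∀ F : (Fin a ⊕ (Fin n ⊕ Fin b) → Bool) → ℂ,
        ∑ s, F s * M s (fun _ => false) = ∑ p, F (full p) * ψ p := fun F => by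
      simp only [hcol, Finset.mul_sum, mul_ite, mul_zero]
      rw [Finset.sum_comm]
      simp
    have e2 : ∀ F : (Fin a ⊕ (Fin n ⊕ Fin b) → Bool) → ℂ,
        ∑ s, M.conjTranspose (fun _ => false) s * F s = ∑ p, star (ψ p) * F (full p) := fun F => by
      have : ∀ s, M.conjTranspose (fun _ => false) s * F s = star (star (F s) * M s fun _ => false) :=
        fun s => by rw [star_mul, star_star, Matrix.conjTranspose_apply]
      simp only [this]
      rw [← star_sum, e1, star_sum]
      simp only [star_mul, star_star]
    rw [Matrix.mul_apply, e2]
    refine Finset.sum_congr rfl fun p' _ => ?_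
    rw [Matrix.mul_apply, e1, Finset.mul_sum]
  have h2 : ρ = reducedState ψ := Uρ.prepares.symm
  have h3 : (α : ℂ)⁻¹ * (ρ * A).trace = (ρ * ((α : ℂ)⁻¹ • A)).trace := by
    rw [Matrix.mul_smul, Matrix.trace_smul, smul_eq_mul]
  rw [h1, h3]
  generalize (α : ℂ)⁻¹ • A = Z at hentry
  simp only [hentry, Fintype.sum_prod_type, ite_mul, zero_mul, mul_ite, mul_zero,
    Finset.sum_ite_eq, Finset.mem_univ, if_true, Matrix.trace, Matrix.diag_apply, Matrix.mul_apply,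
    h2, reducedState, Matrix.of_apply, Finset.sum_mul]
  rw [Finset.sum_congr rfl fun x _ => Finset.sum_comm, Finset.sum_comm]
  refine Finset.sum_congr rfl fun x _ => ?_
  refine Finset.sum_congr rfl fun y _ => ?_
  refine Finset.sum_congr rfl fun j _ => ?_
  ring

/-! Programs. -/

theorem programMatrix_append {r₁ r₂ : Type} {m : ℕ} (V₁ : Op r₁) (V₂ : Op r₂)
    (p q : List (Instr r₁ r₂ m)) :
    programMatrix V₁ V₂ (p ++ q) = programMatrix V₁ V₂ q * programMatrix V₁ V₂ p := by
  induction p with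
  | nil => simp [programMatrix]
  | cons s p ih => rw [List.cons_append, programMatrix, programMatrix, ih, mul_assoc]

theorem programMatrix_gates {r₁ r₂ : Type} {m : ℕ} (V₁ : Op r₁) (V₂ : Op r₂)
    (c : Circuit (Fin m)) :
    programMatrix V₁ V₂ (List.map Instr.gate c : List (Instr r₁ r₂ m)) = c.matrix := by
  induction c with
  | nil => rfl
  | cons g c ih => rw [List.map_cons, programMatrix, Circuit.matrix, ih]; rfl

theorem callMatrix_mem_unitaryGroup {r : Type} [Fintype r] [DecidableEq r] {m : ℕ} {V : Op r}
    (hV : V ∈ Matrix.unitaryGroup (r → Bool) ℂ) (w : r ↪ Fin m) (inv : Bool)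
    (ctrl : Option (Fin m)) (h : ∀ q ∈ ctrl, q ∉ Set.range w) :
    callMatrix V w inv ctrl ∈ Matrix.unitaryGroup (Fin m → Bool) ℂ := by
  have hW : (if inv then V.conjTranspose else V) ∈ Matrix.unitaryGroup (r → Bool) ℂ := by
    cases inv
    · exact hV
    · exact Unitary.star_mem hV
  cases ctrl with
  | none => exact place_mem_unitaryGroup w hW
  | some q =>
    exact controlled_mem_unitaryGroup (fixes_place w _) (h q rfl) (place_mem_unitaryGroup w hW)

theorem programMatrix_mem_unitaryGroup {r₁ r₂ : Type} [Fintype r₁] [DecidableEq r₁] [Fintype r₂]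
    [DecidableEq r₂] {m : ℕ} {V₁ : Op r₁} {V₂ : Op r₂}
    (h₁ : V₁ ∈ Matrix.unitaryGroup (r₁ → Bool) ℂ) (h₂ : V₂ ∈ Matrix.unitaryGroup (r₂ → Bool) ℂ)
    (p : List (Instr r₁ r₂ m)) :
    programMatrix V₁ V₂ p ∈ Matrix.unitaryGroup (Fin m → Bool) ℂ := by
  induction p with
  | nil => exact one_mem _
  | cons s p ih =>
    refine mul_mem ih ?_
    cases s with
    | gate g => exact g.matrix_mem_unitaryGroup
    | call₁ w inv ctrl h => exact callMatrix_mem_unitaryGroup h₁ w inv ctrl h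
    | call₂ w inv ctrl h => exact callMatrix_mem_unitaryGroup h₂ w inv ctrl h

theorem programCost_append {r₁ r₂ : Type} {m : ℕ} (V₁ : Op r₁) (V₂ : Op r₂)
    (p q : List (Instr r₁ r₂ m)) :
    programCost V₁ V₂ (p ++ q) = programCost V₁ V₂ p + programCost V₁ V₂ q := by
  simp [programCost]

theorem programCost_gates {r₁ r₂ : Type} {m : ℕ} (V₁ : Op r₁) (V₂ : Op r₂)
    (c : List (Gate (Fin m))) :
    programCost V₁ V₂ (c.map Instr.gate : List (Instr r₁ r₂ m)) = c.length := by
  induction c with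
  | nil => rfl
  | cons g c ih =>
    have : programCost V₁ V₂ (Instr.gate g :: c.map Instr.gate : List (Instr r₁ r₂ m)) =
      1 + programCost V₁ V₂ (c.map Instr.gate : List (Instr r₁ r₂ m)) := by
      simp [programCost, Instr.cost]
    rw [List.map_cons, this, ih, List.length_cons]
    push_cast
    rw [add_comm]

theorem programMatrix_replicate {r₁ r₂ : Type} {m : ℕ} (V₁ : Op r₁) (V₂ : Op r₂)
    (p : List (Instr r₁ r₂ m)) (j : ℕ) :
    programMatrix V₁ V₂ (List.replicate j p).flatten = programMatrix V₁ V₂ p ^ j := by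
  induction j with
  | zero => rfl
  | succ j ih => rw [List.replicate_succ, List.flatten_cons, programMatrix_append, ih, pow_succ]

theorem programCost_replicate {r₁ r₂ : Type} {m : ℕ} (V₁ : Op r₁) (V₂ : Op r₂)
    (p : List (Instr r₁ r₂ m)) (j : ℕ) :
    programCost V₁ V₂ (List.replicate j p).flatten = j * programCost V₁ V₂ p := by
  induction j with
  | zero => simp [programCost]
  | succ j ih =>
    rw [List.replicate_succ, List.flatten_cons, programCost_append, ih]
    push_cast
    ring

theorem Fixes.place {r ι : Type} {T : Set r} {M : Op r} (hM : Fixes T M) (w : r ↪ ι) :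
    Fixes (w '' T) (place w M) := by
  intro x y hxy i hi
  by_cases h : ∀ i, i ∉ Set.range w → x i = y i
  · by_cases hw : i ∈ Set.range w
    · obtain ⟨j, rfl⟩ := hw
      rw [place_of_agree w M h] at hxy
      exact hM _ _ hxy j fun hj => hi ⟨j, hj, rfl⟩
    · exact h i hw
  · exact absurd (place_of_not_agree w M h) hxy

/-! ### The amplified program and its cost. -/

/-- Preparation, one-qubit gate, controlled call of the block-encoding, inverse one-qubit gate,
inverse preparation. -/
def sandwich {r₁ r₂ : Type} {m : ℕ} (prep : Circuit (Fin m)) (w₁ : r₁ ↪ Fin m) (w₂ : r₂ ↪ Fin m)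
    (c : Fin m) (hc : c ∉ Set.range w₁) (g g' : Gate (Fin m)) (inv : Bool) :
    List (Instr r₁ r₂ m) :=
  List.map Instr.gate prep ++
    ([.call₂ w₂ false none (by simp), .gate g, .call₁ w₁ inv (some c) (by simpa using hc),
      .gate g'.inverse, .call₂ w₂ true none (by simp)] ++
    List.map Instr.gate (List.map Gate.inverse prep).reverse)

theorem programMatrix_sandwich {r₁ r₂ : Type} {m : ℕ} (prep : Circuit (Fin m)) (w₁ : r₁ ↪ Fin m)
    (w₂ : r₂ ↪ Fin m) (c : Fin m) (hc : c ∉ Set.range w₁) (g g' : Gate (Fin m)) (inv : Bool)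
    (V₁ : Op r₁) (V₂ : Op r₂) :
    programMatrix V₁ V₂ (sandwich prep w₁ w₂ c hc g g' inv) =
      prep.matrix.conjTranspose * ((place w₂ V₂).conjTranspose * (g'.matrix.conjTranspose *
        (controlled c (place w₁ (if inv then V₁.conjTranspose else V₁)) * (g.matrix *
          (place w₂ V₂ * prep.matrix))))) := by
  rw [sandwich, programMatrix_append, programMatrix_append, programMatrix_gates,
    programMatrix_gates, Circuit.matrix_inverse]
  simp only [programMatrix, one_mul, Instr.matrix, callMatrix, Gate.matrix_inverse,
    place_conjTranspose, mul_assoc, if_true]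
  rfl

/-- The factor seven is charged also for the two uncontrolled calls of `V₂`, hence `14`. -/
theorem programCost_sandwich_le {r₁ r₂ : Type} [Fintype r₁] [DecidableEq r₁] [Fintype r₂]
    [DecidableEq r₂] {m : ℕ} (prep : Circuit (Fin m)) (w₁ : r₁ ↪ Fin m)
    (w₂ : r₂ ↪ Fin m) (c : Fin m) (hc : c ∉ Set.range w₁) (g g' : Gate (Fin m)) (inv : Bool)
    (c₁ : Circuit r₁) (c₂ : Circuit r₂) :
    programCost c₁.matrix c₂.matrix (sandwich prep w₁ w₂ c hc g g' inv) ≤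
      ((2 * prep.length + 14 * c₂.length + 7 * c₁.length + 2 : ℕ) : ℕ∞) := by
  rw [sandwich, programCost_append, programCost_append, programCost_gates, programCost_gates,
    List.length_reverse, List.length_map]
  have h1 := circuitComplexity_callMatrix_le c₁ w₁ inv (some c) (by simpa using hc)
  have h2 := circuitComplexity_callMatrix_le c₂ w₂ false none (by simp)
  have h3 := circuitComplexity_callMatrix_le c₂ w₂ true none (by simp)
  have : programCost c₁.matrix c₂.matrix ([.call₂ w₂ false none (by simp), .gate g,
      .call₁ w₁ inv (some c) (by simpa using hc),
      .gate g'.inverse, .call₂ w₂ true none (by simp)] : List (Instr r₁ r₂ m)) ≤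
      ((7 * c₂.length : ℕ) : ℕ∞) + (1 + (((7 * c₁.length : ℕ) : ℕ∞) +
        (1 + (((7 * c₂.length : ℕ) : ℕ∞) + 0)))) := by
    simp only [programCost, List.map_cons, List.map_nil, List.sum_cons, List.sum_nil, Instr.cost]
    gcongr
  refine (add_le_add_right (add_le_add_left this _) _).trans (le_of_eq ?_)
  push_cast
  ring

/-- Wires for the system qubits and one further qubit, and a circuit that reflects about `|0⋯0⟩`
the states in which all qubits but this one and those in `L` are in the state `|0⟩`. -/
theorem exists_wires (S : Type) [Fintype S] [DecidableEq S] (L : List S) (hL : L.Nodup) :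
    ∃ (m : ℕ) (s : S ↪ Fin m) (c : Fin m) (r : Circuit (Fin m)), c ∉ Set.range s ∧
      r.length ≤ 14 * L.length + 3 ∧
      ∀ ψ : (Fin m → Bool) → ℂ, ZeroOff (insert c (s '' {i | i ∈ L})) ψ →
        r.matrix *ᵥ ψ =
          (2 * ψ fun _ => false) • Pi.single (fun _ => false) (1 : ℂ) - ψ := by
  -- The qubits are the system, one control qubit, and a second copy of the system serving as work
  -- qubits of the ladder.
  let e := Fintype.equivFin (S ⊕ (Unit ⊕ S))
  let s : S ↪ Fin _ := Embedding.inl.trans e.toEmbedding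
  let lad : S ↪ Fin _ := (Embedding.inr.trans Embedding.inr).trans e.toEmbedding
  let c := e (Sum.inr (Sum.inl ()))
  have h1 : ∀ i, s i ≠ c := fun i h => Sum.inl_ne_inr (e.injective h)
  have h2 : ∀ i, lad i ≠ c := fun i h => Sum.inr_ne_inl (Sum.inr_injective (e.injective h))
  have h3 : ∀ i j, s i ≠ lad j := fun i j h => Sum.inl_ne_inr (e.injective h)
  have hm1 : (L.map fun i => (s i, lad i)).map Prod.fst = L.map s := by
    rw [List.map_map]; rfl
  have hm2 : (L.map fun i => (s i, lad i)).map Prod.snd = L.map lad := by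
    rw [List.map_map]; rfl
  obtain ⟨r, hr, hr'⟩ := exists_circuit_reflection (L.map fun i => (s i, lad i)) c
    (by
      rw [hm1, hm2, List.nodup_cons, List.nodup_append, List.mem_append, not_or]
      refine ⟨⟨?_, ?_⟩, hL.map s.injective, hL.map lad.injective, ?_⟩
      · rw [List.mem_map]; rintro ⟨i, _, hi⟩; exact h1 i hi
      · rw [List.mem_map]; rintro ⟨i, _, hi⟩; exact h2 i hi
      · simp only [List.mem_map]
        rintro _ ⟨i, _, rfl⟩ _ ⟨j, _, rfl⟩
        exact h3 i j)
    (T := insert c (s '' {i | i ∈ L})) (by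
      intro i
      rw [hm1, Set.mem_insert_iff, Set.mem_image, List.mem_map]
      rfl)
  exact ⟨_, s, c, r, by rintro ⟨i, hi⟩; exact h1 i hi, by simpa using hr, hr'⟩

/-- Preparing only the touched qubits gives the expectation of the block-encoded operator. -/
theorem expectation_touched {k l a n b D Q R : ℕ} [NeZero k] [NeZero l] {α : ℝ}
    (encK : Fin k ↪ (Fin a → Bool)) (encL : Fin l ↪ (Fin b → Bool))
    (encH : Fin D ↪ (Fin n → Bool)) {z : Fin D → ℂ} {φ : Fin n → Bool → ℂ}
    (hφ : ∀ i, ‖φ i false‖ ^ 2 + ‖φ i true‖ ^ 2 = 1)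
    (hz : ∀ s : Fin n → Bool, (∑ x, if encH x = s then z x else 0) = ∏ i, φ i (s i))
    {A ρ : Matrix (Fin D) (Fin D) ℂ} (UA : BlockEncoding encK encH 0 α Q A)
    (Uρ : PreparationUnitary encH encL z R ρ)
    {L : List (Fin a ⊕ (Fin n ⊕ Fin b))} (hL : L.Nodup)
    (h₁ : ∀ i ∈ UA.circuit.support, blockWires a n b i ∈ L)
    (h₂ : ∀ i ∈ Uρ.circuit.support, prepWires a n b i ∈ L)
    {M : Op (Fin a ⊕ (Fin n ⊕ Fin b))}
    (hM : M = place (prepWires a n b) Uρ.circuit.matrix *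
        (layer _ (initialQubits_normalized encK encL hφ) L).matrix) :
    (M.conjTranspose * (place (blockWires a n b) UA.circuit.matrix * M))
      (fun _ => false) (fun _ => false) = (α : ℂ)⁻¹ * (ρ * A).trace := by
  classical
  -- Preparing the untouched qubits in `L'` as well changes nothing, and then all qubits are
  -- prepared as in `expectation_eq_trace`.
  let L' := (Finset.univ.filter fun i => i ∉ L).toList
  have hL' : ∀ i, i ∈ L' ↔ i ∉ L := fun i => by simp [L']
  rw [← expectation_eq_trace encK encL encH hφ hz UA Uρ (L := L ++ L') _ _ rfl]
  · have := expectation_layer_append (initialQubits_normalized encK encL hφ) L L'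
      (List.map (Gate.map (blockWires a n b)) UA.circuit)
      (List.map (Gate.map (prepWires a n b)) Uρ.circuit) (by
        intro i hi
        rw [Circuit.support_map]
        rintro ⟨q, hq, rfl⟩
        exact (hL' _).1 hi (h₁ q hq)) (by
        intro i hi
        rw [Circuit.support_map]
        rintro ⟨q, hq, rfl⟩
        exact (hL' _).1 hi (h₂ q hq))
    rw [Circuit.matrix_map, Circuit.matrix_map] at this
    rw [this, hM]
  · exact List.nodup_append.2 ⟨hL, Finset.nodup_toList _, fun x hx y hy h =>
      (hL' y).1 hy (h ▸ hx)⟩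
  · intro i
    rw [List.mem_append, hL']
    exact em _

open scoped ComplexOrder in
-- `Tr(ρA)/α` is an entry of a unitary matrix, so its modulus is at most one. It is real because `ρ`
-- and `A` are Hermitian.
theorem exists_expectation {k l a n b D Q R : ℕ} [NeZero k] [NeZero l] {α : ℝ} (hα : 0 < α)
    {encK : Fin k ↪ (Fin a → Bool)} {encL : Fin l ↪ (Fin b → Bool)}
    {encH : Fin D ↪ (Fin n → Bool)} {z : Fin D → ℂ} (hz : EasyToPrepare encH z)
    {A ρ : Matrix (Fin D) (Fin D) ℂ} (hA : A.IsHermitian) (hρ : IsDensityOperator ρ)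
    (UA : BlockEncoding encK encH 0 α Q A) (Uρ : PreparationUnitary encH encL z R ρ) :
    ∃ t : ℝ, |t| ≤ 1 ∧ (ρ * A).trace = ((α * t : ℝ) : ℂ) := by
  obtain ⟨φ, hφ, hz⟩ := hz
  have hα' : (α : ℂ) ≠ 0 := by exact_mod_cast hα.ne'
  have hreal : star (ρ * A).trace = (ρ * A).trace := by
    rw [← Matrix.trace_conjTranspose, Matrix.conjTranspose_mul, hA.eq, hρ.1.isHermitian.eq,
      Matrix.trace_mul_comm]
  have htr : (((ρ * A).trace.re : ℝ) : ℂ) = (ρ * A).trace := Complex.conj_eq_iff_re.1 hreal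
  have hexp := expectation_touched encK encL encH hφ hz UA Uρ (Finset.univ.nodup_toList)
    (fun _ _ => by simp) (fun _ _ => by simp) rfl
  set M := place (prepWires a n b) Uρ.circuit.matrix *
        (layer _ (initialQubits_normalized encK encL hφ) Finset.univ.toList).matrix with hM
  have hMu : M ∈ Matrix.unitaryGroup _ ℂ :=
    mul_mem (place_mem_unitaryGroup _ (Circuit.matrix_mem_unitaryGroup _))
      (Circuit.matrix_mem_unitaryGroup _)
  have hu : M.conjTranspose * (place (blockWires a n b) UA.circuit.matrix * M) ∈
      Matrix.unitaryGroup _ ℂ :=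
    mul_mem (Unitary.star_mem hMu)
      (mul_mem (place_mem_unitaryGroup _ (Circuit.matrix_mem_unitaryGroup _)) hMu)
  refine ⟨α⁻¹ * (ρ * A).trace.re, ?_, ?_⟩
  · have h1 := sum_norm_sq_col hu (fun _ => false)
    have h2 := Finset.single_le_sum (f := fun x => ‖(M.conjTranspose *
      (place (blockWires a n b) UA.circuit.matrix * M)) x (fun _ => false)‖ ^ 2)
      (fun x _ => by positivity) (Finset.mem_univ (fun _ => false))
    rw [h1] at h2
    simp only [hexp] at h2
    rw [← htr] at h2
    have h3 : ((α : ℂ)⁻¹ * (((ρ * A).trace.re : ℝ) : ℂ)) = ((α⁻¹ * (ρ * A).trace.re : ℝ) : ℂ) := by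
      push_cast; rfl
    rw [h3, Complex.norm_real, Real.norm_eq_abs] at h2
    exact (sq_le_one_iff₀ (abs_nonneg _)).1 h2
  · rw [mul_inv_cancel_left₀ hα.ne', htr]

/-- The program that amplifies the amplitude `sin x = cos u cos v + t sin u sin v` to
`sin ((2 j + 1) x)`, where `t` is the expectation. -/
theorem exists_program {k l a n b D : ℕ} [NeZero k] [NeZero l]
    (encK : Fin k ↪ (Fin a → Bool)) (encL : Fin l ↪ (Fin b → Bool))
    (encH : Fin D ↪ (Fin n → Bool)) {z : Fin D → ℂ} (hz : EasyToPrepare encH z)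
    (T₁ : Set (Fin a ⊕ Fin n)) (T₂ : Set (Fin n ⊕ Fin b)) (u v : ℝ) (j : ℕ) :
    ∃ (m : ℕ) (p : List (Instr (Fin a ⊕ Fin n) (Fin n ⊕ Fin b) m)),
      ∀ {Q R : ℕ} {α : ℝ} {A ρ : Matrix (Fin D) (Fin D) ℂ}
        (UA : BlockEncoding encK encH 0 α Q A) (Uρ : PreparationUnitary encH encL z R ρ),
        UA.circuit.support = T₁ → Uρ.circuit.support = T₂ → 0 < α →
        programCost UA.circuit.matrix Uρ.circuit.matrix p ≤
            (((2 * j + 1) * (46 * (R + Q) + 5) : ℕ) : ℕ∞) ∧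
        ∀ {t x : ℝ}, (ρ * A).trace = ((α * t : ℝ) : ℂ) →
        Real.sin x = Real.cos u * Real.cos v + Real.sin u * Real.sin v * t → Real.cos x ≠ 0 →
        ‖programMatrix UA.circuit.matrix Uρ.circuit.matrix p (fun _ => false) (fun _ => false)‖ ^ 2
            = Real.sin ((2 * j + 1) * x) ^ 2 := by
  classical
  obtain ⟨φ, hφ, hz⟩ := hz
  let F := (blockWires a n b '' T₁ ∪ prepWires a n b '' T₂).toFinite.toFinset
  have hF : ∀ i, i ∈ F.toList ↔ i ∈ blockWires a n b '' T₁ ∪ prepWires a n b '' T₂ := fun i => by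
    rw [Finset.mem_toList, Set.Finite.mem_toFinset]
  obtain ⟨m, s, c, r, hc, hr, hr'⟩ := exists_wires _ F.toList F.nodup_toList
  set T := insert c (s '' {i | i ∈ F.toList}) with hT
  let lay := layer _ (initialQubits_normalized encK encL hφ) F.toList
  let prep : Circuit (Fin m) := List.map (Gate.map s) lay
  have hc₁ : c ∉ Set.range ((blockWires a n b).trans s) := by
    rintro ⟨i, hi⟩; exact hc ⟨_, hi⟩
  have hrot : ∀ θ : ℝ, ‖(Real.cos θ : ℂ)‖ ^ 2 + ‖(Real.sin θ : ℂ)‖ ^ 2 = 1 := fun θ => by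
    rw [Complex.norm_real, Complex.norm_real, Real.norm_eq_abs, Real.norm_eq_abs, sq_abs, sq_abs,
      Real.cos_sq_add_sin_sq]
  let g : ℝ → Gate (Fin m) := fun θ =>
    gateOne c (qubitOp (Real.cos θ) (Real.sin θ)) (qubitOp_mem_unitaryGroup (hrot θ))
  let sw : ℝ → ℝ → Bool → List (Instr (Fin a ⊕ Fin n) (Fin n ⊕ Fin b) m) := fun θ θ' inv =>
    sandwich prep ((blockWires a n b).trans s) ((prepWires a n b).trans s) c hc₁ (g θ) (g θ') inv
  let rp : List (Instr (Fin a ⊕ Fin n) (Fin n ⊕ Fin b) m) := List.map Instr.gate r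
  -- With `B` the operator of `sw v u false`, exchanging the angles and inverting the call gives
  -- `B†`, so this program performs `(B S B† S)^j B`.
  refine ⟨m, sw v u false ++ (List.replicate j (rp ++ (sw u v true ++ (rp ++ sw v u false)))).flatten,
    ?_⟩
  intro Q R α A ρ UA Uρ hT₁ hT₂ hα
  constructor
  -- At most `2(R+Q)` qubits are touched. A sandwich costs at most `4(R+Q) + 14R + 7Q + 2` and a
  -- reflection at most `14·2(R+Q) + 3`; there are `2j+1` sandwiches and `2j` reflections.
  · have hlen : F.toList.length ≤ 2 * (R + Q) := by
      rw [Finset.length_toList, ← Set.ncard_eq_toFinset_card]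
      have k1 := UA.circuit.finite_support_ncard_le.2
      have k2 := Uρ.circuit.finite_support_ncard_le.2
      rw [hT₁] at k1
      rw [hT₂] at k2
      have k3 := UA.length_le
      have k4 := Uρ.length_le
      have k5 := Set.ncard_union_le (blockWires a n b '' T₁) (prepWires a n b '' T₂)
      rw [Set.ncard_image_of_injective _ (blockWires a n b).injective,
        Set.ncard_image_of_injective _ (prepWires a n b).injective] at k5
      omega
    have hpl : List.length prep = F.toList.length := by simp [prep, lay, layer]
    have hswc : ∀ (θ θ' : ℝ) (inv : Bool),
        programCost UA.circuit.matrix Uρ.circuit.matrix (sw θ θ' inv) ≤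
          ((18 * (R + Q) + 2 : ℕ) : ℕ∞) := fun θ θ' inv => by
      refine (programCost_sandwich_le _ _ _ _ _ _ _ _ _ _).trans ?_
      have k3 := UA.length_le
      have k4 := Uρ.length_le
      exact_mod_cast (by omega)
    have hrc : programCost UA.circuit.matrix Uρ.circuit.matrix rp ≤
        ((28 * (R + Q) + 3 : ℕ) : ℕ∞) := by
      rw [programCost_gates]
      exact_mod_cast (by omega)
    rw [programCost_append, programCost_replicate]
    simp only [programCost_append]
    calc _ ≤ ((18 * (R + Q) + 2 : ℕ) : ℕ∞) + j * (((28 * (R + Q) + 3 : ℕ) : ℕ∞) +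
          (((18 * (R + Q) + 2 : ℕ) : ℕ∞) + (((28 * (R + Q) + 3 : ℕ) : ℕ∞) +
            ((18 * (R + Q) + 2 : ℕ) : ℕ∞)))) := by
          gcongr <;> exact hswc _ _ _
      _ ≤ _ := by
          norm_cast
          nlinarith
  intro t x ht hx hcos
  have hα' : (α : ℂ) ≠ 0 := by exact_mod_cast hα.ne'
  set M := place (prepWires a n b) Uρ.circuit.matrix * lay.matrix with hM
  have hMu : M ∈ Matrix.unitaryGroup _ ℂ :=
    mul_mem (place_mem_unitaryGroup _ (Circuit.matrix_mem_unitaryGroup _))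
      (Circuit.matrix_mem_unitaryGroup _)
  have hexp := expectation_touched encK encL encH hφ hz UA Uρ F.nodup_toList
    (fun i hi => (hF _).2 (Or.inl ⟨i, hT₁ ▸ hi, rfl⟩))
    (fun i hi => (hF _).2 (Or.inr ⟨i, hT₂ ▸ hi, rfl⟩)) hM
  rw [ht] at hexp
  have hexp' : (α : ℂ)⁻¹ * ((α * t : ℝ) : ℂ) = t := by
    push_cast
    rw [inv_mul_cancel_left₀ hα']
  rw [hexp'] at hexp
  have hprep : prep.matrix = place s lay.matrix := Circuit.matrix_map s lay
  have hsw : ∀ (θ θ' : ℝ) (inv : Bool),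
      programMatrix UA.circuit.matrix Uρ.circuit.matrix (sw θ θ' inv) =
      place s M.conjTranspose * (place (oneWire c) (qubitOp (Real.cos θ') (Real.sin θ')).conjTranspose *
        (controlled c (place s (place (blockWires a n b)
          (if inv then UA.circuit.matrix.conjTranspose else UA.circuit.matrix))) *
          (place (oneWire c) (qubitOp (Real.cos θ) (Real.sin θ)) * place s M))) := by
    intro θ θ' inv
    refine (programMatrix_sandwich _ _ _ _ _ _ _ _ _ _).trans ?_
    have hM' : place s M =
        place ((prepWires a n b).trans s) Uρ.circuit.matrix * prep.matrix := by
      rw [hM, place_mul, place_place, hprep]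
    rw [← place_conjTranspose s M, hM', Matrix.conjTranspose_mul, place_place, mul_assoc,
      gateOne_matrix, gateOne_matrix, place_conjTranspose, place_conjTranspose]
  set B := programMatrix UA.circuit.matrix Uρ.circuit.matrix (sw v u false) with hB
  have hBu : B ∈ Matrix.unitaryGroup _ ℂ :=
    programMatrix_mem_unitaryGroup UA.circuit.matrix_mem_unitaryGroup
      Uρ.circuit.matrix_mem_unitaryGroup _
  have hB' : programMatrix UA.circuit.matrix Uρ.circuit.matrix (sw u v true) =
      B.conjTranspose := by
    rw [hB, hsw, hsw]
    simp only [Matrix.conjTranspose_mul, place_conjTranspose, Matrix.conjTranspose_conjTranspose,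
      mul_assoc]
    rw [controlled_conjTranspose (fixes_place s _) hc, place_conjTranspose, place_conjTranspose]
    rfl
  have hoo : B (fun _ => false) (fun _ => false) = (Real.sin x : ℂ) := by
    rw [hB, hsw, linear_combination_apply s c hc _ hMu]
    have : place (blockWires a n b) (if false = true then UA.circuit.matrix.conjTranspose else
      UA.circuit.matrix) = place (blockWires a n b) UA.circuit.matrix := rfl
    rw [this, hexp, hx, RCLike.star_def, Complex.conj_ofReal, Complex.conj_ofReal]
    push_cast
    ring
  have hBfix : Fixes T B := by
    have hs : ∀ {N : Op (Fin a ⊕ (Fin n ⊕ Fin b))}, Fixes {i | i ∈ F.toList} N →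
        Fixes T (place s N) := fun hN => (hN.place s).mono (Set.subset_insert _ _)
    have hone : ∀ N, Fixes T (place (oneWire c) N) := fun N =>
      (fixes_place (oneWire c) N).mono (by
        rw [range_oneWire]; exact Set.singleton_subset_iff.2 (Set.mem_insert _ _))
    have hMf : Fixes {i | i ∈ F.toList} M := by
      refine Fixes.mul ((Uρ.circuit.fixes_support.place _).mono ?_) ?_
      · rw [hT₂]; exact fun i hi => (hF i).2 (Or.inr hi)
      · have := lay.fixes_support
        rwa [support_layer] at this
    have hXf : Fixes {i | i ∈ F.toList} (place (blockWires a n b) UA.circuit.matrix) := by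
      refine (UA.circuit.fixes_support.place _).mono ?_
      rw [hT₁]; exact fun i hi => (hF i).2 (Or.inl hi)
    rw [hB, hsw]
    exact (hs hMf.conjTranspose).mul ((hone _).mul (((hs hXf).controlled c).mul
      ((hone _).mul (hs hMf))))
  have hz0 := ZeroOff.single (ι := Fin m) T
  have hmat : programMatrix UA.circuit.matrix Uρ.circuit.matrix
      (sw v u false ++ (List.replicate j (rp ++ (sw u v true ++ (rp ++ sw v u false)))).flatten) =
      (B * (r.matrix * (B.conjTranspose * r.matrix))) ^ j * B := by
    simp only [programMatrix_append, programMatrix_replicate, hB', ← hB, mul_assoc]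
    rw [programMatrix_gates]
  rw [hmat]
  refine amplification_apply hBu hcos ?_ ?_ ?_ hoo j
  · rw [hr' _ hz0, Pi.single_eq_same]
    module
  · rw [hr' _ (ZeroOff.mulVec hBfix hz0), Matrix.mulVec_single_one, Matrix.col_apply, hoo]
  · rw [hr' _ (ZeroOff.mulVec hBfix.conjTranspose hz0), Matrix.mulVec_single_one,
      Matrix.col_apply, Matrix.conjTranspose_apply, hoo, RCLike.star_def, Complex.conj_ofReal]

/-! Majority votes. -/

theorem Algorithm.prob_nonneg {r₁ r₂ : Type} (V₁ : Op r₁) (V₂ : Op r₂) (S : Set ℝ)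
    (P : Algorithm r₁ r₂) : 0 ≤ P.prob V₁ V₂ S := by
  induction P with
  | output ξ =>
    rw [Algorithm.prob]
    split_ifs <;> norm_num
  | toss N next ih =>
    rw [Algorithm.prob]
    exact div_nonneg (Finset.sum_nonneg fun i _ => ih i) (by positivity)
  | run m p next ih =>
    rw [Algorithm.prob]
    exact Finset.sum_nonneg fun x _ => mul_nonneg (by positivity) (ih x)

/-- Runs `p` repeatedly and continues according to whether the outcome `0⋯0` has occurred in more
than half of the runs; `d` is the current excess of this outcome. -/
def majority {r₁ r₂ : Type} {m : ℕ} (p : List (Instr r₁ r₂ m)) (next : Bool → Algorithm r₁ r₂) :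
    ℕ → ℤ → Algorithm r₁ r₂
  | 0, d => next (decide (0 < d))
  | N + 1, d => .run m p fun x =>
      majority p next N (d + if x = fun _ => false then 1 else -1)

theorem majority_prob_succ {r₁ r₂ : Type} {m : ℕ} {V₁ : Op r₁} {V₂ : Op r₂}
    {p : List (Instr r₁ r₂ m)}
    (hu : programMatrix V₁ V₂ p ∈ Matrix.unitaryGroup (Fin m → Bool) ℂ)
    (next : Bool → Algorithm r₁ r₂) (S : Set ℝ) {q : ℝ}
    (hq : ‖programMatrix V₁ V₂ p (fun _ => false) (fun _ => false)‖ ^ 2 = q) (N : ℕ) (d : ℤ) :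
    (majority p next (N + 1) d).prob V₁ V₂ S =
      q * (majority p next N (d + 1)).prob V₁ V₂ S +
        (1 - q) * (majority p next N (d - 1)).prob V₁ V₂ S := by
  have h := sum_norm_sq_col hu (fun _ => false)
  rw [← Finset.add_sum_erase _ _ (Finset.mem_univ (fun _ => false)), hq] at h
  rw [majority, Algorithm.prob, ← Finset.add_sum_erase _ _ (Finset.mem_univ (fun _ => false)), hq,
    if_pos rfl, ← eq_sub_iff_add_eq'.2 h, Finset.sum_mul]
  congr 1
  refine Finset.sum_congr rfl fun x hx => ?_
  rw [if_neg (Finset.ne_of_mem_erase hx), sub_eq_add_neg]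

/-- This serves the middle third, where the vote is uninformative and either outcome is acceptable.
-/
theorem majority_prob_of_forall {r₁ r₂ : Type} {m : ℕ} {V₁ : Op r₁} {V₂ : Op r₂}
    {p : List (Instr r₁ r₂ m)}
    (hu : programMatrix V₁ V₂ p ∈ Matrix.unitaryGroup (Fin m → Bool) ℂ)
    (next : Bool → Algorithm r₁ r₂) (S : Set ℝ) {g : ℝ}
    (hg : ∀ c, g ≤ (next c).prob V₁ V₂ S) (N : ℕ) (d : ℤ) :
    g ≤ (majority p next N d).prob V₁ V₂ S := by
  induction N generalizing d with
  | zero => exact hg _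
  | succ N ih =>
    have h := sum_norm_sq_col hu (fun _ => false)
    have hle : ‖programMatrix V₁ V₂ p (fun _ => false) (fun _ => false)‖ ^ 2 ≤ 1 := by
      rw [← h]
      exact Finset.single_le_sum
        (f := fun x => ‖programMatrix V₁ V₂ p x (fun _ => false)‖ ^ 2)
        (fun x _ => by positivity) (Finset.mem_univ _)
    rw [majority_prob_succ hu next S rfl]
    have h0 : 0 ≤ ‖programMatrix V₁ V₂ p (fun _ => false) (fun _ => false)‖ ^ 2 := by positivity
    nlinarith [mul_le_mul_of_nonneg_left (ih (d + 1)) h0,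
      mul_le_mul_of_nonneg_left (ih (d - 1)) (sub_nonneg.2 hle)]

/-- Exponential moment bound: one vote multiplies the mean of `(21/20)^(-d)` by `q·20/21 +
(1-q)·21/20`, which is `799/800` at `q = 21/40` and decreases in `q`. At the end this quantity is at
least one whenever the vote is lost. -/
theorem majority_prob_of_high {r₁ r₂ : Type} {m : ℕ} {V₁ : Op r₁} {V₂ : Op r₂}
    {p : List (Instr r₁ r₂ m)}
    (hu : programMatrix V₁ V₂ p ∈ Matrix.unitaryGroup (Fin m → Bool) ℂ)
    (next : Bool → Algorithm r₁ r₂) (S : Set ℝ) {g : ℝ} (hg0 : 0 ≤ g)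
    (hq : 21 / 40 ≤ ‖programMatrix V₁ V₂ p (fun _ => false) (fun _ => false)‖ ^ 2)
    (hg : g ≤ (next true).prob V₁ V₂ S) (N : ℕ) (d : ℤ) :
    g * (1 - (799 / 800) ^ N * (21 / 20) ^ (-d)) ≤ (majority p next N d).prob V₁ V₂ S := by
  have hle := sum_norm_sq_col hu (fun _ => false)
  replace hle : ‖programMatrix V₁ V₂ p (fun _ => false) (fun _ => false)‖ ^ 2 ≤ 1 := by
    rw [← hle]
    exact Finset.single_le_sum
      (f := fun x => ‖programMatrix V₁ V₂ p x (fun _ => false)‖ ^ 2)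
      (fun x _ => by positivity) (Finset.mem_univ _)
  induction N generalizing d with
  | zero =>
    rw [majority, pow_zero, one_mul]
    by_cases hd : 0 < d
    · rw [decide_eq_true hd]
      refine le_trans ?_ hg
      have : (0 : ℝ) < (21 / 20) ^ (-d) := by positivity
      nlinarith
    · refine le_trans ?_ (Algorithm.prob_nonneg _ _ _ _)
      have : (1 : ℝ) ≤ (21 / 20) ^ (-d) := one_le_zpow₀ (by norm_num) (by omega)
      nlinarith
  | succ N ih =>
    rw [majority_prob_succ hu next S rfl]
    have h1 := ih (d + 1)
    have h2 := ih (d - 1)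
    set q := ‖programMatrix V₁ V₂ p (fun _ => false) (fun _ => false)‖ ^ 2
    have e1 : (21 / 20 : ℝ) ^ (-(d + 1)) = (21 / 20) ^ (-d) * (20 / 21) := by
      rw [neg_add, zpow_add₀ (by norm_num)]; norm_num
    have e2 : (21 / 20 : ℝ) ^ (-(d - 1)) = (21 / 20) ^ (-d) * (21 / 20) := by
      rw [neg_sub, sub_eq_neg_add, zpow_add₀ (by norm_num)]; norm_num
    rw [e1] at h1
    rw [e2] at h2
    set X := (799 / 800 : ℝ) ^ N * (21 / 20) ^ (-d) with hX
    have hX0 : 0 ≤ X := by positivity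
    have e3 : (799 / 800 : ℝ) ^ (N + 1) * (21 / 20) ^ (-d) = X * (799 / 800) := by
      rw [hX, pow_succ]; ring
    rw [e3]
    have h3 : q * (20 / 21) + (1 - q) * (21 / 20) ≤ 799 / 800 := by linarith
    calc g * (1 - X * (799 / 800)) ≤ g * (1 - X * (q * (20 / 21) + (1 - q) * (21 / 20))) := by
          gcongr
      _ = q * (g * (1 - (799 / 800) ^ N * ((21 / 20) ^ (-d) * (20 / 21)))) +
          (1 - q) * (g * (1 - (799 / 800) ^ N * ((21 / 20) ^ (-d) * (21 / 20)))) := by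
          rw [hX]; ring
      _ ≤ _ := add_le_add (mul_le_mul_of_nonneg_left h1 (by linarith))
          (mul_le_mul_of_nonneg_left h2 (by linarith))

theorem majority_prob_of_low {r₁ r₂ : Type} {m : ℕ} {V₁ : Op r₁} {V₂ : Op r₂}
    {p : List (Instr r₁ r₂ m)}
    (hu : programMatrix V₁ V₂ p ∈ Matrix.unitaryGroup (Fin m → Bool) ℂ)
    (next : Bool → Algorithm r₁ r₂) (S : Set ℝ) {g : ℝ} (hg0 : 0 ≤ g)
    (hq : ‖programMatrix V₁ V₂ p (fun _ => false) (fun _ => false)‖ ^ 2 ≤ 19 / 40)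
    (hg : g ≤ (next false).prob V₁ V₂ S) (N : ℕ) (d : ℤ) :
    g * (1 - (799 / 800) ^ N * (21 / 20) ^ d) ≤ (majority p next N d).prob V₁ V₂ S := by
  induction N generalizing d with
  | zero =>
    rw [majority, pow_zero, one_mul]
    by_cases hd : 0 < d
    · refine le_trans ?_ (Algorithm.prob_nonneg _ _ _ _)
      have : (1 : ℝ) ≤ (21 / 20) ^ d := one_le_zpow₀ (by norm_num) (by omega)
      nlinarith
    · rw [decide_eq_false hd]
      refine le_trans ?_ hg
      have : (0 : ℝ) < (21 / 20) ^ d := by positivity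
      nlinarith
  | succ N ih =>
    rw [majority_prob_succ hu next S rfl]
    have h1 := ih (d + 1)
    have h2 := ih (d - 1)
    have hq0 : 0 ≤ ‖programMatrix V₁ V₂ p (fun _ => false) (fun _ => false)‖ ^ 2 := by positivity
    set q := ‖programMatrix V₁ V₂ p (fun _ => false) (fun _ => false)‖ ^ 2
    have e1 : (21 / 20 : ℝ) ^ (d + 1) = (21 / 20) ^ d * (21 / 20) := by
      rw [zpow_add₀ (by norm_num)]; norm_num
    have e2 : (21 / 20 : ℝ) ^ (d - 1) = (21 / 20) ^ d * (20 / 21) := by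
      rw [sub_eq_add_neg, zpow_add₀ (by norm_num)]; norm_num
    rw [e1] at h1
    rw [e2] at h2
    set X := (799 / 800 : ℝ) ^ N * (21 / 20) ^ d with hX
    have hX0 : 0 ≤ X := by positivity
    have e3 : (799 / 800 : ℝ) ^ (N + 1) * (21 / 20) ^ d = X * (799 / 800) := by
      rw [hX, pow_succ]; ring
    rw [e3]
    have h3 : q * (21 / 20) + (1 - q) * (20 / 21) ≤ 799 / 800 := by linarith
    calc g * (1 - X * (799 / 800)) ≤ g * (1 - X * (q * (21 / 20) + (1 - q) * (20 / 21))) := by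
          gcongr
      _ = q * (g * (1 - (799 / 800) ^ N * ((21 / 20) ^ d * (21 / 20)))) +
          (1 - q) * (g * (1 - (799 / 800) ^ N * ((21 / 20) ^ d * (20 / 21)))) := by
          rw [hX]; ring
      _ ≤ _ := add_le_add (mul_le_mul_of_nonneg_left h1 hq0)
          (mul_le_mul_of_nonneg_left h2 (by linarith))

theorem majority_cost_le {r₁ r₂ : Type} {m : ℕ} {V₁ : Op r₁} {V₂ : Op r₂}
    {p : List (Instr r₁ r₂ m)} (next : Bool → Algorithm r₁ r₂) {κ K : ℕ}
    (hp : programCost V₁ V₂ p ≤ (κ : ℕ∞)) (hn : ∀ c, (next c).cost V₁ V₂ ≤ (K : ℕ∞)) (N : ℕ)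
    (d : ℤ) : (majority p next N d).cost V₁ V₂ ≤ ((N * κ + K : ℕ) : ℕ∞) := by
  induction N generalizing d with
  | zero => simpa [majority] using hn _
  | succ N ih =>
    rw [majority, Algorithm.cost]
    have : ((((N + 1) * κ + K : ℕ)) : ℕ∞) = (κ : ℕ∞) + ((N * κ + K : ℕ) : ℕ∞) := by
      push_cast; ring
    rw [this]
    exact add_le_add hp (iSup_le fun x => ih _)

/-! Search by trisection. -/

/-- Shrinks the interval of centre `c` and half-width `w` by the factor `2 / 3` in each of the given
number of rounds, and then continues with the centre. -/
def search {r₁ r₂ : Type} (prog : ℝ → ℝ → Σ m : ℕ, List (Instr r₁ r₂ m)) (N : ℕ → ℕ)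
    (fin : ℝ → Algorithm r₁ r₂) : ℕ → ℝ → ℝ → Algorithm r₁ r₂
  | 0, c, _ => fin c
  | i + 1, c, w => majority (prog c w).2
      (fun up => search prog N fin i (if up then c + w / 3 else c - w / 3) (2 / 3 * w)) (N i) 0

/-- The two candidate intervals `[c - w/3, c + w]` and `[c - w, c + w/3]` overlap in the middle
third, so only a `t` in an outer third can be lost, with probability at most `(799/800)^N`. The
losses add up over the rounds. The index counts the remaining rounds, so the earliest round uses the
largest index of `N`. -/
theorem search_prob_ge {r₁ r₂ : Type} [Fintype r₁] [DecidableEq r₁] [Fintype r₂] [DecidableEq r₂]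
    {V₁ : Op r₁} {V₂ : Op r₂} (h₁ : V₁ ∈ Matrix.unitaryGroup (r₁ → Bool) ℂ)
    (h₂ : V₂ ∈ Matrix.unitaryGroup (r₂ → Bool) ℂ)
    (prog : ℝ → ℝ → Σ m : ℕ, List (Instr r₁ r₂ m)) (N : ℕ → ℕ) (fin : ℝ → Algorithm r₁ r₂)
    (S : Set ℝ) {t g : ℝ} (hg : 0 ≤ g)
    (hhigh : ∀ c w, 0 < w → |c| + w ≤ 1 → |t - c| ≤ w → w / 3 ≤ t - c →
      21 / 40 ≤ ‖programMatrix V₁ V₂ (prog c w).2 (fun _ => false) (fun _ => false)‖ ^ 2)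
    (hlow : ∀ c w, 0 < w → |c| + w ≤ 1 → |t - c| ≤ w → t - c ≤ -(w / 3) →
      ‖programMatrix V₁ V₂ (prog c w).2 (fun _ => false) (fun _ => false)‖ ^ 2 ≤ 19 / 40)
    (i : ℕ) : ∀ c w, 0 < w → |c| + w ≤ 1 → |t - c| ≤ w →
      (∀ c', |t - c'| ≤ (2 / 3) ^ i * w → g ≤ (fin c').prob V₁ V₂ S) →
      g * (1 - ∑ i' ∈ Finset.range i, (799 / 800 : ℝ) ^ N i') ≤
        (search prog N fin i c w).prob V₁ V₂ S := by
  induction i with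
  | zero =>
    intro c w _ _ hc hfin
    simpa [search] using hfin c (by simpa using hc)
  | succ i ih =>
    intro c w hw hcw hc hfin
    rw [search]
    have hu := programMatrix_mem_unitaryGroup h₁ h₂ (prog c w).2
    set next := fun up : Bool =>
      search prog N fin i (if up then c + w / 3 else c - w / 3) (2 / 3 * w)
    set g' := g * (1 - ∑ i' ∈ Finset.range i, (799 / 800 : ℝ) ^ N i') with hg'
    have hρ : (0 : ℝ) ≤ (799 / 800) ^ N i := by positivity
    have hsum : (0 : ℝ) ≤ ∑ i' ∈ Finset.range i, (799 / 800 : ℝ) ^ N i' :=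
      Finset.sum_nonneg fun _ _ => by positivity
    have hgg : g' ≤ g := by rw [hg']; nlinarith
    have e1 : g * (1 - ∑ i' ∈ Finset.range (i + 1), (799 / 800 : ℝ) ^ N i') =
        g' - g * (799 / 800) ^ N i := by
      rw [Finset.sum_range_succ, hg']; ring
    rw [e1]
    have hgρ : 0 ≤ g * (799 / 800 : ℝ) ^ N i := mul_nonneg hg hρ
    have habs := abs_le.1 hc
    have hfin' : ∀ c', |t - c'| ≤ (2 / 3) ^ i * (2 / 3 * w) → g ≤ (fin c').prob V₁ V₂ S :=
      fun c' h => hfin c' (h.trans_eq (by rw [pow_succ]; ring))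
    have hup : -(w / 3) ≤ t - c → g' ≤ (next true).prob V₁ V₂ S := fun h => by
      refine ih (c + w / 3) (2 / 3 * w) (by linarith) ?_ ?_ hfin'
      · have := abs_add_le c (w / 3)
        rw [abs_of_pos (show 0 < w / 3 by linarith)] at this
        linarith
      · rw [abs_le]; constructor <;> linarith
    have hdn : t - c ≤ w / 3 → g' ≤ (next false).prob V₁ V₂ S := fun h => by
      refine ih (c - w / 3) (2 / 3 * w) (by linarith) ?_ ?_ hfin'
      · have := abs_sub c (w / 3)
        rw [abs_of_pos (show 0 < w / 3 by linarith)] at this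
        linarith
      · rw [abs_le]; constructor <;> linarith
    -- The majority bounds need a nonnegative guarantee; a negative one is trivially met.
    by_cases hneg : g' < 0
    · exact le_trans (by linarith) (Algorithm.prob_nonneg _ _ _ _)
    rw [not_lt] at hneg
    have hstep : g' - g * (799 / 800) ^ N i ≤ g' * (1 - (799 / 800) ^ N i * 1) := by
      nlinarith
    by_cases ha : w / 3 ≤ t - c
    · refine hstep.trans ?_
      have := majority_prob_of_high hu next S hneg (hhigh c w hw hcw hc ha) (hup (by linarith))
        (N i) 0
      simpa using this
    · by_cases hb : t - c ≤ -(w / 3)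
      · refine hstep.trans ?_
        have := majority_prob_of_low hu next S hneg (hlow c w hw hcw hc hb) (hdn (by linarith))
          (N i) 0
        simpa using this
      · refine le_trans (by linarith) (majority_prob_of_forall hu next S (g := g') ?_ (N i) 0)
        intro up
        cases up
        · exact hdn (by linarith)
        · exact hup (by linarith)

/-- The bracket `f i` solves `f 0 = 0`, `f (i+1) = (Λ + i + 1) + (3/2) f i`. The factor `3/2` arises
because the next rounds work at half-width `2w/3`. -/
theorem search_cost_le {r₁ r₂ : Type} {V₁ : Op r₁} {V₂ : Op r₂}
    (prog : ℝ → ℝ → Σ m : ℕ, List (Instr r₁ r₂ m)) (N : ℕ → ℕ) (fin : ℝ → Algorithm r₁ r₂)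
    (hfin : ∀ c, (fin c).cost V₁ V₂ = 0) {κ Λ : ℝ} (hκ : 0 ≤ κ)
    (hN : ∀ i, (N i : ℝ) ≤ 801 * (Λ + i + 1))
    (hprog : ∀ c w, 0 < w → |c| + w ≤ 1 →
      ∃ K : ℕ, programCost V₁ V₂ (prog c w).2 ≤ (K : ℕ∞) ∧ (K : ℝ) ≤ κ / w)
    (i : ℕ) : ∀ c w, 0 < w → |c| + w ≤ 1 →
      ∃ K : ℕ, (search prog N fin i c w).cost V₁ V₂ ≤ (K : ℕ∞) ∧
        (K : ℝ) ≤ κ / w * (801 * ((2 * Λ + 6) * (3 / 2) ^ i - 2 * (Λ + i) - 6)) := by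
  induction i with
  | zero =>
    intro c w _ _
    refine ⟨0, by rw [search, hfin]; simp, le_of_eq ?_⟩
    push_cast
    ring
  | succ i ih =>
    intro c w hw hcw
    obtain ⟨K, hK, hK'⟩ := hprog c w hw hcw
    obtain ⟨K₁, hK₁, hK₁'⟩ := ih (c + w / 3) (2 / 3 * w) (by linarith) (by
      have := abs_add_le c (w / 3)
      rw [abs_of_pos (show 0 < w / 3 by linarith)] at this
      linarith)
    obtain ⟨K₂, hK₂, hK₂'⟩ := ih (c - w / 3) (2 / 3 * w) (by linarith) (by
      have := abs_sub c (w / 3)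
      rw [abs_of_pos (show 0 < w / 3 by linarith)] at this
      linarith)
    refine ⟨N i * K + max K₁ K₂, ?_, ?_⟩
    · rw [search]
      refine majority_cost_le _ hK ?_ _ _
      intro up
      cases up
      · exact hK₂.trans (by exact_mod_cast le_max_right _ _)
      · exact hK₁.trans (by exact_mod_cast le_max_left _ _)
    · have hmax : ((max K₁ K₂ : ℕ) : ℝ) ≤ κ / (2 / 3 * w) *
          (801 * ((2 * Λ + 6) * (3 / 2) ^ i - 2 * (Λ + i) - 6)) := by
        rw [Nat.cast_max]; exact max_le hK₁' hK₂'
      have e : κ / (2 / 3 * w) = κ / w * (3 / 2) := by field_simp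
      rw [e] at hmax
      have hκw : 0 ≤ κ / w := by positivity
      have h1 : (N i : ℝ) * K ≤ 801 * (Λ + i + 1) * (κ / w) :=
        mul_le_mul (hN i) hK' (by positivity) ((Nat.cast_nonneg _).trans (hN i))
      push_cast at hmax ⊢
      refine (add_le_add h1 hmax).trans (le_of_eq ?_)
      rw [pow_succ]
      ring

/-! The bias of the amplified amplitude. -/

/-- The conditions amount to `cos (u - v) = β + γ` and `cos (u + v) = β - γ`. They realize the
amplitude `β + γ t`. -/
theorem exists_angles {β γ : ℝ} (h : |β| + |γ| ≤ 1) :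
    ∃ u v : ℝ, Real.cos u * Real.cos v = β ∧ Real.sin u * Real.sin v = γ := by
  have h1 := abs_le.1 ((abs_add_le β γ).trans h)
  have h2 := abs_le.1 ((abs_sub β γ).trans h)
  have c1 := Real.cos_arccos h1.1 h1.2
  have c2 := Real.cos_arccos h2.1 h2.2
  set p := Real.arccos (β + γ)
  set q := Real.arccos (β - γ)
  refine ⟨(p + q) / 2, (q - p) / 2, ?_, ?_⟩
  · have e1 : p = (p + q) / 2 - (q - p) / 2 := by ring
    have e2 : q = (p + q) / 2 + (q - p) / 2 := by ring
    rw [e1, Real.cos_sub] at c1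
    rw [e2, Real.cos_add] at c2
    have := add_eq_of_eq_sub c2
    linear_combination (1 / 2 : ℝ) * c1 + (1 / 2 : ℝ) * c2
  · have e1 : p = (p + q) / 2 - (q - p) / 2 := by ring
    have e2 : q = (p + q) / 2 + (q - p) / 2 := by ring
    rw [e1, Real.cos_sub] at c1
    rw [e2, Real.cos_add] at c2
    linear_combination (1 / 2 : ℝ) * c1 - (1 / 2 : ℝ) * c2

theorem sin_pi_div_bounds {k : ℝ} (hk : 3 ≤ k) :
    0 ≤ Real.pi / (4 * k) ∧ Real.pi / (4 * k) ≤ Real.pi / 12 ∧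
      0 ≤ Real.sin (Real.pi / (4 * k)) ∧ Real.sin (Real.pi / (4 * k)) ≤ 27 / 100 := by
  have hpi := Real.pi_pos
  have h0 : 0 ≤ Real.pi / (4 * k) := by positivity
  have h1 : Real.pi / (4 * k) ≤ Real.pi / 12 := by
    apply div_le_div_of_nonneg_left hpi.le (by norm_num) (by linarith)
  refine ⟨h0, h1, Real.sin_nonneg_of_nonneg_of_le_pi h0 (by linarith), ?_⟩
  have := Real.sin_le h0
  have := Real.pi_lt_d2
  linarith

/-- The relative position of the expectation in the interval is visible in the amplified
probability. -/
theorem amplified_bias {k w d : ℝ} (hw : 0 < w) (hw1 : w ≤ 1) (hk : 2 / w + 1 ≤ k)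
    (hk' : k ≤ 2 / w + 3) (hd : |d| ≤ w) :
    ∃ x : ℝ, Real.sin x = Real.sin (Real.pi / (4 * k)) + d / 20 ∧ Real.cos x ≠ 0 ∧
      (w / 3 ≤ d → 21 / 40 ≤ Real.sin (k * x) ^ 2) ∧
      (d ≤ -(w / 3) → Real.sin (k * x) ^ 2 ≤ 19 / 40) := by
  have hpi := Real.pi_pos
  have hw2 : 2 ≤ 2 / w := by rw [le_div_iff₀ hw]; linarith
  have hk3 : 3 ≤ k := by linarith
  have hk5 : k ≤ 5 / w := by
    have : 3 ≤ 3 / w := by rw [le_div_iff₀ hw]; linarith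
    have e : 5 / w = 2 / w + 3 / w := by ring
    linarith
  obtain ⟨hy0, hy1, hs0, hs1⟩ := sin_pi_div_bounds hk3
  -- Working point: `sin²(k y₀) = 1/2`, where the amplified probability is steepest.
  set y₀ := Real.pi / (4 * k) with hy
  have hd' := abs_le.1 hd
  set s := Real.sin y₀ + d / 20 with hs
  have hsl : -(1 / 2) ≤ s := by rw [hs]; linarith
  have hsu : s ≤ 1 / 2 := by rw [hs]; linarith
  set x := Real.arcsin s with hx
  have hsx : Real.sin x = s := Real.sin_arcsin (by linarith) (by linarith)
  have hxu : x ≤ Real.pi / 6 := by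
    rw [hx, Real.arcsin_le_iff_le_sin' ⟨by linarith, by linarith⟩, Real.sin_pi_div_six]
    exact hsu
  have hxl : -(Real.pi / 6) ≤ x := by
    rw [hx, Real.le_arcsin_iff_sin_le' ⟨by linarith, by linarith⟩, Real.sin_neg,
      Real.sin_pi_div_six]
    exact hsl
  have hcos : 0 < Real.cos x := Real.cos_pos_of_mem_Ioo ⟨by linarith, by linarith⟩
  have hdiff : d / 20 = 2 * Real.sin ((x - y₀) / 2) * Real.cos ((x + y₀) / 2) := by
    rw [← Real.sin_sub_sin, hsx, hs]; ring
  have hc1 : 1 / 2 ≤ Real.cos ((x + y₀) / 2) := by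
    rw [← Real.cos_pi_div_three, ← Real.cos_abs ((x + y₀) / 2)]
    refine Real.cos_le_cos_of_nonneg_of_le_pi (abs_nonneg _) (by linarith) ?_
    rw [abs_le]; constructor <;> linarith
  have hc2 := Real.cos_le_one ((x + y₀) / 2)
  have hsq : Real.sin (k * x) ^ 2 = 1 / 2 + Real.sin (2 * k * (x - y₀)) / 2 := by
    rw [Real.sin_sq_eq_half_sub]
    have : 2 * (k * x) = 2 * k * (x - y₀) + Real.pi / 2 := by
      rw [hy]; field_simp; ring
    rw [this, Real.cos_add_pi_div_two]
    ring
  -- Here `y = |x - y₀|` and `e = |d|`. Since `w/60 ≤ y ≤ πw/20` and `2/w ≤ k ≤ 5/w`, the phase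
  -- `2ky` lies in `[1/15, π/2]`, where the sine is monotone and at least `1/20`. The slope `1/20`
  -- is small enough to keep the phase below `π/2`.
  have main : ∀ y e : ℝ, 0 ≤ y → y ≤ Real.pi / 4 → w / 3 ≤ e → e ≤ w →
      e / 20 = 2 * Real.sin (y / 2) * Real.cos ((x + y₀) / 2) → 1 / 20 ≤ Real.sin (2 * k * y) := by
    intro y e hy hy' he he' heq
    have hsin : 0 ≤ Real.sin (y / 2) :=
      Real.sin_nonneg_of_nonneg_of_le_pi (by linarith) (by linarith)
    have hlow : e / 20 ≤ y := by
      have := Real.sin_le (show 0 ≤ y / 2 by linarith)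
      nlinarith
    have hup : y ≤ Real.pi * (w / 20) := by
      have h1 := Real.mul_le_sin (show 0 ≤ y / 2 by linarith) (by linarith)
      have h2 : Real.sin (y / 2) ≤ e / 20 := by nlinarith
      have h3 : 2 / Real.pi * (y / 2) = y / Real.pi := by ring
      rw [h3] at h1
      rw [mul_comm, ← div_le_iff₀ hpi]
      linarith
    have h1 : 1 / 15 ≤ 2 * k * y := by
      have h2 : (2 / w) * (w / 60) ≤ k * y :=
        mul_le_mul (by linarith) (by linarith) (by positivity) (by linarith)
      have h3 : (2 / w) * (w / 60) = 1 / 30 := by field_simp; norm_num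
      linarith
    have h2 : 2 * k * y ≤ Real.pi / 2 := by
      have h3 : k * y ≤ (5 / w) * (Real.pi * (w / 20)) :=
        mul_le_mul hk5 hup hy (by positivity)
      have h4 : (5 / w) * (Real.pi * (w / 20)) = Real.pi / 4 := by field_simp; norm_num
      linarith
    have h3 := Real.sin_gt_sub_cube (x := 1 / 15) (by norm_num)
    have h4 := Real.sin_le_sin_of_le_of_le_pi_div_two (by linarith) h2 h1
    norm_num at h3
    linarith
  refine ⟨x, hsx, hcos.ne', fun h => ?_, fun h => ?_⟩
  · have hxy : y₀ ≤ x := by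
      rw [hx, Real.le_arcsin_iff_sin_le' ⟨by linarith, by linarith⟩, hs]
      linarith
    have := main (x - y₀) d (by linarith) (by linarith) h hd'.2 hdiff
    rw [hsq]; linarith
  · have hxy : x ≤ y₀ := by
      rw [hx, Real.arcsin_le_iff_le_sin' ⟨by linarith, by linarith⟩, hs]
      linarith
    have := main (y₀ - x) (-d) (by linarith) (by linarith) (by linarith) (by linarith) (by
      have e : (y₀ - x) / 2 = -((x - y₀) / 2) := by ring
      rw [e, Real.sin_neg]; linarith)
    have e : 2 * k * (y₀ - x) = -(2 * k * (x - y₀)) := by ring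
    rw [e, Real.sin_neg] at this
    rw [hsq]; linarith

/-! The complete algorithm. -/

theorem exists_grid_point {t c η : ℝ} (hη : 0 < η) (G : ℕ) (h : |t - c| ≤ (G + 1) * η) :
    ∃ i : Fin (G + 1), |c + (2 * (i : ℕ) + 1 - (G + 1)) * η - t| ≤ η := by
  obtain ⟨h1, h2⟩ := abs_le.1 h
  set y := (t - c + (G + 1) * η) / (2 * η) with hy
  have hyt : t = c + (2 * y - (G + 1)) * η := by rw [hy]; field_simp; ring
  have hy0 : 0 ≤ y := div_nonneg (by linarith) (by linarith)
  have hy1 : y ≤ G + 1 := by rw [hy, div_le_iff₀ (by linarith)]; linarith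
  suffices ∃ i : Fin (G + 1), ((i : ℕ) : ℝ) ≤ y ∧ y ≤ (i : ℕ) + 1 by
    obtain ⟨i, hi, hi'⟩ := this
    refine ⟨i, ?_⟩
    have e : c + (2 * ((i : ℕ) : ℝ) + 1 - (G + 1)) * η - t = (2 * (i : ℕ) + 1 - 2 * y) * η := by
      rw [hyt]; ring
    rw [e, abs_mul, abs_of_pos hη]
    refine mul_le_of_le_one_left hη.le (abs_le.2 ⟨by linarith, by linarith⟩)
  -- The last cell is treated apart because `y` may equal `G + 1`, whose floor is out of range.
  by_cases hG : y < G
  · have hf : ⌊y⌋₊ < G := (Nat.floor_lt hy0).2 hG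
    exact ⟨⟨⌊y⌋₊, by omega⟩, Nat.floor_le hy0, (Nat.lt_floor_add_one y).le⟩
  · exact ⟨Fin.last G, by simpa using hG, by simpa using hy1⟩

theorem toss_prob_ge {r₁ r₂ : Type} (V₁ : Op r₁) (V₂ : Op r₂) (S : Set ℝ) (G : ℕ)
    (ξ : Fin (G + 1) → ℝ) (h : ∃ i, ξ i ∈ S) :
    1 / ((G : ℝ) + 1) ≤ (Algorithm.toss G fun i => .output (ξ i) : Algorithm r₁ r₂).prob V₁ V₂ S := by
  obtain ⟨i, hi⟩ := h
  rw [Algorithm.prob]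
  refine div_le_div_of_nonneg_right ?_ (by positivity)
  have h1 : (Algorithm.output (ξ i) : Algorithm r₁ r₂).prob V₁ V₂ S = 1 := by
    rw [Algorithm.prob, if_pos hi]
  rw [← h1]
  exact Finset.single_le_sum (f := fun i => (Algorithm.output (ξ i) : Algorithm r₁ r₂).prob V₁ V₂ S)
    (fun _ _ => Algorithm.prob_nonneg _ _ _ _) (Finset.mem_univ i)

/-- The programs for one round of the search. -/
theorem exists_round_program {k l a n b D : ℕ} [NeZero k] [NeZero l]
    (encK : Fin k ↪ (Fin a → Bool)) (encL : Fin l ↪ (Fin b → Bool))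
    (encH : Fin D ↪ (Fin n → Bool)) {z : Fin D → ℂ} (hz : EasyToPrepare encH z)
    (T₁ : Set (Fin a ⊕ Fin n)) (T₂ : Set (Fin n ⊕ Fin b)) {c w : ℝ} (hw : 0 < w)
    (hcw : |c| + w ≤ 1) :
    ∃ p : Σ m : ℕ, List (Instr (Fin a ⊕ Fin n) (Fin n ⊕ Fin b) m),
      ∀ {Q R : ℕ} {α : ℝ} {A ρ : Matrix (Fin D) (Fin D) ℂ}
        (UA : BlockEncoding encK encH 0 α Q A) (Uρ : PreparationUnitary encH encL z R ρ),
        UA.circuit.support = T₁ → Uρ.circuit.support = T₂ → 0 < α → 1 ≤ R + Q →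
        (∃ K : ℕ, programCost UA.circuit.matrix Uρ.circuit.matrix p.2 ≤ (K : ℕ∞) ∧
          (K : ℝ) ≤ 255 * ((R : ℝ) + Q) / w) ∧
        ∀ {t : ℝ}, (ρ * A).trace = ((α * t : ℝ) : ℂ) → |t - c| ≤ w →
          (w / 3 ≤ t - c → 21 / 40 ≤ ‖programMatrix UA.circuit.matrix Uρ.circuit.matrix p.2
            (fun _ => false) (fun _ => false)‖ ^ 2) ∧
          (t - c ≤ -(w / 3) → ‖programMatrix UA.circuit.matrix Uρ.circuit.matrix p.2
            (fun _ => false) (fun _ => false)‖ ^ 2 ≤ 19 / 40) := by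
  have hw1 : w ≤ 1 := by linarith [abs_nonneg c]
  have hc1 : |c| ≤ 1 := by linarith
  have hw2 : 2 ≤ 2 / w := by rw [le_div_iff₀ hw]; linarith
  -- This makes `2j + 1` an odd number between `2/w + 1` and `2/w + 3`.
  set j := ⌈1 / w⌉₊ with hj
  have hj1 : 1 / w ≤ j := Nat.le_ceil _
  have hj2 : (j : ℝ) < 1 / w + 1 := Nat.ceil_lt_add_one (by positivity)
  have e2 : 2 / w = 2 * (1 / w) := by ring
  set κ : ℝ := 2 * j + 1 with hκ
  have hκ1 : 2 / w + 1 ≤ κ := by linarith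
  have hκ2 : κ ≤ 2 / w + 3 := by linarith
  obtain ⟨-, -, hs0, hs1⟩ := sin_pi_div_bounds (show 3 ≤ κ by linarith)
  -- The amplitude becomes `sin(π/(4κ)) + (t - c)/20`, centred at the working point.
  obtain ⟨u, v, huv, huv'⟩ := exists_angles (β := Real.sin (Real.pi / (4 * κ)) - c / 20)
    (γ := 1 / 20) (by
      rw [abs_of_pos (show (0 : ℝ) < 1 / 20 by norm_num)]
      have h1 := abs_le.1 hc1
      have : |Real.sin (Real.pi / (4 * κ)) - c / 20| ≤ 19 / 20 :=
        abs_le.2 ⟨by linarith, by linarith⟩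
      linarith)
  obtain ⟨m, p, hp⟩ := exists_program encK encL encH hz T₁ T₂ u v j
  refine ⟨⟨m, p⟩, fun {Q R α A ρ} UA Uρ h₁ h₂ hα hRQ => ?_⟩
  obtain ⟨hcost, hprob⟩ := hp UA Uρ h₁ h₂ hα
  refine ⟨⟨_, hcost, ?_⟩, fun {t} ht htc => ?_⟩
  · have hRQ' : (1 : ℝ) ≤ (R : ℝ) + Q := by exact_mod_cast hRQ
    push_cast
    rw [← hκ]
    have h5 : κ ≤ 5 / w := by
      have : 3 ≤ 3 / w := by rw [le_div_iff₀ hw]; linarith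
      have e : 5 / w = 2 / w + 3 / w := by ring
      linarith
    -- `46(R+Q) + 5 ≤ 51(R+Q)` because `R + Q ≥ 1`.
    have e : 255 * ((R : ℝ) + Q) / w = 5 / w * (51 * ((R : ℝ) + Q)) := by ring
    rw [e]
    exact mul_le_mul h5 (by linarith) (by positivity) (by positivity)
  · obtain ⟨x, hx, hcos, hhigh, hlow⟩ := amplified_bias hw hw1 hκ1 hκ2 htc
    have := hprob (t := t) (x := x) ht (by rw [hx, huv, huv']; ring) hcos
    rw [this]
    exact ⟨hhigh, hlow⟩

/-- Every 800 votes gain a factor `exp(-1) ≤ 1/2`. The geometric factor makes the errors of all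
rounds sum to at most `exp(-Λ)`. -/
theorem pow_ceil_le (Λ : ℝ) (i : ℕ) :
    (799 / 800 : ℝ) ^ ⌈800 * (Λ + i + 1)⌉₊ ≤ Real.exp (-Λ) * (1 / 2) ^ (i + 1) := by
  have h1 : (799 / 800 : ℝ) ≤ Real.exp (-(1 / 800)) := by
    have := Real.add_one_le_exp (-(1 / 800) : ℝ)
    linarith
  have h2 : Real.exp (-1) ≤ 1 / 2 := by
    rw [Real.exp_neg, ← one_div]
    refine one_div_le_one_div_of_le (by norm_num) ?_
    have := Real.add_one_le_exp (1 : ℝ)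
    linarith
  calc (799 / 800 : ℝ) ^ ⌈800 * (Λ + i + 1)⌉₊ ≤ Real.exp (-(1 / 800)) ^ ⌈800 * (Λ + i + 1)⌉₊ := by
        gcongr
    _ = Real.exp (⌈800 * (Λ + i + 1)⌉₊ * -(1 / 800)) := (Real.exp_nat_mul _ _).symm
    _ ≤ Real.exp (-Λ + ((i + 1 : ℕ) : ℝ) * (-1)) := by
        rw [Real.exp_le_exp]
        have := Nat.le_ceil (800 * (Λ + i + 1))
        push_cast
        linarith
    _ = Real.exp (-Λ) * Real.exp (-1) ^ (i + 1) := by rw [Real.exp_add, Real.exp_nat_mul]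
    _ ≤ _ := by gcongr

theorem sum_half_pow_le (J : ℕ) : ∑ i ∈ Finset.range J, (1 / 2 : ℝ) ^ (i + 1) ≤ 1 := by
  have : ∀ J : ℕ, ∑ i ∈ Finset.range J, (1 / 2 : ℝ) ^ (i + 1) = 1 - (1 / 2) ^ J := by
    intro J
    induction J with
    | zero => simp
    | succ J ih => rw [Finset.sum_range_succ, ih, pow_succ]; ring
  rw [this]
  have : (0 : ℝ) < (1 / 2) ^ J := by positivity
  linarith

/-- The number of rounds needed to reach the half-width `W`. -/
theorem exists_rounds {W Λ : ℝ} (hW : 0 < W) (hΛ : 0 ≤ Λ) :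
    ∃ J : ℕ, (2 / 3 : ℝ) ^ J ≤ W ∧
      (2 * Λ + 6) * (3 / 2 : ℝ) ^ J - 2 * (Λ + J) - 6 ≤ (2 * Λ + 6) * (3 / 2) / W := by
  classical
  have hex : ∃ J : ℕ, (2 / 3 : ℝ) ^ J ≤ W := by
    obtain ⟨J, hJ⟩ := exists_pow_lt_of_lt_one hW (show (2 / 3 : ℝ) < 1 by norm_num)
    exact ⟨J, hJ.le⟩
  -- Minimality of the number of rounds gives `(3/2)^(J-1) ≤ 1/W`. With no rounds the left-hand side
  -- is zero.
  refine ⟨Nat.find hex, Nat.find_spec hex, ?_⟩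
  cases h : Nat.find hex with
  | zero =>
    have : 0 ≤ (2 * Λ + 6) * (3 / 2) / W := by positivity
    simpa using this
  | succ J =>
    have h1 : W < (2 / 3 : ℝ) ^ J := not_le.1 (Nat.find_min hex (by omega))
    have h2 : (3 / 2 : ℝ) ^ J ≤ 1 / W := by
      rw [le_div_iff₀ hW]
      have h3 : (3 / 2 : ℝ) ^ J * (2 / 3) ^ J = 1 := by rw [← mul_pow]; norm_num
      have h4 : (0 : ℝ) < (3 / 2) ^ J := by positivity
      nlinarith
    have h5 : (2 * Λ + 6) * (3 / 2 : ℝ) ^ (J + 1) ≤ (2 * Λ + 6) * (3 / 2) * (1 / W) := by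
      rw [pow_succ, mul_comm ((3 / 2 : ℝ) ^ J), ← mul_assoc]
      exact mul_le_mul_of_nonneg_left h2 (by positivity)
    have h6 : (0 : ℝ) ≤ ((J + 1 : ℕ) : ℝ) := Nat.cast_nonneg _
    have e : (2 * Λ + 6) * (3 / 2) / W = (2 * Λ + 6) * (3 / 2) * (1 / W) := by ring
    rw [e]
    linarith

/-- `G` trades success probability for cost: the search stops at half-width at most `(G+1)ε/α`, and
one of `G+1` cell centres, one of them within `ε/α` of `t`, is guessed uniformly. -/
theorem exists_algorithm {k l a n b D : ℕ} [NeZero k] [NeZero l]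
    (encK : Fin k ↪ (Fin a → Bool)) (encL : Fin l ↪ (Fin b → Bool))
    (encH : Fin D ↪ (Fin n → Bool)) {z : Fin D → ℂ} (hz : EasyToPrepare encH z)
    (T₁ : Set (Fin a ⊕ Fin n)) (T₂ : Set (Fin n ⊕ Fin b)) {α ε Λ : ℝ} (hα : 0 < α) (hε : 0 < ε)
    (hΛ : 0 ≤ Λ) (G : ℕ) :
    ∃ P : Algorithm (Fin a ⊕ Fin n) (Fin n ⊕ Fin b),
      ∀ {Q R : ℕ} {A ρ : Matrix (Fin D) (Fin D) ℂ}, A.IsHermitian → IsDensityOperator ρ →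
        ∀ (UA : BlockEncoding encK encH 0 α Q A) (Uρ : PreparationUnitary encH encL z R ρ),
        UA.circuit.support = T₁ → Uρ.circuit.support = T₂ → 1 ≤ R + Q →
        1 / ((G : ℝ) + 1) * (1 - Real.exp (-Λ)) ≤
          P.prob UA.circuit.matrix Uρ.circuit.matrix {ξ : ℝ | ‖(ξ : ℂ) - (ρ * A).trace‖ ≤ ε} ∧
        ∃ N : ℕ, P.cost UA.circuit.matrix Uρ.circuit.matrix ≤ (N : ℕ∞) ∧
          (N : ℝ) ≤ 306383 * (((R : ℝ) + Q) * (α / ε)) * ((2 * Λ + 6) / ((G : ℝ) + 1)) := by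
  have hex : ∀ c w : ℝ, ∃ p : Σ m : ℕ, List (Instr (Fin a ⊕ Fin n) (Fin n ⊕ Fin b) m),
      0 < w → |c| + w ≤ 1 → ∀ {Q R : ℕ} {α : ℝ} {A ρ : Matrix (Fin D) (Fin D) ℂ}
        (UA : BlockEncoding encK encH 0 α Q A) (Uρ : PreparationUnitary encH encL z R ρ),
        UA.circuit.support = T₁ → Uρ.circuit.support = T₂ → 0 < α → 1 ≤ R + Q →
        (∃ K : ℕ, programCost UA.circuit.matrix Uρ.circuit.matrix p.2 ≤ (K : ℕ∞) ∧
          (K : ℝ) ≤ 255 * ((R : ℝ) + Q) / w) ∧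
        ∀ {t : ℝ}, (ρ * A).trace = ((α * t : ℝ) : ℂ) → |t - c| ≤ w →
          (w / 3 ≤ t - c → 21 / 40 ≤ ‖programMatrix UA.circuit.matrix Uρ.circuit.matrix p.2
            (fun _ => false) (fun _ => false)‖ ^ 2) ∧
          (t - c ≤ -(w / 3) → ‖programMatrix UA.circuit.matrix Uρ.circuit.matrix p.2
            (fun _ => false) (fun _ => false)‖ ^ 2 ≤ 19 / 40) := by
    intro c w
    by_cases h : 0 < w ∧ |c| + w ≤ 1
    · obtain ⟨p, hp⟩ := exists_round_program encK encL encH hz T₁ T₂ h.1 h.2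
      exact ⟨p, fun _ _ => hp⟩
    -- Default program for intervals that the search never visits.
    · exact ⟨⟨0, []⟩, fun h1 h2 => absurd ⟨h1, h2⟩ h⟩
  choose prog hprog using hex
  have hη : 0 < ε / α := by positivity
  have hG : (0 : ℝ) < (G : ℝ) + 1 := by positivity
  set W := ((G : ℝ) + 1) * (ε / α) with hW
  obtain ⟨J, hJ, hJ'⟩ := exists_rounds (W := W) (by positivity) hΛ
  let N : ℕ → ℕ := fun i => ⌈800 * (Λ + i + 1)⌉₊
  let fin : ℝ → Algorithm (Fin a ⊕ Fin n) (Fin n ⊕ Fin b) := fun c =>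
    .toss G fun i => .output (α * (c + (2 * (i : ℕ) + 1 - (G + 1)) * (ε / α)))
  refine ⟨search prog N fin J 0 1, ?_⟩
  intro Q R A ρ hA hρ UA Uρ hT₁ hT₂ hRQ
  obtain ⟨t, ht, htr⟩ := exists_expectation hα hz hA hρ UA Uρ
  have h01 : |(0 : ℝ)| + 1 ≤ 1 := by simp
  constructor
  · have h1 := search_prob_ge UA.circuit.matrix_mem_unitaryGroup Uρ.circuit.matrix_mem_unitaryGroup
      prog N fin {ξ : ℝ | ‖(ξ : ℂ) - (ρ * A).trace‖ ≤ ε} (t := t) (g := 1 / ((G : ℝ) + 1))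
      (by positivity)
      (fun c w hw hcw htc =>
        ((hprog c w hw hcw UA Uρ hT₁ hT₂ hα hRQ).2 htr htc).1)
      (fun c w hw hcw htc =>
        ((hprog c w hw hcw UA Uρ hT₁ hT₂ hα hRQ).2 htr htc).2) J 0 1 one_pos h01
      (by simpa using ht) (by
        intro c' hc'
        refine toss_prob_ge _ _ _ G _ ?_
        obtain ⟨i, hi⟩ := exists_grid_point hη G (hc'.trans (by rw [mul_one]; exact hJ))
        refine ⟨i, ?_⟩
        rw [Set.mem_ofPred_eq, htr, ← Complex.ofReal_sub, Complex.norm_real, Real.norm_eq_abs,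
          ← mul_sub, abs_mul, abs_of_pos hα, ← le_div_iff₀' hα]
        exact hi)
    refine le_trans (mul_le_mul_of_nonneg_left ?_ (by positivity)) h1
    refine sub_le_sub_left ?_ _
    calc ∑ i ∈ Finset.range J, (799 / 800 : ℝ) ^ N i
        ≤ ∑ i ∈ Finset.range J, Real.exp (-Λ) * (1 / 2) ^ (i + 1) :=
          Finset.sum_le_sum fun i _ => pow_ceil_le Λ i
      _ = Real.exp (-Λ) * ∑ i ∈ Finset.range J, (1 / 2 : ℝ) ^ (i + 1) := by rw [Finset.mul_sum]
      _ ≤ Real.exp (-Λ) * 1 := by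
          gcongr
          exact sum_half_pow_le J
      _ = _ := mul_one _
  · obtain ⟨K, hK, hK'⟩ := search_cost_le (V₁ := UA.circuit.matrix) (V₂ := Uρ.circuit.matrix)
      prog N fin (fun c => by simp [fin, Algorithm.cost]) (κ := 255 * ((R : ℝ) + Q)) (Λ := Λ)
      (by positivity) (fun i => by
        have h1 := (Nat.ceil_lt_add_one (show 0 ≤ 800 * (Λ + i + 1) by positivity)).le
        have h2 : (0 : ℝ) ≤ i := Nat.cast_nonneg i
        change ((⌈800 * (Λ + i + 1)⌉₊ : ℕ) : ℝ) ≤ _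
        linarith)
      (fun c w hw hcw => (hprog c w hw hcw UA Uρ hT₁ hT₂ hα hRQ).1) J 0 1 one_pos h01
    refine ⟨K, hK, hK'.trans ?_⟩
    have hRQ0 : (0 : ℝ) ≤ (R : ℝ) + Q := by positivity
    calc 255 * ((R : ℝ) + Q) / 1 * (801 * ((2 * Λ + 6) * (3 / 2) ^ J - 2 * (Λ + J) - 6))
        ≤ 255 * ((R : ℝ) + Q) / 1 * (801 * ((2 * Λ + 6) * (3 / 2) / W)) := by gcongr
      -- `306382.5 = 255 · 801 · 3/2`.
      _ = 306382.5 * (((R : ℝ) + Q) * (α / ε)) * ((2 * Λ + 6) / ((G : ℝ) + 1)) := by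
          rw [hW]; field_simp; ring
      _ ≤ _ := by gcongr; norm_num

/-- Without any gates the block-encoded operator is `α` times the identity. -/
theorem trace_eq_of_no_gates {k a n D : ℕ} [NeZero k] {α : ℝ} (hα : 0 < α)
    {encK : Fin k ↪ (Fin a → Bool)} {encH : Fin D ↪ (Fin n → Bool)}
    {A ρ : Matrix (Fin D) (Fin D) ℂ} (hρ : IsDensityOperator ρ)
    (UA : BlockEncoding encK encH 0 α 0 A) : (ρ * A).trace = α := by
  have hα' : (α : ℂ) ≠ 0 := by exact_mod_cast hα.ne'
  have hnil : UA.circuit = ([] : List (Gate (Fin a ⊕ Fin n))) :=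
    List.eq_nil_of_length_eq_zero (Nat.le_zero.1 UA.length_le)
  have h1 : zeroBlock UA.U = 1 := by
    ext x y
    rw [zeroBlock, Matrix.of_apply, ← UA.implements, hnil, Matrix.submatrix_apply]
    change (1 : Op (Fin a ⊕ Fin n)) _ _ = _
    simp [Matrix.one_apply, (encPair_injective encK encH).eq_iff]
  have h2 : (α : ℂ)⁻¹ • A = 1 := by rw [eq_of_opNorm_sub_le_zero UA.accurate, h1]
  have h3 : A = (α : ℂ) • 1 := by rw [← h2, smul_smul, mul_inv_cancel₀ hα', one_smul]
  rw [h3, mul_smul_comm, mul_one, Matrix.trace_smul, hρ.2, smul_eq_mul, mul_one]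

end QEst

end

/-! ### Choice of the parameters for a given failure probability. -/

open QEst
theorem mainTheorem5 :
    ∃ C : ℝ, 0 < C ∧
      ∀ (D n a b k l : ℕ) [NeZero k] [NeZero l]
        (encH : Fin D ↪ (Fin n → Bool)) (encK : Fin k ↪ (Fin a → Bool))
        (encL : Fin l ↪ (Fin b → Bool))
        (z : Fin D → ℂ) (_ : EasyToPrepare encH z)
        (Q R : ℕ) (T₁ : Set (Fin a ⊕ Fin n)) (T₂ : Set (Fin n ⊕ Fin b))
        (α ε δ : ℝ) (_ : 0 < α) (_ : 0 < ε) (_ : 0 < δ) (_ : δ ≤ 1),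
        ∃ P : Algorithm (Fin a ⊕ Fin n) (Fin n ⊕ Fin b),
          ∀ (A ρ : Matrix (Fin D) (Fin D) ℂ) (_ : A.IsHermitian) (_ : IsDensityOperator ρ)
            (UA : BlockEncoding encK encH 0 α Q A) (Uρ : PreparationUnitary encH encL z R ρ)
            (_ : UA.circuit.support = T₁) (_ : Uρ.circuit.support = T₂),
            1 - δ ≤ P.prob UA.circuit.matrix Uρ.circuit.matrix
                {ξ : ℝ | ‖(ξ : ℂ) - (ρ * A).trace‖ ≤ ε} ∧
            ∃ N : ℕ, P.cost UA.circuit.matrix Uρ.circuit.matrix ≤ (N : ℕ∞) ∧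
              (N : ℝ) ≤ C * (((R : ℝ) + (Q : ℝ)) * (α / ε) * Real.log (1 / δ)) := by
  refine ⟨10000000, by norm_num, ?_⟩
  intro D n a b k l _ _ encH encK encL z hz Q R T₁ T₂ α ε δ hα hε hδ hδ1
  have hlog : Real.log (1 / δ) = -Real.log δ := by rw [one_div, Real.log_inv]
  have hlog0 : 0 ≤ Real.log (1 / δ) := by
    rw [hlog]; linarith [Real.log_nonpos hδ.le hδ1]
  by_cases hRQ : 1 ≤ R + Q
  swap
  -- No gate may be spent here, but the block-encoding is empty as well, which forces the trace to
  -- be `α`.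
  · obtain ⟨rfl, rfl⟩ : R = 0 ∧ Q = 0 := by omega
    refine ⟨.output α, fun A ρ hA hρ UA Uρ _ _ => ⟨?_, 0, ?_, ?_⟩⟩
    · rw [Algorithm.prob, if_pos]
      · linarith
      · rw [Set.mem_ofPred_eq, trace_eq_of_no_gates hα hρ UA, sub_self, norm_zero]
        exact hε.le
    · simp [Algorithm.cost]
    · simp
  -- The budget is zero and nothing is demanded.
  by_cases hδe : δ = 1
  · subst hδe
    refine ⟨.output 0, fun A ρ hA hρ UA Uρ _ _ => ⟨?_, 0, ?_, ?_⟩⟩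
    · rw [sub_self]; exact Algorithm.prob_nonneg _ _ _ _
    · simp [Algorithm.cost]
    · simp
  have hδ1' : δ < 1 := lt_of_le_of_ne hδ1 hδe
  have hl2 := Real.log_two_gt_d9
  have hl2' := Real.log_two_lt_d9
  have hX : 0 ≤ ((R : ℝ) + Q) * (α / ε) := by positivity
  suffices ∃ (Λ : ℝ) (G : ℕ), 0 ≤ Λ ∧ 1 - δ ≤ 1 / ((G : ℝ) + 1) * (1 - Real.exp (-Λ)) ∧
      (2 * Λ + 6) / ((G : ℝ) + 1) ≤ 32 * Real.log (1 / δ) by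
    obtain ⟨Λ, G, hΛ, h1, h2⟩ := this
    obtain ⟨P, hP⟩ := exists_algorithm encK encL encH hz T₁ T₂ hα hε hΛ G
    refine ⟨P, fun A ρ hA hρ UA Uρ hT₁ hT₂ => ?_⟩
    obtain ⟨h3, N, hN, hN'⟩ := hP hA hρ UA Uρ hT₁ hT₂ hRQ
    refine ⟨h1.trans h3, N, hN, hN'.trans ?_⟩
    calc 306383 * (((R : ℝ) + Q) * (α / ε)) * ((2 * Λ + 6) / ((G : ℝ) + 1))
        ≤ 306383 * (((R : ℝ) + Q) * (α / ε)) * (32 * Real.log (1 / δ)) := by gcongr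
      _ = 9804256 * (((R : ℝ) + Q) * (α / ε) * Real.log (1 / δ)) := by ring
      _ ≤ _ := by gcongr; norm_num
  by_cases hhalf : δ ≤ 1 / 2
  -- No guessing is needed: `exp(-Λ) = δ`, and `log(1/δ) ≥ log 2` absorbs the additive constant `6`.
  · refine ⟨Real.log (1 / δ), 0, hlog0, ?_, ?_⟩
    · rw [hlog, neg_neg, Real.exp_log hδ]; simp
    · have : Real.log 2 ≤ Real.log (1 / δ) := by
        refine Real.log_le_log (by norm_num) ?_
        rw [le_div_iff₀ hδ]; linarith
      simp only [Nat.cast_zero, zero_add, div_one]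
      linarith
  · rw [not_le] at hhalf
    have h0 : 0 < 1 - δ := by linarith
    -- With `Λ = log 2` and `G + 1 = ⌊y⌋` the success probability is at least `1/(2⌊y⌋) ≥ 1 - δ`.
    -- The cost fits because `log(1/δ) ≥ 1 - δ` and `(1 - δ)⌊y⌋ ≥ 1/4`, as `y < ⌊y⌋ + 1 ≤ 2⌊y⌋`.
    set y := 1 / (2 * (1 - δ)) with hy
    have hy1 : 1 ≤ y := by rw [hy, le_div_iff₀ (by linarith)]; linarith
    have hf1 : 1 ≤ ⌊y⌋₊ := (Nat.one_le_floor_iff y).2 hy1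
    have hcast : (((⌊y⌋₊ - 1 : ℕ) : ℝ) + 1) = (⌊y⌋₊ : ℝ) := by
      rw [Nat.cast_sub hf1]; push_cast; ring
    have hfy : (⌊y⌋₊ : ℝ) ≤ y := Nat.floor_le (by linarith)
    have hfy' : y < ⌊y⌋₊ + 1 := Nat.lt_floor_add_one y
    have hf0 : (1 : ℝ) ≤ (⌊y⌋₊ : ℝ) := by exact_mod_cast hf1
    have hyy : y * (1 - δ) = 1 / 2 := by rw [hy]; field_simp
    refine ⟨Real.log 2, ⌊y⌋₊ - 1, by linarith, ?_, ?_⟩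
    · rw [hcast, Real.exp_neg, Real.exp_log (by norm_num), div_mul_eq_mul_div, one_mul,
        le_div_iff₀ (by linarith)]
      nlinarith
    · rw [hcast, div_le_iff₀ (by linarith)]
      have h1 : 1 - δ ≤ Real.log (1 / δ) := by
        rw [hlog]; linarith [Real.log_le_sub_one_of_pos hδ]
      have h2 : 1 / 4 ≤ (1 - δ) * ⌊y⌋₊ := by nlinarith
      have h3 : (1 - δ) * ⌊y⌋₊ ≤ Real.log (1 / δ) * ⌊y⌋₊ := by gcongr
      linarith
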